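/- Let $(\mathsf V,\wedge,S)$ be a closed symmetric monoidal category with a zero object and with finite products, finite coproducts and coequalizers (for example the category of $S$-modules of Elmendorf–Kriz–Mandell–May, with $S$ the sphere spectrum). We write $\vee$ for coproducts, and $0$ for zero morphisms. **Symmetric sequences.** A (reduced) symmetric sequence is a functor $A$ from the groupoid of nonempty finite sets and bijections to $\mathsf V$. The composition product is $$(A\circ B)[T]=\bigvee_{s} A[T/s]\wedge\bigwedge_{j\in T/s}B[j],$$ where $s$ runs over the partitions of $T$ and $T/s$ is the set of blocks of $s$. Its unit $I$ has $I[T]=S$ if $|T|=1$ and $I[T]=0$ otherwise. The triple product is $$(A\circ B\circ C)[T]=\bigvee_{s,t}A[T/s]\wedge\bigwedge_{i\in T/s}B[\{j\in T/t: j\subseteq i\}]\wedge\bigwedge_{j\in T/t}C[j],$$ over pairs of partitions with $t$ refining $s$; it has canonical maps to $(A\circ B)\circ C$ and to $A\circ(B\circ C)$. **Box product.** For cosimplicial symmetric sequences $X,Y$ let $$(X\mathring\square Y)^n=\operatorname{colim}\Big(\bigvee_{r+s=n-1}X^r\circ Y^s\rightrightarrows\bigvee_{p+q=n}X^p\circ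 Y^q\Big),$$ the two maps being induced by $\mathrm{id}\circ d^0$ and $d^{r+1}\circ\mathrm{id}$. Its cosimplicial structure is: $d^i$ is induced by $d^i\circ \mathrm{id}$ for $i\le p$ and by $\mathrm{id}\circ d^{i-p}$ for $i>p$; $s^j$ is induced by $s^j\circ\mathrm{id}$ for $j<p$ and by $\mathrm{id}\circ s^{j-p}$ for $j\ge p$. The triple product $X\mathring\square Y\mathring\square Z$ has $n$-th term the quotient of $\bigvee_{p+q+r=n}X^p\circ Y^q\circ Z^r$ by the relations (for $p+q+r=n-1$) $d^{p+1}\circ\mathrm{id}\circ\mathrm{id}\sim\mathrm{id}\circ d^0\circ\mathrm{id}$ and $\mathrm{id}\circ d^{q+1}\circ\mathrm{id}\sim\mathrm{id}\circ\mathrm{id}\circ d^0$; the maps above induce $X\mathring\square Y\mathring\square Z\to(X\mathring\square Y)\mathring\square Z$ and $\theta\colon X\mathring\square Y\mathring\square Z\to X\mathring\square(Y\mathring\square Z)$. Let $\underline I$ be the constant cosimplicial object on $I$; there are canonical isomorphisms $\underline I\mathring\square X\cong X\cong X\mathring\square\underline I$. A *$\mathring\square$-monoid* is a cosimplicial symmetric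 sequence $X$ with maps $m\colon X\mathring\square X\to X$ and $u\colon\underline I\to X$ such that the two composites $$X\mathring\square X\mathring\square X\xrightarrow{\theta}X\mathring\square(X\mathring\square X)\xrightarrow{\mathrm{id}\mathring\square m}X\mathring\square X\xrightarrow{m}X,\qquad X\mathring\square X\mathring\square X\to(X\mathring\square X)\mathring\square X\xrightarrow{m\mathring\square\mathrm{id}}X\mathring\square X\xrightarrow{m}X$$ agree (associativity), and such that $\underline I\mathring\square X\xrightarrow{u\mathring\square\mathrm{id}}X\mathring\square X\xrightarrow{m}X$ and $X\mathring\square\underline I\xrightarrow{\mathrm{id}\mathring\square u}X\mathring\square X\xrightarrow{m}X$ are the canonical isomorphisms (unitality). **The object $C(\underline S)$.** For a nonempty finite set $T$ order the partitions of $T$ by $\lambda\le\lambda'$ if $\lambda'$ refines $\lambda$; $\min$ is the partition with one block and $\max$ the partition into singletons. Let $P(T)_\bullet$ be the pointed simplicial set whose $k$-simplices are a basepoint and the chains $\lambda_0\le\dots\le\lambda_k$ of partitions of $T$ with $\lambda_0=\min$ and $\lambda_k=\max$; faces delete and degeneracies repeat entries, and a chain which does not start with $\min$ or does not end with $\max$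 is identified with the basepoint. Then $C(\underline S)^k[T]=\prod S$, the product over the $k$-simplices of $P(T)$ different from the basepoint; for $f\colon[m]\to[n]$ the component of $f_*\colon C(\underline S)^m[T]\to C(\underline S)^n[T]$ at $\alpha$ is the projection to the factor $f^*\alpha$, or $0$ if $f^*\alpha$ is the basepoint. **The maps $m_{p,q}$.** Let $s$ be a partition of $T$. For $\gamma=(\lambda_0\le\dots\le\lambda_p)\in P(T/s)_p$ and $\beta_j=(\mu^j_0\le\dots\le\mu^j_q)\in P(j)_q$ $(j\in T/s)$, all different from the basepoint, let $\gamma\circ(\beta_j)_j\in P(T)_{p+q}$ be the chain $$\lambda_0'\le\dots\le\lambda_p'=\coprod_j\mu^j_0\le\dots\le\coprod_j\mu_q^j,$$ where $\lambda_i'$ is obtained from $\lambda_i$ by replacing each element of $T/s$ by its elements. Let $\Psi(\gamma')_s=(\gamma,(\beta_j)_j)$ if $\gamma'=\gamma\circ(\beta_j)_j$ is such a decomposition of $\gamma'\in P(T)_{p+q}$ (it is unique), and let $\Psi(\gamma')_s$ be the basepoint if there is none. Let $m_{p,q}\colon C(\underline S)^p\circ C(\underline S)^q\to C(\underline S)^{p+q}$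 be the map whose component at $\gamma'$, restricted to the summand of $s$, is the smash product of the projections to the factors of $\gamma$ and of the $\beta_j$ followed by $S\wedge\dots\wedge S\cong S$ if $\Psi(\gamma')_s=(\gamma,(\beta_j)_j)$, and $0$ if $\Psi(\gamma')_s$ is the basepoint. **Proposition.** $C(\underline S)$ has a $\mathring\square$-monoid structure $m\colon C(\underline S)\mathring\square C(\underline S)\to C(\underline S)$, $u\colon\underline I\to C(\underline S)$ such that the restriction of $m$ to $C(\underline S)^p\circ C(\underline S)^q$ is $m_{p,q}$ for all $p,q\ge0$, and such that $u$ is the coaugmentation given by the identity of $I$ (every component of $I[T]\to C(\underline S)^k[T]$ is the identity of $S$ if $|T|=1$, and $I[T]=0$ otherwise). In particular the maps $m_{p,q}$ satisfy $m_{p,q+1}(\mathrm{id}\circ d^0)=m_{p+1,q}(d^{p+1}\circ\mathrm{id})$ and are compatible with the cosimplicial structures and with bijections of finite sets. -/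

import Mathlib

open CategoryTheory MonoidalCategory Limits

universe v u

noncomputable section

namespace BoxCirc

/-! ### Tensor products indexed by finite sets -/

section UnorderedTensor

variable {V : Type u} [Category.{v} V] [MonoidalCategory V]

/-- `X j₁ ⊗ (X j₂ ⊗ (⋯ ⊗ 𝟙))` for a list `[j₁, j₂, …]` of indices. -/
@[reducible] def tensList {J : Type} (X : J → V) : List J → V
  | [] => 𝟙_ V
  | j :: l => X j ⊗ tensList X l

/-- Tensor product of a family of morphisms over a map of index sets. -/
def tensListMap {J J' : Type} {X : J → V} {X' : J' → V} (e : J → J')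
    (f : ∀ j j', e j = j' → (X j ⟶ X' j')) : (l : List J) →
      (tensList X l ⟶ tensList X' (l.map e))
  | [] => 𝟙 (𝟙_ V)
  | j :: l => f j (e j) rfl ⊗ₘ tensListMap e f l

/-- `Extract j l r`: the list `r` is `l` with one occurrence of `j` removed. -/
inductive Extract {J : Type} (j : J) : List J → List J → Type
  | head (l : List J) : Extract j (j :: l) l
  | tail (k : J) {l r : List J} (e : Extract j l r) : Extract j (k :: l) (k :: r)

/-- `Reorder l l'`: a way of rearranging `l` into `l'`. -/
inductive Reorder {J : Type} : List J → List J → Type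
  | nil : Reorder [] []
  | cons {j : J} {l r t : List J} (e : Extract j l r) (p : Reorder r t) : Reorder l (j :: t)

lemma nonempty_extract {J : Type} {j : J} {l r : List J} (h : l.Perm (j :: r)) :
    ∃ r', r'.Perm r ∧ Nonempty (Extract j l r') := by
  have hj : j ∈ l := h.symm.subset (by simp)
  obtain ⟨a, b, rfl⟩ := List.append_of_mem hj
  refine ⟨a ++ b, ?_, ?_⟩
  · exact (List.perm_middle.symm.trans h).cons_inv
  · clear h hj
    induction a with
    | nil => exact ⟨.head _⟩
    | cons k a ih => obtain ⟨e⟩ := ih; exact ⟨.tail k e⟩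

lemma nonempty_reorder {J : Type} {l l' : List J} (h : l.Perm l') : Nonempty (Reorder l l') := by
  induction l' generalizing l with
  | nil => obtain rfl := h.eq_nil; exact ⟨.nil⟩
  | cons j t ih =>
    obtain ⟨r, hr, ⟨e⟩⟩ := nonempty_extract h
    obtain ⟨p⟩ := ih hr
    exact ⟨.cons e p⟩

lemma Extract.perm {J : Type} {j : J} {l r : List J} (e : Extract j l r) : l.Perm (j :: r) := by
  induction e with
  | head l => rfl
  | tail k e ih => exact (ih.cons k).trans (List.Perm.swap _ _ _)

lemma Extract.unique {J : Type} {j : J} {l r r' : List J} (hl : l.Nodup) (e : Extract j l r)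
    (e' : Extract j l r') : r = r' ∧ HEq e e' := by
  induction e generalizing r' with
  | head l =>
    cases e' with
    | head => simp
    | tail _ e' => exact absurd (e'.perm.symm.subset (by simp)) (List.nodup_cons.1 hl).1
  | tail k e ih =>
    cases e' with
    | head => exact absurd (e.perm.symm.subset (by simp)) (List.nodup_cons.1 hl).1
    | tail _ e' =>
      obtain ⟨rfl, h⟩ := ih (List.nodup_cons.1 hl).2 e'
      obtain rfl := eq_of_heq h
      simp

lemma Reorder.unique {J : Type} {l l' : List J} (hl : l.Nodup) (p p' : Reorder l l') : p = p' := by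
  induction p with
  | nil => cases p'; rfl
  | cons e p ih =>
    cases p' with
    | cons e' p' =>
      obtain ⟨rfl, h⟩ := Extract.unique hl e e'
      obtain rfl := eq_of_heq h
      rw [ih (List.nodup_cons.1 (e.perm.nodup_iff.1 hl)).2 p']

/-- The image of an extraction under a map of index sets. -/
def Extract.map {J J' : Type} (f : J → J') {j : J} {l r : List J} :
    Extract j l r → Extract (f j) (l.map f) (r.map f)
  | .head l => .head _
  | .tail k e => .tail (f k) (e.map f)

/-- The image of a rearrangement under a map of index sets. -/
def Reorder.map {J J' : Type} (f : J → J') {l l' : List J} :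
    Reorder l l' → Reorder (l.map f) (l'.map f)
  | .nil => .nil
  | .cons e p => .cons (e.map f) (p.map f)

/-- The trivial rearrangement. -/
def Reorder.refl {J : Type} : (l : List J) → Reorder l l
  | [] => .nil
  | j :: l => .cons (.head l) (.refl l)

section Symmetric

variable [SymmetricCategory V]

/-- `X ⊗ (Y ⊗ Z) ≅ Y ⊗ (X ⊗ Z)` by the symmetry. -/
def swapHead (X Y Z : V) : X ⊗ (Y ⊗ Z) ⟶ Y ⊗ (X ⊗ Z) :=
  (α_ X Y Z).inv ≫ (β_ X Y).hom ▷ Z ≫ (α_ Y X Z).hom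

lemma swapHead_natural {X X' Y Y' Z Z' : V} (f : X ⟶ X') (g : Y ⟶ Y') (h : Z ⟶ Z') :
    (f ⊗ₘ (g ⊗ₘ h)) ≫ swapHead X' Y' Z' = swapHead X Y Z ≫ (g ⊗ₘ (f ⊗ₘ h)) := by
  simp only [swapHead, Category.assoc]
  rw [associator_inv_naturality_assoc, ← associator_naturality]
  simp only [← tensorHom_id, tensorHom_comp_tensorHom_assoc, Category.assoc,
    BraidedCategory.braiding_naturality, Category.comp_id, Category.id_comp]

@[simp]
lemma swapHead_swapHead (X Y Z : V) : swapHead X Y Z ≫ swapHead Y X Z = 𝟙 _ := by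
  simp [swapHead, ← comp_whiskerRight_assoc]

lemma swapHead_yang_baxter (X Y Z W : V) :
    swapHead X Y (Z ⊗ W) ≫ Y ◁ swapHead X Z W ≫ swapHead Y Z (X ⊗ W) =
      X ◁ swapHead Y Z W ≫ swapHead X Z (Y ⊗ W) ≫ Z ◁ swapHead X Y W := by
  simp only [swapHead]
  calc
    _ = 𝟙 _ ⊗≫ ((α_ X Y Z).inv ≫ (β_ X Y).hom ▷ Z ≫ (α_ Y X Z).hom ≫ Y ◁ (β_ X Z).hom ≫
          (α_ Y Z X).inv ≫ (β_ Y Z).hom ▷ X ≫ (α_ Z Y X).hom) ▷ W ⊗≫ 𝟙 _ := by monoidal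
    _ = _ := by rw [BraidedCategory.yang_baxter]; monoidal

/-- The rearrangement of tensor factors given by an extraction. -/
def Extract.hom {J : Type} (X : J → V) {j : J} {l r : List J} :
    Extract j l r → (tensList X l ⟶ X j ⊗ tensList X r)
  | .head _ => 𝟙 _
  | .tail k e => X k ◁ e.hom X ≫ swapHead _ _ _

/-- The rearrangement of tensor factors given by a rearrangement of indices. -/
def Reorder.hom {J : Type} (X : J → V) {l l' : List J} :
    Reorder l l' → (tensList X l ⟶ tensList X l')
  | .nil => 𝟙 _
  | .cons (j := j) e p => e.hom X ≫ X j ◁ p.hom X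

lemma Extract.exchange {J : Type} (X : J → V) {j k : J} {l r r' : List J} (e : Extract k l r)
    (e' : Extract j r r') : ∃ (s : List J) (d : Extract j l s) (d' : Extract k s r'),
      e.hom X ≫ X k ◁ e'.hom X ≫ swapHead _ _ _ = d.hom X ≫ X j ◁ d'.hom X := by
  induction e generalizing r' with
  | head l => exact ⟨_, .tail k e', .head _, by simp [Extract.hom]⟩
  | tail i e ih =>
    cases e' with
    | head => exact ⟨_, .head _, e, by simp [Extract.hom]⟩
    | tail _ e' =>
      obtain ⟨s, d, d', h⟩ := ih e'
      refine ⟨_, .tail i d, .tail i d', ?_⟩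
      have n1 := swapHead_natural (𝟙 (X i)) (𝟙 (X k)) (e'.hom X)
      have n2 := swapHead_natural (𝟙 (X i)) (𝟙 (X j)) (d'.hom X)
      simp only [id_tensorHom] at n1 n2
      simp only [Extract.hom, Category.assoc, MonoidalCategory.whiskerLeft_comp]
      rw [← reassoc_of% n1, ← reassoc_of% n2, swapHead_yang_baxter]
      simp only [← MonoidalCategory.whiskerLeft_comp_assoc, Category.assoc]
      rw [h]

lemma Reorder.exchange {J : Type} (X : J → V) {j : J} {l l' r' : List J} (p : Reorder l l')
    (e : Extract j l' r') : ∃ (r : List J) (d : Extract j l r) (q : Reorder r r'),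
      p.hom X ≫ e.hom X = d.hom X ≫ X j ◁ q.hom X := by
  induction p generalizing r' with
  | nil => cases e
  | @cons k _ _ _ e₀ p ih =>
    cases e with
    | head => exact ⟨_, e₀, p, by simp [Extract.hom, Reorder.hom]⟩
    | tail _ e =>
      obtain ⟨r, d, q, h⟩ := ih e
      obtain ⟨s, d₁, d₂, h'⟩ := Extract.exchange X e₀ d
      refine ⟨s, d₁, .cons d₂ q, ?_⟩
      simp only [Reorder.hom, Extract.hom, Category.assoc]
      rw [← whiskerLeft_comp_assoc, h, MonoidalCategory.whiskerLeft_comp_assoc]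
      have n := swapHead_natural (𝟙 (X k)) (𝟙 (X j)) (q.hom X)
      simp only [id_tensorHom] at n
      rw [n, reassoc_of% h', MonoidalCategory.whiskerLeft_comp]

lemma Reorder.exists_comp {J : Type} (X : J → V) {l l' l'' : List J} (p : Reorder l l')
    (q : Reorder l' l'') : ∃ s : Reorder l l'', p.hom X ≫ q.hom X = s.hom X := by
  induction q generalizing l with
  | nil => exact ⟨p, by simp [Reorder.hom]⟩
  | cons e q ih =>
    obtain ⟨r, d, p', h⟩ := Reorder.exchange X p e
    obtain ⟨s, hs⟩ := ih p'
    refine ⟨.cons d s, ?_⟩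
    simp only [Reorder.hom]
    rw [reassoc_of% h, ← MonoidalCategory.whiskerLeft_comp, hs]

lemma Reorder.hom_comp {J : Type} (X : J → V) {l l' l'' : List J} (hl : l.Nodup)
    (p : Reorder l l') (q : Reorder l' l'') (s : Reorder l l'') :
    p.hom X ≫ q.hom X = s.hom X := by
  obtain ⟨s', h⟩ := Reorder.exists_comp X p q
  rw [h, Reorder.unique hl s' s]

lemma Reorder.hom_refl {J : Type} (X : J → V) (l : List J) :
    (Reorder.refl l).hom X = 𝟙 _ := by
  induction l with
  | nil => rfl
  | cons j l ih => simp [Reorder.refl, Reorder.hom, Extract.hom, ih]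

lemma Extract.hom_naturality {J J' : Type} {X : J → V} {X' : J' → V} (e : J → J')
    (f : ∀ j j', e j = j' → (X j ⟶ X' j')) {j : J} {l r : List J} (d : Extract j l r) :
    tensListMap e f l ≫ (d.map e).hom X' = d.hom X ≫ (f j _ rfl ⊗ₘ tensListMap e f r) := by
  induction d with
  | head l => simp only [Extract.map, Extract.hom, tensListMap, Category.id_comp]; exact Category.comp_id _
  | tail k d ih =>
    simp only [Extract.map, Extract.hom, tensListMap, Category.assoc]
    rw [← swapHead_natural, tensorHom_comp_whiskerLeft_assoc, ih,
      whiskerLeft_comp_tensorHom_assoc]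

lemma Reorder.hom_naturality {J J' : Type} {X : J → V} {X' : J' → V} (e : J → J')
    (f : ∀ j j', e j = j' → (X j ⟶ X' j')) {l l' : List J} (p : Reorder l l') :
    tensListMap e f l ≫ (p.map e).hom X' = p.hom X ≫ tensListMap e f l' := by
  induction p with
  | nil => simp [Reorder.map, Reorder.hom, tensListMap]
  | cons d p ih =>
    simp only [Reorder.map, Reorder.hom, tensListMap, Category.assoc]
    rw [reassoc_of% (Extract.hom_naturality e f d), tensorHom_comp_whiskerLeft, ih,
      whiskerLeft_comp_tensorHom]
/-- An enumeration without repetitions of a finite type. -/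
def enum (J : Type) [Finite J] : List J := (@Finset.univ J (Fintype.ofFinite J)).toList

lemma nodup_enum (J : Type) [Finite J] : (enum J).Nodup := Finset.nodup_toList _

lemma mem_enum {J : Type} [Finite J] (j : J) : j ∈ enum J := by simp [enum]

lemma perm_enum {J : Type} [Finite J] {l : List J} (hl : l.Nodup) (h : ∀ j, j ∈ l) :
    l.Perm (enum J) :=
  (List.perm_ext_iff_of_nodup hl (nodup_enum J)).2 fun j => ⟨fun _ => mem_enum j, fun _ => h j⟩

lemma perm_map_enum {J J' : Type} [Finite J] [Finite J'] (e : J ≃ J') :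
    ((enum J).map e).Perm (enum J') :=
  perm_enum ((nodup_enum J).map e.injective) fun j =>
    List.mem_map.2 ⟨e.symm j, mem_enum _, e.apply_symm_apply j⟩

/-- The canonical comparison of the tensor products over two orderings of the same indices. -/
def reorderHom {J : Type} (X : J → V) {l l' : List J} (h : l.Perm l') :
    tensList X l ⟶ tensList X l' :=
  (Classical.choice (nonempty_reorder h)).hom X

lemma reorderHom_eq {J : Type} (X : J → V) {l l' : List J} (hl : l.Nodup) (h : l.Perm l')
    (p : Reorder l l') : reorderHom X h = p.hom X := by
  exact congrArg (Reorder.hom X) (Reorder.unique hl _ p)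

lemma reorderHom_comp {J : Type} (X : J → V) {l l' l'' : List J} (hl : l.Nodup) (h : l.Perm l')
    (h' : l'.Perm l'') : reorderHom X h ≫ reorderHom X h' = reorderHom X (h.trans h') :=
  Reorder.hom_comp X hl _ _ _

lemma reorderHom_refl {J : Type} (X : J → V) {l : List J} (hl : l.Nodup) (h : l.Perm l) :
    reorderHom X h = 𝟙 _ := by
  rw [reorderHom_eq X hl h (.refl l), Reorder.hom_refl]

lemma reorderHom_naturality {J J' : Type} {X : J → V} {X' : J' → V} (e : J → J')
    (he : Function.Injective e) (f : ∀ j j', e j = j' → (X j ⟶ X' j')) {l l' : List J}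
    (hl : l.Nodup) (h : l.Perm l') :
    tensListMap e f l ≫ reorderHom X' (h.map e) = reorderHom X h ≫ tensListMap e f l' := by
  obtain ⟨p⟩ := nonempty_reorder h
  rw [reorderHom_eq X hl h p, reorderHom_eq X' (hl.map he) _ (p.map e),
    Reorder.hom_naturality]

/-- The tensor product `⨂_{j ∈ J} X j` of a family of objects indexed by a finite set. -/
@[reducible] def tens {J : Type} [Finite J] (X : J → V) : V := tensList X (enum J)

/-- The morphism `⨂_{j ∈ J} X j ⟶ ⨂_{j' ∈ J'} X' j'` induced by a bijection `e : J ≃ J'` and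
morphisms `X j ⟶ X' (e j)`. -/
def tensMap {J J' : Type} [Finite J] [Finite J'] {X : J → V} {X' : J' → V} (e : J ≃ J')
    (f : ∀ j j', e j = j' → (X j ⟶ X' j')) : tens X ⟶ tens X' :=
  tensListMap e f (enum J) ≫ reorderHom X' (perm_map_enum e)

lemma eqToHom_tensList_cons {J : Type} (X : J → V) (j : J) {l l' : List J} (h : l = l') :
    eqToHom (congrArg (fun t => tensList X (j :: t)) h) =
      X j ◁ eqToHom (congrArg (tensList X) h) := by
  subst h; simp

lemma tensListMap_comp {J J' J'' : Type} {X : J → V} {X' : J' → V} {X'' : J'' → V} (e : J → J')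
    (e' : J' → J'') (f : ∀ j j', e j = j' → (X j ⟶ X' j'))
    (f' : ∀ j j', e' j = j' → (X' j ⟶ X'' j'))
    (f'' : ∀ j j', e' (e j) = j' → (X j ⟶ X'' j'))
    (hf : ∀ j, f j (e j) rfl ≫ f' (e j) (e' (e j)) rfl = f'' j _ rfl) (l : List J)
    (hl : l.map (fun j => e' (e j)) = (l.map e).map e') :
    tensListMap e f l ≫ tensListMap e' f' (l.map e) =
      tensListMap (fun j => e' (e j)) f'' l ≫ eqToHom (congrArg (tensList X'') hl) := by
  induction l with
  | nil => rfl
  | cons j l ih =>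
    have hl' : l.map (fun j => e' (e j)) = (l.map e).map e' := by simp
    have := eqToHom_tensList_cons X'' (e' (e j)) hl'
    change (f j (e j) rfl ⊗ₘ tensListMap e f l) ≫
      (f' (e j) _ rfl ⊗ₘ tensListMap e' f' (l.map e)) =
      (f'' j _ rfl ⊗ₘ tensListMap (fun j => e' (e j)) f'' l) ≫
        eqToHom (congrArg (fun t => tensList X'' (e' (e j) :: t)) hl')
    rw [this, tensorHom_comp_tensorHom, hf, ih hl', tensorHom_comp_whiskerLeft]

lemma eqToHom_reorderHom {J : Type} (X : J → V) {l l' l'' : List J} (h : l = l')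
    (h' : l'.Perm l'') :
    eqToHom (congrArg (tensList X) h) ≫ reorderHom X h' = reorderHom X (h ▸ h') := by
  subst h; simp

lemma tensMap_comp {J J' J'' : Type} [Finite J] [Finite J'] [Finite J''] {X : J → V} {X' : J' → V}
    {X'' : J'' → V} (e : J ≃ J') (e' : J' ≃ J'') (e'' : J ≃ J'')
    (f : ∀ j j', e j = j' → (X j ⟶ X' j'))
    (f' : ∀ j j', e' j = j' → (X' j ⟶ X'' j'))
    (f'' : ∀ j j', e'' j = j' → (X j ⟶ X'' j'))
    (he : ∀ j, e' (e j) = e'' j)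
    (hf : ∀ j, f j (e j) rfl ≫ f' (e j) (e'' j) (he j) = f'' j _ rfl) :
    tensMap e f ≫ tensMap e' f' = tensMap e'' f'' := by
  obtain rfl : e'' = e.trans e' := by ext j; exact (he j).symm
  have rfl_map : (enum J).map (fun j => e' (e j)) = ((enum J).map e).map e' := by
    rw [List.map_map]; rfl
  have hn : ((enum J).map e).Nodup := (nodup_enum J).map e.injective
  simp only [tensMap, Category.assoc]
  rw [← reassoc_of% (reorderHom_naturality e' e'.injective f' hn (perm_map_enum e)),
    reorderHom_comp X'' (hn.map e'.injective),
    reassoc_of% (tensListMap_comp e e' f f' f'' hf (enum J) rfl_map)]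
  rw [eqToHom_reorderHom X'' rfl_map]
  rfl

lemma tensListMap_id {J : Type} {X : J → V} (f : ∀ j j', id j = j' → (X j ⟶ X j'))
    (hf : ∀ j, f j j rfl = 𝟙 _) (l : List J) (hl : l = l.map id) :
    tensListMap id f l = eqToHom (congrArg (tensList X) hl) := by
  induction l with
  | nil => rfl
  | cons j l ih =>
    have hl' : l = l.map id := by simp
    have := eqToHom_tensList_cons X j hl'
    change f j j rfl ⊗ₘ tensListMap id f l =
      eqToHom (congrArg (fun t => tensList X (j :: t)) hl')
    rw [this, hf, ih hl', id_tensorHom]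

lemma tensMap_id {J : Type} [Finite J] {X : J → V} (e : J ≃ J)
    (f : ∀ j j', e j = j' → (X j ⟶ X j')) (he : ∀ j, e j = j)
    (hf : ∀ j, f j j (he j) = 𝟙 _) :
    tensMap e f = 𝟙 _ := by
  obtain rfl : e = Equiv.refl J := by ext j; exact he j
  have h : enum J = (enum J).map id := (List.map_id _).symm
  have h' := tensListMap_id f hf (enum J) h
  change tensListMap id f (enum J) ≫ reorderHom X (perm_map_enum (Equiv.refl J)) = 𝟙 _
  rw [h']
  exact (eqToHom_reorderHom X h _).trans (reorderHom_refl X (nodup_enum J) _)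
/-- The morphism of tensor products induced by morphisms of the factors. -/
def tensListHom {J : Type} {X Y : J → V} (f : ∀ j, X j ⟶ Y j) :
    (l : List J) → (tensList X l ⟶ tensList Y l)
  | [] => 𝟙 (𝟙_ V)
  | j :: l => f j ⊗ₘ tensListHom f l

lemma tensListHom_id {J : Type} (X : J → V) (l : List J) :
    tensListHom (fun j => 𝟙 (X j)) l = 𝟙 _ := by
  induction l with
  | nil => rfl
  | cons j l ih => simp [tensListHom, ih]

lemma tensListHom_comp {J : Type} {X Y Z : J → V} (f : ∀ j, X j ⟶ Y j) (g : ∀ j, Y j ⟶ Z j)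
    (l : List J) :
    tensListHom f l ≫ tensListHom g l = tensListHom (fun j => f j ≫ g j) l := by
  induction l with
  | nil => simp [tensListHom]
  | cons j l ih => simp [tensListHom, ih]

lemma Extract.hom_natural {J : Type} {X Y : J → V} (f : ∀ j, X j ⟶ Y j) {j : J} {l r : List J}
    (d : Extract j l r) :
    tensListHom f l ≫ d.hom Y = d.hom X ≫ (f j ⊗ₘ tensListHom f r) := by
  induction d with
  | head l => simp [Extract.hom, tensListHom]
  | tail k d ih =>
    simp only [Extract.hom, tensListHom, Category.assoc]
    rw [← swapHead_natural, tensorHom_comp_whiskerLeft_assoc, ih,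
      whiskerLeft_comp_tensorHom_assoc]

lemma Reorder.hom_natural {J : Type} {X Y : J → V} (f : ∀ j, X j ⟶ Y j) {l l' : List J}
    (p : Reorder l l') :
    tensListHom f l ≫ p.hom Y = p.hom X ≫ tensListHom f l' := by
  induction p with
  | nil => simp [Reorder.hom, tensListHom]
  | cons d p ih =>
    simp only [Reorder.hom, tensListHom, Category.assoc]
    rw [reassoc_of% (Extract.hom_natural f d), tensorHom_comp_whiskerLeft, ih,
      whiskerLeft_comp_tensorHom]

lemma reorderHom_natural {J : Type} {X Y : J → V} (f : ∀ j, X j ⟶ Y j) {l l' : List J}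
    (h : l.Perm l') :
    tensListHom f l ≫ reorderHom Y h = reorderHom X h ≫ tensListHom f l' :=
  Reorder.hom_natural f _

/-- The morphism `⨂_{j ∈ J} X j ⟶ ⨂_{j ∈ J} Y j` induced by morphisms of the factors. -/
def tensHom {J : Type} [Finite J] {X Y : J → V} (f : ∀ j, X j ⟶ Y j) : tens X ⟶ tens Y :=
  tensListHom f (enum J)

lemma tensHom_id {J : Type} [Finite J] (X : J → V) : tensHom (fun j => 𝟙 (X j)) = 𝟙 _ :=
  tensListHom_id X _

lemma tensHom_comp {J : Type} [Finite J] {X Y Z : J → V} (f : ∀ j, X j ⟶ Y j)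
    (g : ∀ j, Y j ⟶ Z j) : tensHom f ≫ tensHom g = tensHom (fun j => f j ≫ g j) :=
  tensListHom_comp f g _

lemma tensListMap_natural {J J' : Type} {X Y : J → V} {X' Y' : J' → V}
    (e : J → J') (f : ∀ j, X j ⟶ Y j) (f' : ∀ j, X' j ⟶ Y' j)
    (g : ∀ j j', e j = j' → (X j ⟶ X' j')) (g' : ∀ j j', e j = j' → (Y j ⟶ Y' j'))
    (h : ∀ j, f j ≫ g' j (e j) rfl = g j (e j) rfl ≫ f' (e j)) (l : List J) :
    tensListHom f l ≫ tensListMap e g' l = tensListMap e g l ≫ tensListHom f' (l.map e) := by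
  induction l with
  | nil => rfl
  | cons j l ih =>
    change (f j ⊗ₘ tensListHom f l) ≫ (g' j _ rfl ⊗ₘ tensListMap e g' l) =
      (g j _ rfl ⊗ₘ tensListMap e g l) ≫ (f' (e j) ⊗ₘ tensListHom f' (l.map e))
    rw [tensorHom_comp_tensorHom, tensorHom_comp_tensorHom, h, ih]

lemma tensMap_natural {J J' : Type} [Finite J] [Finite J'] {X Y : J → V} {X' Y' : J' → V}
    (e : J ≃ J') (f : ∀ j, X j ⟶ Y j) (f' : ∀ j, X' j ⟶ Y' j)
    (g : ∀ j j', e j = j' → (X j ⟶ X' j')) (g' : ∀ j j', e j = j' → (Y j ⟶ Y' j'))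
    (h : ∀ j, f j ≫ g' j (e j) rfl = g j (e j) rfl ≫ f' (e j)) :
    tensHom f ≫ tensMap e g' = tensMap e g ≫ tensHom f' := by
  simp only [tensMap, tensHom, Category.assoc]
  rw [← reorderHom_natural, reassoc_of% (tensListMap_natural e f f' g g' h)]

/-- The shuffle `(⨂_j X j) ⊗ (⨂_j Y j) ⟶ ⨂_j (X j ⊗ Y j)`, for lists. -/
def zipList {J : Type} (X Y : J → V) :
    (l : List J) → (tensList X l ⊗ tensList Y l ⟶ tensList (fun j => X j ⊗ Y j) l)
  | [] => (λ_ (𝟙_ V)).hom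
  | j :: l => tensorμ (X j) (tensList X l) (Y j) (tensList Y l) ≫ (X j ⊗ Y j) ◁ zipList X Y l

lemma zipList_natural {J : Type} {X Y X' Y' : J → V} (f : ∀ j, X j ⟶ X' j)
    (g : ∀ j, Y j ⟶ Y' j) (l : List J) :
    (tensListHom f l ⊗ₘ tensListHom g l) ≫ zipList X' Y' l =
      zipList X Y l ≫ tensListHom (fun j => f j ⊗ₘ g j) l := by
  induction l with
  | nil => simp [tensListHom, zipList]
  | cons j l ih =>
    simp only [tensListHom, zipList, Category.assoc]
    rw [tensorμ_natural_assoc, tensorHom_comp_whiskerLeft, ih, whiskerLeft_comp_tensorHom]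

/-- The shuffle `(⨂_j X j) ⊗ (⨂_j Y j) ⟶ ⨂_j (X j ⊗ Y j)`. -/
def zip {J : Type} [Finite J] (X Y : J → V) :
    tens X ⊗ tens Y ⟶ tens (fun j => X j ⊗ Y j) :=
  zipList X Y (enum J)

lemma zip_natural {J : Type} [Finite J] {X Y X' Y' : J → V} (f : ∀ j, X j ⟶ X' j)
    (g : ∀ j, Y j ⟶ Y' j) :
    (tensHom f ⊗ₘ tensHom g) ≫ zip X' Y' = zip X Y ≫ tensHom (fun j => f j ⊗ₘ g j) :=
  zipList_natural f g _

/-- Splitting a tensor product over a concatenation of lists. -/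
def splitList {J : Type} (X : J → V) :
    (l l' : List J) → (tensList X (l ++ l') ⟶ tensList X l ⊗ tensList X l')
  | [], l' => (λ_ (tensList X l')).inv
  | j :: l, l' => X j ◁ splitList X l l' ≫ (α_ _ _ _).inv

lemma splitList_natural {J : Type} {X Y : J → V} (f : ∀ j, X j ⟶ Y j) (l l' : List J) :
    tensListHom f (l ++ l') ≫ splitList Y l l' =
      splitList X l l' ≫ (tensListHom f l ⊗ₘ tensListHom f l') := by
  induction l with
  | nil =>
    change tensListHom f l' ≫ (λ_ (tensList Y l')).inv =
      (λ_ (tensList X l')).inv ≫ (𝟙 (𝟙_ V) ⊗ₘ tensListHom f l')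
    rw [leftUnitor_inv_naturality, id_tensorHom]
  | cons j l ih =>
    change (f j ⊗ₘ tensListHom f (l ++ l')) ≫ Y j ◁ splitList Y l l' ≫ (α_ _ _ _).inv =
      (X j ◁ splitList X l l' ≫ (α_ _ _ _).inv) ≫
        ((f j ⊗ₘ tensListHom f l) ⊗ₘ tensListHom f l')
    rw [tensorHom_comp_whiskerLeft_assoc, ih, Category.assoc, ← associator_inv_naturality,
      whiskerLeft_comp_tensorHom_assoc]

/-- Bracketing a tensor product over the concatenation of the lists `φ i`. -/
def bracketList {I J : Type} (φ : I → List J) (X : J → V) :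
    (l : List I) → (tensList X (l.flatMap φ) ⟶ tensList (fun i => tensList X (φ i)) l)
  | [] => 𝟙 (𝟙_ V)
  | i :: l => splitList X (φ i) (l.flatMap φ) ≫ tensList X (φ i) ◁ bracketList φ X l

lemma bracketList_natural {I J : Type} (φ : I → List J) {X Y : J → V} (f : ∀ j, X j ⟶ Y j)
    (l : List I) :
    tensListHom f (l.flatMap φ) ≫ bracketList φ Y l =
      bracketList φ X l ≫ tensListHom (fun i => tensListHom f (φ i)) l := by
  induction l with
  | nil => rfl
  | cons i l ih =>
    change tensListHom f (φ i ++ l.flatMap φ) ≫ splitList Y (φ i) (l.flatMap φ) ≫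
        tensList Y (φ i) ◁ bracketList φ Y l =
      (splitList X (φ i) (l.flatMap φ) ≫ tensList X (φ i) ◁ bracketList φ X l) ≫
        (tensListHom f (φ i) ⊗ₘ tensListHom (fun i => tensListHom f (φ i)) l)
    rw [reassoc_of% (splitList_natural f (φ i) (l.flatMap φ)), tensorHom_comp_whiskerLeft, ih,
      Category.assoc, whiskerLeft_comp_tensorHom]

/-- The identification of a tensor product over a relabelled list. -/
def relabelList {I J : Type} (e : I → J) (X : J → V) :
    (l : List I) → (tensList X (l.map e) ⟶ tensList (fun i => X (e i)) l)
  | [] => 𝟙 (𝟙_ V)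
  | i :: l => X (e i) ◁ relabelList e X l

lemma relabelList_natural {I J : Type} (e : I → J) {X Y : J → V} (f : ∀ j, X j ⟶ Y j)
    (l : List I) :
    tensListHom f (l.map e) ≫ relabelList e Y l =
      relabelList e X l ≫ tensListHom (fun i => f (e i)) l := by
  induction l with
  | nil => rfl
  | cons i l ih =>
    change (f (e i) ⊗ₘ tensListHom f (l.map e)) ≫ Y (e i) ◁ relabelList e Y l =
      X (e i) ◁ relabelList e X l ≫ (f (e i) ⊗ₘ tensListHom (fun i => f (e i)) l)
    rw [tensorHom_comp_whiskerLeft, ih, whiskerLeft_comp_tensorHom]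

/-- The elements of the fibre of `g` over `i`, as a list. -/
@[reducible] def fibreList {K I : Type} [Finite K] (g : K → I) (i : I) : List K :=
  (enum {k // g k = i}).map Subtype.val

lemma perm_fibreList {K I : Type} [Finite K] [Finite I] (g : K → I) :
    (enum K).Perm ((enum I).flatMap (fibreList g)) := by
  have hm : ∀ i k, k ∈ fibreList g i ↔ g k = i := fun i k => by
    simp [fibreList, mem_enum]
  refine (perm_enum ?_ fun k => ?_).symm
  · rw [List.nodup_flatMap]
    refine ⟨fun i _ => (nodup_enum _).map Subtype.val_injective, ?_⟩
    refine (nodup_enum I).imp fun {i i'} hne => ?_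
    intro k hk hk'
    exact hne (((hm i k).1 hk).symm.trans ((hm i' k).1 hk'))
  · exact List.mem_flatMap.2 ⟨g k, mem_enum _, (hm _ k).2 rfl⟩

/-- For a map `g : K → I` of finite sets, the canonical morphism
`⨂_{k ∈ K} X k ⟶ ⨂_{i ∈ I} ⨂_{k ∈ g⁻¹(i)} X k`. -/
def fibrewise {K I : Type} [Finite K] [Finite I] (g : K → I) (X : K → V) :
    tens X ⟶ tens (fun i : I => tens (fun k : {k // g k = i} => X k.1)) :=
  reorderHom X (perm_fibreList g) ≫ bracketList (fibreList g) X (enum I) ≫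
    tensListHom (fun i => relabelList Subtype.val X (enum {k // g k = i})) (enum I)

lemma fibrewise_natural {K I : Type} [Finite K] [Finite I] (g : K → I) {X Y : K → V}
    (f : ∀ k, X k ⟶ Y k) :
    tensHom f ≫ fibrewise g Y =
      fibrewise g X ≫ tensHom (fun i : I => tensHom (fun k : {k // g k = i} => f k.1)) := by
  have h1 := reorderHom_natural f (perm_fibreList g)
  have h2 := bracketList_natural (fibreList g) f (enum I)
  have h3 : tensListHom (fun i => tensListHom f (fibreList g i)) (enum I) ≫
      tensListHom (fun i => relabelList Subtype.val Y (enum {k // g k = i})) (enum I) =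
      tensListHom (fun i => relabelList Subtype.val X (enum {k // g k = i})) (enum I) ≫
      tensHom (fun i : I => tensHom (fun k : {k // g k = i} => f k.1)) := by
    rw [tensHom, tensListHom_comp, tensListHom_comp]
    congr 1
    funext i
    exact relabelList_natural _ f _
  simp only [fibrewise, Category.assoc]
  rw [← h3, ← reassoc_of% h2, ← reassoc_of% h1]
  rfl

/-- The morphism `⨂_{j ∈ J} X j ⟶ 𝟙` induced by morphisms `X j ⟶ 𝟙`, for lists. -/
def collapseList {J : Type} {X : J → V} (f : ∀ j, X j ⟶ 𝟙_ V) :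
    (l : List J) → (tensList X l ⟶ 𝟙_ V)
  | [] => 𝟙 (𝟙_ V)
  | j :: l => (f j ⊗ₘ collapseList f l) ≫ (λ_ (𝟙_ V)).hom

lemma Extract.hom_collapseList {J : Type} {X : J → V} (f : ∀ j, X j ⟶ 𝟙_ V) {j : J}
    {l r : List J} (d : Extract j l r) :
    d.hom X ≫ (f j ⊗ₘ collapseList f r) ≫ (λ_ (𝟙_ V)).hom = collapseList f l := by
  induction d with
  | head l => simp [Extract.hom, collapseList]
  | @tail k l r d ih =>
    have h : swapHead (𝟙_ V) (𝟙_ V) (𝟙_ V) ≫ (𝟙_ V) ◁ (λ_ (𝟙_ V)).hom =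
        (𝟙_ V) ◁ (λ_ (𝟙_ V)).hom := by
      have := unitors_equal (C := V)
      simp [swapHead, ← this]
    have n := swapHead_natural (f k) (f j) (collapseList f r)
    have m : ∀ {A B : V} (a : A ⟶ 𝟙_ V) (b : B ⟶ 𝟙_ V ⊗ 𝟙_ V),
        (a ⊗ₘ (b ≫ (λ_ (𝟙_ V)).hom)) = (a ⊗ₘ b) ≫ (𝟙_ V) ◁ (λ_ (𝟙_ V)).hom := fun a b => by
      rw [tensorHom_comp_whiskerLeft]
    simp only [Extract.hom, collapseList, ← ih, Category.assoc]
    rw [m (f j), Category.assoc, ← reassoc_of% n, reassoc_of% h,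
      whiskerLeft_comp_tensorHom_assoc, ← tensorHom_comp_whiskerLeft_assoc]
    rw [tensorHom_comp_whiskerLeft_assoc, tensorHom_comp_whiskerLeft_assoc, Category.assoc]

lemma Reorder.hom_collapseList {J : Type} {X : J → V} (f : ∀ j, X j ⟶ 𝟙_ V) {l l' : List J}
    (p : Reorder l l') : p.hom X ≫ collapseList f l' = collapseList f l := by
  induction p with
  | nil => simp [Reorder.hom]
  | cons d p ih =>
    simp only [Reorder.hom, collapseList, Category.assoc]
    rw [whiskerLeft_comp_tensorHom_assoc, ih, Extract.hom_collapseList]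

/-- The morphism `⨂_{j ∈ J} X j ⟶ 𝟙` induced by morphisms `X j ⟶ 𝟙`. -/
def collapse {J : Type} [Finite J] {X : J → V} (f : ∀ j, X j ⟶ 𝟙_ V) : tens X ⟶ 𝟙_ V :=
  collapseList f (enum J)

lemma tensListMap_collapseList {J J' : Type} {X : J → V} {X' : J' → V} (e : J → J')
    (g : ∀ j j', e j = j' → (X j ⟶ X' j')) (f : ∀ j, X j ⟶ 𝟙_ V) (f' : ∀ j, X' j ⟶ 𝟙_ V)
    (h : ∀ j, g j (e j) rfl ≫ f' (e j) = f j) (l : List J) :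
    tensListMap e g l ≫ collapseList f' (l.map e) = collapseList f l := by
  induction l with
  | nil => exact Category.comp_id _
  | cons j l ih =>
    change (g j _ rfl ⊗ₘ tensListMap e g l) ≫ (f' (e j) ⊗ₘ collapseList f' (l.map e)) ≫ _ = _
    rw [tensorHom_comp_tensorHom_assoc, h, ih]
    rfl

lemma tensMap_collapse {J J' : Type} [Finite J] [Finite J'] {X : J → V} {X' : J' → V} (e : J ≃ J')
    (g : ∀ j j', e j = j' → (X j ⟶ X' j')) (f : ∀ j, X j ⟶ 𝟙_ V) (f' : ∀ j, X' j ⟶ 𝟙_ V)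
    (h : ∀ j, g j (e j) rfl ≫ f' (e j) = f j) :
    tensMap e g ≫ collapse f' = collapse f := by
  simp only [tensMap, collapse, Category.assoc, reorderHom]
  rw [Reorder.hom_collapseList, tensListMap_collapseList e g f f' h]

lemma tensHom_collapse {J : Type} [Finite J] {X Y : J → V} (g : ∀ j, X j ⟶ Y j)
    (f : ∀ j, Y j ⟶ 𝟙_ V) : tensHom g ≫ collapse f = collapse (fun j => g j ≫ f j) := by
  have (l : List J) : tensListHom g l ≫ collapseList f l =
      collapseList (fun j => g j ≫ f j) l := by
    induction l with
    | nil => simp [tensListHom, collapseList]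
    | cons j l ih => simp [tensListHom, collapseList, ← ih]
  exact this _

/-- The canonical isomorphism `⨂_{j ∈ J} X j ≅ X j₀` when `J = {j₀}`. -/
def single {J : Type} [Finite J] [Subsingleton J] (X : J → V) (j : J) : tens X ⟶ X j :=
  reorderHom X (perm_enum (l := [j]) (by simp) fun k => by simp [Subsingleton.elim k j]).symm ≫
    (ρ_ (X j)).hom

lemma single_natural {J : Type} [Finite J] [Subsingleton J] {X Y : J → V}
    (f : ∀ j, X j ⟶ Y j) (j : J) : tensHom f ≫ single Y j = single X j ≫ f j := by
  have := reorderHom_natural f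
    (perm_enum (l := [j]) (by simp) fun k => by simp [Subsingleton.elim k j]).symm
  simp only [single, tensHom, Category.assoc]
  rw [reassoc_of% this]
  simp [tensListHom]

lemma tensMap_single {J J' : Type} [Finite J] [Finite J'] [Subsingleton J] [Subsingleton J']
    {X : J → V} {X' : J' → V} (e : J ≃ J') (f : ∀ j j', e j = j' → (X j ⟶ X' j')) (j : J) (j' : J')
    (h : e j = j') : tensMap e f ≫ single X' j' = single X j ≫ f j j' h := by
  subst h
  have hp := (perm_enum (l := [j]) (by simp) fun k => by simp [Subsingleton.elim k j]).symm
  have := reorderHom_naturality e e.injective f (nodup_enum J) hp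
  simp only [single, tensMap, Category.assoc]
  rw [reassoc_of% (reorderHom_comp X' ((nodup_enum J).map e.injective) (perm_map_enum e) _)]
  have this' := this =≫ (ρ_ (X' (e j))).hom
  simp only [Category.assoc] at this'
  refine this'.trans ?_
  congr 1
  simp [tensListMap]

end Symmetric

end UnorderedTensor
/-! ### Symmetric sequences and the composition product -/

/-- Nonempty finite sets. -/
structure FinNE : Type 1 where
  carrier : Type
  [fin : Finite carrier]
  [ne : Nonempty carrier]

instance : CoeSort FinNE Type := ⟨FinNE.carrier⟩

instance (T : FinNE) : Finite T := T.fin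

instance (T : FinNE) : Nonempty T := T.ne

/-- Morphisms of nonempty finite sets are bijections. -/
@[ext]
structure FinNE.Hom (S T : FinNE) where
  equiv : S ≃ T

instance : Category.{0} FinNE where
  Hom := FinNE.Hom
  id S := ⟨Equiv.refl S⟩
  comp f g := ⟨f.equiv.trans g.equiv⟩

@[simp] lemma FinNE.id_equiv (S : FinNE) : (𝟙 S : S ⟶ S).equiv = Equiv.refl S := rfl

@[simp] lemma FinNE.comp_equiv {S T U : FinNE} (f : S ⟶ T) (g : T ⟶ U) :
    (f ≫ g).equiv = f.equiv.trans g.equiv := rfl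

/-- A bijection, as a morphism. -/
def FinNE.ofEquiv {S T : FinNE} (e : S ≃ T) : S ⟶ T := ⟨e⟩

instance finite_setoid {T : Type} [Finite T] : Finite (Setoid T) :=
  Finite.of_injective (fun s : Setoid T => fun x y => s x y) fun s s' h => by
    ext x y
    exact iff_of_eq (congrFun (congrFun h x) y)

/-- The set of blocks of a partition (partitions are encoded as equivalence relations). -/
def blocks {T : FinNE} (s : Setoid T) : FinNE :=
  have : Nonempty (Quotient s) := ⟨Quotient.mk s (Classical.arbitrary T)⟩
  ⟨Quotient s⟩

/-- A block of a partition, as a set in its own right. -/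
def block {T : FinNE} (s : Setoid T) (j : Quotient s) : FinNE :=
  have : Nonempty {x : T // Quotient.mk s x = j} :=
    let ⟨x, hx⟩ := j.exists_rep
    ⟨⟨x, hx⟩⟩
  ⟨{x : T // Quotient.mk s x = j}⟩

/-- The bijection between blocks induced by a bijection compatible with partitions. -/
def blocksMap {T T' : FinNE} (σ : T ≃ T') {s : Setoid T} {s' : Setoid T'}
    (h : ∀ x y, s x y ↔ s' (σ x) (σ y)) : Quotient s ≃ Quotient s' :=
  Quotient.congr σ h

/-- The restriction of a bijection compatible with partitions to a block. -/
def blockMap {T T' : FinNE} (σ : T ≃ T') {s : Setoid T} {s' : Setoid T'}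
    (h : ∀ x y, s x y ↔ s' (σ x) (σ y)) (j : Quotient s) (j' : Quotient s')
    (hj : blocksMap σ h j = j') : block s j ≃ block s' j' :=
  σ.subtypeEquiv fun x => by
    subst hj
    rw [show Quotient.mk s' (σ x) = blocksMap σ h (Quotient.mk s x) from rfl,
      (blocksMap σ h).apply_eq_iff_eq]

/-- The partition transported along a bijection. -/
def pushPartition {T T' : FinNE} (σ : T ≃ T') (s : Setoid T) : Setoid T' :=
  s.comap σ.symm

lemma pushPartition_iff {T T' : FinNE} (σ : T ≃ T') (s : Setoid T) (x y : T) :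
    s x y ↔ pushPartition σ s (σ x) (σ y) := by
  change s x y ↔ s (σ.symm (σ x)) (σ.symm (σ y))
  rw [σ.symm_apply_apply, σ.symm_apply_apply]

section

variable (V : Type u) [Category.{v} V]

/-- Reduced symmetric sequences in `V`: functors from the groupoid of nonempty finite sets and
bijections. Restricting to the sets `{1, …, n}`, such a functor amounts to objects `A[n]` with an
action of `Σ_n` for `n ≥ 1` (and `A[0] = *`). -/
abbrev SymSeq := FinNE ⥤ V

end

section Composition

variable {V : Type u} [Category.{v} V] [MonoidalCategory V] [SymmetricCategory V]

/-- The summand of `(A ∘ B)[T]` at a partition. -/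
@[reducible] def compSummand (A B : SymSeq V) {T : FinNE} (s : Setoid T) : V :=
  A.obj (blocks s) ⊗ tens fun j : Quotient s => B.obj (block s j)

/-- The map of summands induced by a bijection compatible with partitions. -/
def compSummandMap (A B : SymSeq V) {T T' : FinNE} (σ : T ≃ T') {s : Setoid T} {s' : Setoid T'}
    (h : ∀ x y, s x y ↔ s' (σ x) (σ y)) : compSummand A B s ⟶ compSummand A B s' :=
  A.map (FinNE.ofEquiv (S := blocks s) (T := blocks s') (blocksMap σ h)) ⊗ₘ
    tensMap (blocksMap σ h) fun j j' hj => B.map (FinNE.ofEquiv (blockMap σ h j j' hj))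

/-- The map of summands induced by morphisms of symmetric sequences. -/
def compSummandHom {A A' B B' : SymSeq V} (f : A ⟶ A') (g : B ⟶ B') {T : FinNE}
    (s : Setoid T) : compSummand A B s ⟶ compSummand A' B' s :=
  f.app (blocks s) ⊗ₘ tensHom fun j => g.app (block s j)

lemma compSummandMap_comp (A B : SymSeq V) {T T' T'' : FinNE} (σ : T ≃ T') (τ : T' ≃ T'')
    {s : Setoid T} {s' : Setoid T'} {s'' : Setoid T''}
    (h : ∀ x y, s x y ↔ s' (σ x) (σ y)) (h' : ∀ x y, s' x y ↔ s'' (τ x) (τ y))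
    (h'' : ∀ x y, s x y ↔ s'' (σ.trans τ x) (σ.trans τ y)) :
    compSummandMap A B σ h ≫ compSummandMap A B τ h' = compSummandMap A B (σ.trans τ) h'' := by
  have hj : ∀ j, blocksMap τ h' (blocksMap σ h j) = blocksMap (σ.trans τ) h'' j := fun j =>
    Quotient.inductionOn j fun x => rfl
  rw [compSummandMap, compSummandMap, compSummandMap, tensorHom_comp_tensorHom,
    tensMap_comp _ _ _ _ _ _ hj, ← A.map_comp]
  · congr 2
    exact FinNE.Hom.ext (Equiv.ext hj)
  · intro j
    rw [← B.map_comp]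
    rfl

lemma compSummandMap_natural {A A' B B' : SymSeq V} (f : A ⟶ A') (g : B ⟶ B') {T T' : FinNE}
    (σ : T ≃ T') {s : Setoid T} {s' : Setoid T'} (h : ∀ x y, s x y ↔ s' (σ x) (σ y)) :
    compSummandHom f g s ≫ compSummandMap A' B' σ h =
      compSummandMap A B σ h ≫ compSummandHom f g s' := by
  simp only [compSummandHom, compSummandMap, tensorHom_comp_tensorHom]
  rw [f.naturality]
  congr 1
  exact tensMap_natural _ _ _ _ _ fun j => (g.naturality _).symm

variable [HasFiniteCoproducts V]

lemma compSummandMap_refl (A B : SymSeq V) {T : FinNE} {s s' : Setoid T}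
    (h : ∀ x y, s x y ↔ s' x y) :
    compSummandMap A B (Equiv.refl T) h ≫ Sigma.ι (compSummand A B) s' = Sigma.ι (compSummand A B) s := by
  obtain rfl : s = s' := by ext x y; exact h x y
  have hid : ∀ j, blocksMap (Equiv.refl T) h j = j := fun j =>
    Quotient.inductionOn j fun x => rfl
  have h1 : A.map (FinNE.ofEquiv (S := blocks s) (T := blocks s) (blocksMap (Equiv.refl T) h)) =
      𝟙 _ := by
    rw [← A.map_id]
    congr 1
    exact FinNE.Hom.ext (Equiv.ext hid)
  unfold compSummandMap
  rw [h1, tensMap_id _ _ hid]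
  · simp
  · intro j
    exact B.map_id _

lemma compSummandMap_congr (A B : SymSeq V) {T T' : FinNE} (σ : T ≃ T') {s : Setoid T}
    {s' s'' : Setoid T'} (h : ∀ x y, s x y ↔ s' (σ x) (σ y))
    (h' : ∀ x y, s x y ↔ s'' (σ x) (σ y)) :
    compSummandMap A B σ h ≫ Sigma.ι (compSummand A B) s' = compSummandMap A B σ h' ≫ Sigma.ι (compSummand A B) s'' := by
  obtain rfl : s' = s'' := by
    ext x y
    have := (h (σ.symm x) (σ.symm y)).symm.trans (h' _ _)
    simpa using this
  rfl

/-- The composition product of reduced symmetric sequences,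
`(A ∘ B)[T] = ∐_{partitions of T} A[set of blocks] ⊗ ⨂_{blocks} B[block]`. -/
def comp (A B : SymSeq V) : SymSeq V where
  obj T := ∐ compSummand A B (T := T)
  map {T T'} σ := Sigma.desc fun s =>
    compSummandMap A B σ.equiv (pushPartition_iff σ.equiv s) ≫
      Sigma.ι (compSummand A B) (pushPartition σ.equiv s)
  map_id T := by
    refine Sigma.hom_ext _ _ fun s => ?_
    rw [Sigma.ι_desc, Category.comp_id]
    exact compSummandMap_refl A B _
  map_comp σ τ := by
    refine Sigma.hom_ext _ _ fun s => ?_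
    rw [Sigma.ι_desc, Sigma.ι_desc_assoc, Category.assoc]
    simp only [Sigma.ι_desc]
    rw [← Category.assoc, compSummandMap_comp A B σ.equiv τ.equiv _ _ fun x y =>
      (pushPartition_iff _ _ _ _).trans (pushPartition_iff _ _ _ _)]
    exact compSummandMap_congr A B _ _ _

/-- The inclusion of a summand into `(A ∘ B)[T]`. -/
def compι (A B : SymSeq V) {T : FinNE} (s : Setoid T) : compSummand A B s ⟶ (comp A B).obj T :=
  Sigma.ι (compSummand A B) s

/-- A morphism out of `(A ∘ B)[T]`, given on the summands. -/
def compDesc {A B : SymSeq V} {T : FinNE} {Z : V} (f : ∀ s : Setoid T, compSummand A B s ⟶ Z) :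
    (comp A B).obj T ⟶ Z :=
  Sigma.desc f

@[simp]
lemma compι_desc {A B : SymSeq V} {T : FinNE} {Z : V} (f : ∀ s : Setoid T, compSummand A B s ⟶ Z)
    (s : Setoid T) : compι A B s ≫ compDesc f = f s :=
  Sigma.ι_desc _ _

lemma comp_hom_ext {A B : SymSeq V} {T : FinNE} {Z : V} {f g : (comp A B).obj T ⟶ Z}
    (h : ∀ s : Setoid T, compι A B s ≫ f = compι A B s ≫ g) : f = g :=
  Sigma.hom_ext _ _ h

lemma compι_map (A B : SymSeq V) {T T' : FinNE} (σ : T ⟶ T') {s : Setoid T} {s' : Setoid T'}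
    (h : ∀ x y, s x y ↔ s' (σ.equiv x) (σ.equiv y)) :
    compι A B s ≫ (comp A B).map σ = compSummandMap A B σ.equiv h ≫ compι A B s' :=
  (Sigma.ι_desc _ _).trans (compSummandMap_congr A B _ _ _)

/-- Functoriality of the composition product. -/
def compMap {A A' B B' : SymSeq V} (f : A ⟶ A') (g : B ⟶ B') : comp A B ⟶ comp A' B' where
  app T := compDesc fun s => compSummandHom f g s ≫ compι A' B' s
  naturality T T' σ := by
    refine comp_hom_ext fun s => ?_
    have h := pushPartition_iff σ.equiv s
    rw [← Category.assoc, ← Category.assoc, compι_map A B σ h, compι_desc, Category.assoc,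
      compι_desc, Category.assoc, compι_map A' B' σ h, ← Category.assoc, ← Category.assoc,
      compSummandMap_natural]

@[simp]
lemma compι_compMap {A A' B B' : SymSeq V} (f : A ⟶ A') (g : B ⟶ B') {T : FinNE}
    (s : Setoid T) :
    compι A B s ≫ (compMap f g).app T = compSummandHom f g s ≫ compι A' B' s :=
  compι_desc _ _

lemma compMap_id (A B : SymSeq V) : compMap (𝟙 A) (𝟙 B) = 𝟙 (comp A B) := by
  ext T : 2
  refine comp_hom_ext fun s => ?_
  rw [compι_compMap]
  simp only [compSummandHom, NatTrans.id_app]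
  rw [tensHom_id, id_tensorHom_id, Category.id_comp, Category.comp_id]

lemma compMap_comp {A A' A'' B B' B'' : SymSeq V} (f : A ⟶ A') (f' : A' ⟶ A'') (g : B ⟶ B')
    (g' : B' ⟶ B'') : compMap f g ≫ compMap f' g' = compMap (f ≫ f') (g ≫ g') := by
  ext T : 2
  refine comp_hom_ext fun s => ?_
  rw [compι_compMap, NatTrans.comp_app, ← Category.assoc, compι_compMap, Category.assoc,
    compι_compMap, ← Category.assoc]
  simp only [compSummandHom, NatTrans.comp_app, tensorHom_comp_tensorHom]
  rw [tensHom_comp]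

/-- The composition product as a bifunctor. -/
def compFunctor : SymSeq V ⥤ SymSeq V ⥤ SymSeq V where
  obj A :=
    { obj := fun B => comp A B
      map := fun g => compMap (𝟙 A) g
      map_id := fun B => compMap_id A B
      map_comp := fun g g' => by rw [compMap_comp, Category.comp_id] }
  map f :=
    { app := fun B => compMap f (𝟙 B)
      naturality := fun B B' g => by
        rw [compMap_comp, compMap_comp]; simp }
  map_id A := by ext B : 2; exact compMap_id A B
  map_comp f f' := by ext B : 2; simp [compMap_comp]

/-- For `t` finer than `s`, the map which sends a block of `t` to the block of `s` containing it. -/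
def coarsen {T : FinNE} {s t : Setoid T} (h : t ≤ s) : Quotient t → Quotient s :=
  Quotient.map id fun _ _ hxy => h hxy

lemma coarsen_surjective {T : FinNE} {s t : Setoid T} (h : t ≤ s) :
    Function.Surjective (coarsen h) := fun i =>
  Quotient.inductionOn i fun x => ⟨Quotient.mk t x, rfl⟩

/-- The set of blocks of `t` which lie in a given block of `s`. -/
def blocksIn {T : FinNE} {s t : Setoid T} (h : t ≤ s) (i : Quotient s) : FinNE :=
  have : Nonempty {j : Quotient t // coarsen h j = i} :=
    let ⟨j, hj⟩ := coarsen_surjective h i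
    ⟨⟨j, hj⟩⟩
  ⟨{j : Quotient t // coarsen h j = i}⟩

/-- Chains of two partitions, the first one coarser than the second one. -/
abbrev Chain2 (T : FinNE) : Type := {st : Setoid T × Setoid T // st.2 ≤ st.1}

/-- The summand of the triple composition product. -/
@[reducible] def comp3Summand (A B C : SymSeq V) {T : FinNE} (c : Chain2 T) : V :=
  A.obj (blocks c.1.1) ⊗ ((tens fun i : Quotient c.1.1 => B.obj (blocksIn c.2 i)) ⊗
    tens fun j : Quotient c.1.2 => C.obj (block c.1.2 j))

/-- The triple composition product `(A ∘ B ∘ C)[T]`, the coproduct over the chains of partitions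
`t ≤ s` (with `t` finer than `s`) of
`A[blocks of s] ⊗ ⨂_{blocks i of s} B[blocks of t in i] ⊗ ⨂_{blocks j of t} C[j]`. -/
def comp3 (A B C : SymSeq V) (T : FinNE) : V := ∐ comp3Summand A B C (T := T)

def comp3SummandHom {A A' B B' C C' : SymSeq V} (f : A ⟶ A') (g : B ⟶ B') (k : C ⟶ C')
    {T : FinNE} (c : Chain2 T) : comp3Summand A B C c ⟶ comp3Summand A' B' C' c :=
  f.app _ ⊗ₘ ((tensHom fun i => g.app (blocksIn c.2 i)) ⊗ₘ
    tensHom fun j => k.app (block c.1.2 j))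

def comp3ι (A B C : SymSeq V) {T : FinNE} (c : Chain2 T) :
    comp3Summand A B C c ⟶ comp3 A B C T :=
  Sigma.ι (comp3Summand A B C) c

def comp3Desc {A B C : SymSeq V} {T : FinNE} {Z : V}
    (f : ∀ c : Chain2 T, comp3Summand A B C c ⟶ Z) : comp3 A B C T ⟶ Z :=
  Sigma.desc f

@[simp]
lemma comp3ι_desc {A B C : SymSeq V} {T : FinNE} {Z : V}
    (f : ∀ c : Chain2 T, comp3Summand A B C c ⟶ Z) (c : Chain2 T) :
    comp3ι A B C c ≫ comp3Desc f = f c :=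
  Sigma.ι_desc _ _

lemma comp3_hom_ext {A B C : SymSeq V} {T : FinNE} {Z : V} {f g : comp3 A B C T ⟶ Z}
    (h : ∀ c : Chain2 T, comp3ι A B C c ≫ f = comp3ι A B C c ≫ g) : f = g :=
  Sigma.hom_ext _ _ h

/-- Functoriality of the triple composition product. -/
def comp3Map {A A' B B' C C' : SymSeq V} (f : A ⟶ A') (g : B ⟶ B') (k : C ⟶ C') (T : FinNE) :
    comp3 A B C T ⟶ comp3 A' B' C' T :=
  comp3Desc fun c => comp3SummandHom f g k c ≫ comp3ι A' B' C' c

/-- For `t ≤ s`, the partition of the set of blocks of `t` determined by `s`. -/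
def quotientPartition {T : FinNE} {s t : Setoid T} (h : t ≤ s) : Setoid (blocks t) :=
  Setoid.ker (coarsen h)

/-- The blocks of `s` are the blocks of the partition which `s` determines on the blocks of `t`. -/
def quotientBlocks {T : FinNE} {s t : Setoid T} (h : t ≤ s) :
    Quotient s ≃ Quotient (quotientPartition h) :=
  (Setoid.quotientKerEquivOfSurjective (coarsen h) (coarsen_surjective h)).symm

lemma quotientBlocks_coarsen {T : FinNE} {s t : Setoid T} (h : t ≤ s) (j : Quotient t) :
    quotientBlocks h (coarsen h j) = Quotient.mk (quotientPartition h) j :=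
  (Setoid.quotientKerEquivOfSurjective (coarsen h) (coarsen_surjective h)).symm_apply_apply
    (Quotient.mk (quotientPartition h) j)

def quotientBlock {T : FinNE} {s t : Setoid T} (h : t ≤ s) (i : Quotient s)
    (i' : Quotient (quotientPartition h)) (hi : quotientBlocks h i = i') :
    blocksIn h i ≃ block (quotientPartition h) i' :=
  Equiv.subtypeEquivRight fun j => by
    rw [← hi, ← quotientBlocks_coarsen, (quotientBlocks h).apply_eq_iff_eq]

/-- For `t ≤ s`, the partition of a block of `s` determined by `t`. -/
def restrictPartition {T : FinNE} {s : Setoid T} (t : Setoid T) (i : Quotient s) :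
    Setoid (block s i) :=
  t.comap Subtype.val

def restrictBlocksFun {T : FinNE} {s t : Setoid T} (h : t ≤ s) (i : Quotient s) :
    Quotient (restrictPartition t i) → blocksIn h i :=
  Quotient.lift (fun x : block s i => (⟨Quotient.mk t x.1, x.2⟩ : {j // coarsen h j = i}))
    fun _ _ hxy => Subtype.ext (Quotient.sound hxy)

lemma restrictBlocksFun_bijective {T : FinNE} {s t : Setoid T} (h : t ≤ s) (i : Quotient s) :
    Function.Bijective (restrictBlocksFun h i) := by
  constructor
  · intro a b
    refine Quotient.inductionOn₂ a b fun x y hxy => ?_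
    exact Quotient.sound (Quotient.exact (congrArg Subtype.val hxy) : t x.1 y.1)
  · rintro ⟨j, hj⟩
    revert hj
    refine Quotient.inductionOn j fun x hx => ?_
    exact ⟨Quotient.mk _ (⟨x, hx⟩ : {x : T // Quotient.mk s x = i}), rfl⟩

/-- The blocks of `t` contained in a block `i` of `s` are the blocks of the partition which `t`
determines on `i`. -/
def restrictBlocks {T : FinNE} {s t : Setoid T} (h : t ≤ s) (i : Quotient s) :
    blocksIn h i ≃ Quotient (restrictPartition t i) :=
  (Equiv.ofBijective _ (restrictBlocksFun_bijective h i)).symm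

lemma restrictBlocks_mk {T : FinNE} {s t : Setoid T} (h : t ≤ s) (i : Quotient s)
    (x : block s i) : restrictBlocks h i (restrictBlocksFun h i (Quotient.mk _ x)) =
      Quotient.mk (restrictPartition t i) x :=
  (Equiv.ofBijective _ (restrictBlocksFun_bijective h i)).symm_apply_apply
    (Quotient.mk (restrictPartition t i) x)

def restrictBlock {T : FinNE} {s t : Setoid T} (h : t ≤ s) (i : Quotient s)
    (j : {j : Quotient t // coarsen h j = i}) (j' : Quotient (restrictPartition t i))
    (hj : restrictBlocks h i j = j') : block t j.1 ≃ block (restrictPartition t i) j' where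
  toFun x := ⟨(⟨x.1, (congrArg (coarsen h) x.2).trans j.2⟩ : {x : T // Quotient.mk s x = i}), by
    rw [← hj]
    refine (restrictBlocks_mk h i _).symm.trans (congrArg _ ?_)
    exact Subtype.ext x.2⟩
  invFun y := ⟨y.1.1, by
    have h1 := (restrictBlocks_mk h i y.1).trans (y.2.trans hj.symm)
    exact congrArg Subtype.val ((restrictBlocks h i).injective h1)⟩
  left_inv _ := rfl
  right_inv _ := rfl

/-- The comparison `A[blocks of s] ⊗ ⨂_i B[blocks of t in i] ⟶ (A ∘ B)[blocks of t]`. -/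
def regroupLeft (A B : SymSeq V) {T : FinNE} (c : Chain2 T) :
    A.obj (blocks c.1.1) ⊗ (tens fun i : Quotient c.1.1 => B.obj (blocksIn c.2 i)) ⟶
      (comp A B).obj (blocks c.1.2) :=
  (A.map (FinNE.ofEquiv (S := blocks c.1.1) (T := blocks (quotientPartition c.2))
      (quotientBlocks c.2)) ⊗ₘ
    tensMap (quotientBlocks c.2) fun i i' hi => B.map (FinNE.ofEquiv (quotientBlock c.2 i i' hi))) ≫
  compι A B (quotientPartition c.2)

/-- The comparison `B[blocks of t in i] ⊗ ⨂_{j in i} C[j] ⟶ (B ∘ C)[i]`. -/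
def regroupRight (B C : SymSeq V) {T : FinNE} (c : Chain2 T) (i : Quotient c.1.1) :
    B.obj (blocksIn c.2 i) ⊗
        (tens fun j : {j : Quotient c.1.2 // coarsen c.2 j = i} => C.obj (block c.1.2 j.1)) ⟶
      (comp B C).obj (block c.1.1 i) :=
  (B.map (FinNE.ofEquiv (S := blocksIn c.2 i) (T := blocks (restrictPartition c.1.2 i))
      (restrictBlocks c.2 i)) ⊗ₘ
    tensMap (restrictBlocks c.2 i)
      fun j j' hj => C.map (FinNE.ofEquiv (restrictBlock c.2 i j j' hj))) ≫
  compι B C (restrictPartition c.1.2 i)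

/-- The canonical comparison `A ∘ B ∘ C ⟶ (A ∘ B) ∘ C`. -/
def compAssocLeft (A B C : SymSeq V) (T : FinNE) :
    comp3 A B C T ⟶ (comp (comp A B) C).obj T :=
  comp3Desc fun c => (α_ _ _ _).inv ≫
    (regroupLeft A B c ▷ (tens fun j : Quotient c.1.2 => C.obj (block c.1.2 j))) ≫
      compι (comp A B) C c.1.2

/-- The canonical comparison `A ∘ B ∘ C ⟶ A ∘ (B ∘ C)`. -/
def compAssocRight (A B C : SymSeq V) (T : FinNE) :
    comp3 A B C T ⟶ (comp A (comp B C)).obj T :=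
  comp3Desc fun c =>
    (A.obj (blocks c.1.1) ◁
      ((tens fun i : Quotient c.1.1 => B.obj (blocksIn c.2 i)) ◁ fibrewise (coarsen c.2) _ ≫
        zip _ _ ≫ tensHom fun i => regroupRight B C c i)) ≫
      compι A (comp B C) c.1.1

lemma regroupLeft_natural {A A' B B' : SymSeq V} (f : A ⟶ A') (g : B ⟶ B') {T : FinNE}
    (c : Chain2 T) :
    (f.app (blocks c.1.1) ⊗ₘ tensHom fun i => g.app (blocksIn c.2 i)) ≫ regroupLeft A' B' c =
      regroupLeft A B c ≫ (compMap f g).app _ := by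
  have h1 := f.naturality (FinNE.ofEquiv (S := blocks c.1.1)
    (T := blocks (quotientPartition c.2)) (quotientBlocks c.2))
  have h2 := tensMap_natural (quotientBlocks c.2) (fun i => g.app (blocksIn c.2 i))
    (fun i' => g.app (block (quotientPartition c.2) i'))
    (fun i i' hi => B.map (FinNE.ofEquiv (quotientBlock c.2 i i' hi)))
    (fun i i' hi => B'.map (FinNE.ofEquiv (quotientBlock c.2 i i' hi)))
    (fun i => (g.naturality _).symm)
  simp only [regroupLeft, Category.assoc]
  rw [compι_compMap, compSummandHom, tensorHom_comp_tensorHom_assoc,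
    tensorHom_comp_tensorHom_assoc, ← h1, h2]

lemma regroupRight_natural {B B' C C' : SymSeq V} (g : B ⟶ B') (k : C ⟶ C') {T : FinNE}
    (c : Chain2 T) (i : Quotient c.1.1) :
    (g.app (blocksIn c.2 i) ⊗ₘ
      tensHom fun j : {j : Quotient c.1.2 // coarsen c.2 j = i} => k.app (block c.1.2 j.1)) ≫
        regroupRight B' C' c i =
      regroupRight B C c i ≫ (compMap g k).app _ := by
  have h1 := g.naturality (FinNE.ofEquiv (S := blocksIn c.2 i)
    (T := blocks (restrictPartition c.1.2 i)) (restrictBlocks c.2 i))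
  have h2 := tensMap_natural (restrictBlocks c.2 i)
    (fun j : {j : Quotient c.1.2 // coarsen c.2 j = i} => k.app (block c.1.2 j.1))
    (fun i' => k.app (block (restrictPartition c.1.2 i) i'))
    (fun j j' hj => C.map (FinNE.ofEquiv (restrictBlock c.2 i j j' hj)))
    (fun j j' hj => C'.map (FinNE.ofEquiv (restrictBlock c.2 i j j' hj)))
    (fun i => (k.naturality _).symm)
  simp only [regroupRight, Category.assoc]
  rw [compι_compMap, compSummandHom, tensorHom_comp_tensorHom_assoc,
    tensorHom_comp_tensorHom_assoc, ← h1]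
  erw [h2]
  rfl

lemma compAssocLeft_natural {A A' B B' C C' : SymSeq V} (f : A ⟶ A') (g : B ⟶ B')
    (k : C ⟶ C') (T : FinNE) :
    comp3Map f g k T ≫ compAssocLeft A' B' C' T =
      compAssocLeft A B C T ≫ (compMap (compMap f g) k).app T := by
  refine comp3_hom_ext fun c => ?_
  simp only [comp3Map, compAssocLeft]
  rw [← Category.assoc, ← Category.assoc, comp3ι_desc, comp3ι_desc, Category.assoc, comp3ι_desc,
    Category.assoc, Category.assoc, compι_compMap, comp3SummandHom, compSummandHom,
    associator_inv_naturality_assoc, tensorHom_comp_whiskerRight_assoc, regroupLeft_natural,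
    whiskerRight_comp_tensorHom_assoc]

lemma compAssocRight_natural {A A' B B' C C' : SymSeq V} (f : A ⟶ A') (g : B ⟶ B')
    (k : C ⟶ C') (T : FinNE) :
    comp3Map f g k T ≫ compAssocRight A' B' C' T =
      compAssocRight A B C T ≫ (compMap f (compMap g k)).app T := by
  refine comp3_hom_ext fun c => ?_
  simp only [comp3Map, compAssocRight]
  rw [← Category.assoc, ← Category.assoc, comp3ι_desc, comp3ι_desc, Category.assoc, comp3ι_desc,
    Category.assoc, compι_compMap, comp3SummandHom, compSummandHom,
    tensorHom_comp_whiskerLeft_assoc, whiskerLeft_comp_tensorHom_assoc]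
  congr 2
  rw [tensorHom_comp_whiskerLeft_assoc, fibrewise_natural, ← whiskerLeft_comp_tensorHom_assoc,
    Category.assoc, reassoc_of% (zip_natural (fun i => g.app (blocksIn c.2 i)) _)]
  simp only [Category.assoc]
  congr 2
  rw [tensHom_comp, tensHom_comp]
  congr 1
  funext i
  exact regroupRight_natural g k c i

/-- The unit symmetric sequence: `I[T] = 𝟙` if `T` has one element, and `I[T]` is initial
(an empty coproduct) otherwise. -/
def unitSeq : SymSeq V where
  obj T := ∐ fun _ : PLift (Subsingleton T) => 𝟙_ V
  map {T T'} σ := Sigma.desc fun h =>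
    Sigma.ι (fun _ : PLift (Subsingleton T') => 𝟙_ V)
      ⟨have := h.down; σ.equiv.symm.injective.subsingleton⟩
  map_id T := by
    refine Sigma.hom_ext _ _ fun h => ?_
    rw [Sigma.ι_desc, Category.comp_id]
  map_comp σ τ := by
    refine Sigma.hom_ext _ _ fun h => ?_
    rw [Sigma.ι_desc, Sigma.ι_desc_assoc, Sigma.ι_desc]

/-- The canonical morphism `I[T] ⟶ 𝟙`, the identity if `T` has one element. -/
def unitε (T : FinNE) : (unitSeq (V := V)).obj T ⟶ 𝟙_ V := Sigma.desc fun _ => 𝟙 _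

lemma unitSeq_map_ε {T T' : FinNE} (σ : T ⟶ T') :
    unitSeq.map σ ≫ unitε (V := V) T' = unitε T := by
  refine Sigma.hom_ext _ _ fun h => ?_
  simp only [unitSeq, unitε, Sigma.ι_desc_assoc, Sigma.ι_desc]

variable [HasZeroMorphisms V]

/-- If a partition has only one block, then this block is the whole set. -/
def wholeBlock {T : FinNE} (s : Setoid T) [Subsingleton (Quotient s)] (j : Quotient s) :
    block s j ≃ T :=
  Equiv.subtypeUnivEquiv fun _ => Subsingleton.elim _ _

/-- If all blocks are singletons, then the blocks correspond to the elements. -/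
def discreteBlocks {T : FinNE} (s : Setoid T) (h : ∀ x y, s x y → x = y) : Quotient s ≃ T :=
  (Equiv.ofBijective (Quotient.mk s) ⟨fun x y hxy => h x y (Quotient.exact hxy),
    fun j => j.exists_rep⟩).symm

lemma discreteBlocks_mk {T : FinNE} (s : Setoid T) (h : ∀ x y, s x y → x = y) (x : T) :
    discreteBlocks s h (Quotient.mk s x) = x :=
  (Equiv.ofBijective (Quotient.mk s) ⟨fun x y hxy => h x y (Quotient.exact hxy),
    fun j => j.exists_rep⟩).symm_apply_apply x

open Classical in
/-- The canonical morphism on the summands of `I ∘ B` (a summand at a partition with more than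
one block is zero). -/
def leftUnitSummand (B : SymSeq V) {T : FinNE} (s : Setoid T) :
    compSummand unitSeq B s ⟶ B.obj T :=
  if h : Subsingleton (Quotient s) then
    (unitε (blocks s) ⊗ₘ
      (single (fun j : Quotient s => B.obj (block s j)) (Quotient.mk s (Classical.arbitrary T)) ≫
        B.map (FinNE.ofEquiv (wholeBlock s _)))) ≫ (λ_ (B.obj T)).hom
  else 0

lemma leftUnitSummand_eq (B : SymSeq V) {T : FinNE} (s : Setoid T) [Subsingleton (Quotient s)]
    (j : Quotient s) : leftUnitSummand B s = (unitε (blocks s) ⊗ₘ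
      (single (fun j : Quotient s => B.obj (block s j)) j ≫
        B.map (FinNE.ofEquiv (wholeBlock s j)))) ≫ (λ_ (B.obj T)).hom := by
  obtain rfl : j = Quotient.mk s (Classical.arbitrary T) := Subsingleton.elim _ _
  exact dif_pos _

open Classical in
/-- The canonical morphism on the summands of `A ∘ I` (a summand at a partition which has a
block with more than one element is zero). -/
def rightUnitSummand (A : SymSeq V) {T : FinNE} (s : Setoid T) :
    compSummand A unitSeq s ⟶ A.obj T :=
  if h : ∀ x y, s x y → x = y then
    (A.map (FinNE.ofEquiv (S := blocks s) (T := T) (discreteBlocks s h)) ⊗ₘ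
      collapse fun j => unitε (block s j)) ≫ (ρ_ (A.obj T)).hom
  else 0

/-- The canonical isomorphism `I ∘ B ≅ B`, as a morphism. -/
def compLeftUnit (B : SymSeq V) : comp unitSeq B ⟶ B where
  app T := compDesc fun s => leftUnitSummand B s
  naturality T T' σ := by
    refine comp_hom_ext fun s => ?_
    have h := pushPartition_iff σ.equiv s
    rw [← Category.assoc, ← Category.assoc, compι_map unitSeq B σ h, compι_desc, Category.assoc,
      compι_desc]
    by_cases hs : Subsingleton (Quotient s)
    · have hs' : Subsingleton (Quotient (pushPartition σ.equiv s)) :=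
        (blocksMap σ.equiv h).symm.injective.subsingleton
      let j : Quotient s := Quotient.mk s (Classical.arbitrary T)
      rw [leftUnitSummand_eq B s j, leftUnitSummand_eq B _ (blocksMap σ.equiv h j),
        compSummandMap, tensorHom_comp_tensorHom_assoc, unitSeq_map_ε,
        reassoc_of% (tensMap_single (blocksMap σ.equiv h)
          (fun j j' hj => B.map (FinNE.ofEquiv (blockMap σ.equiv h j j' hj))) j _ rfl),
        Category.assoc, ← leftUnitor_naturality, tensorHom_comp_whiskerLeft_assoc, Category.assoc,
        ← B.map_comp, ← B.map_comp]
      rfl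
    · have hs' : ¬ Subsingleton (Quotient (pushPartition σ.equiv s)) := fun h' =>
        hs (blocksMap σ.equiv h).injective.subsingleton
      rw [leftUnitSummand, leftUnitSummand, dif_neg hs, dif_neg hs', comp_zero, zero_comp]

/-- The canonical isomorphism `A ∘ I ≅ A`, as a morphism. -/
def compRightUnit (A : SymSeq V) : comp A unitSeq ⟶ A where
  app T := compDesc fun s => rightUnitSummand A s
  naturality T T' σ := by
    refine comp_hom_ext fun s => ?_
    have h := pushPartition_iff σ.equiv s
    rw [← Category.assoc, ← Category.assoc, compι_map A unitSeq σ h, compι_desc, Category.assoc,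
      compι_desc]
    by_cases hs : ∀ x y, s x y → x = y
    · have hs' : ∀ x y, pushPartition σ.equiv s x y → x = y := fun x y hxy =>
        σ.equiv.symm.injective (hs _ _ hxy)
      rw [rightUnitSummand, rightUnitSummand, dif_pos hs, dif_pos hs', compSummandMap,
        tensorHom_comp_tensorHom_assoc, Category.assoc, ← rightUnitor_naturality,
        tensorHom_comp_whiskerRight_assoc, ← A.map_comp, ← A.map_comp,
        tensMap_collapse _ _ _ _ fun j => unitSeq_map_ε _]
      have hE : FinNE.ofEquiv (S := blocks s) (T := blocks (pushPartition σ.equiv s))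
          (blocksMap σ.equiv h) ≫ FinNE.ofEquiv (T := T') (discreteBlocks _ hs') =
          FinNE.ofEquiv (T := T) (discreteBlocks s hs) ≫ σ := by
        refine FinNE.Hom.ext (Equiv.ext fun j => ?_)
        refine Quotient.inductionOn j fun x => ?_
        exact (discreteBlocks_mk _ hs' (σ.equiv x)).trans
          (congrArg σ.equiv (discreteBlocks_mk s hs x).symm)
      rw [hE]
    · have hs' : ¬ ∀ x y, pushPartition σ.equiv s x y → x = y := fun h' =>
        hs fun x y hxy => σ.equiv.injective (h' _ _ ((h x y).1 hxy))
      rw [rightUnitSummand, rightUnitSummand, dif_neg hs, dif_neg hs', comp_zero, zero_comp]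

lemma compι_leftUnit (B : SymSeq V) {T : FinNE} (s : Setoid T) :
    compι unitSeq B s ≫ (compLeftUnit B).app T = leftUnitSummand B s :=
  compι_desc _ _

lemma compι_rightUnit (A : SymSeq V) {T : FinNE} (s : Setoid T) :
    compι A unitSeq s ≫ (compRightUnit A).app T = rightUnitSummand A s :=
  compι_desc _ _

lemma compLeftUnit_natural {B B' : SymSeq V} (g : B ⟶ B') :
    compMap (𝟙 unitSeq) g ≫ compLeftUnit B' = compLeftUnit B ≫ g := by
  ext T : 2
  refine comp_hom_ext fun s => ?_
  rw [NatTrans.comp_app, NatTrans.comp_app, ← Category.assoc, compι_compMap, Category.assoc,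
    ← Category.assoc (compι _ _ _), compι_leftUnit, compι_leftUnit]
  by_cases hs : Subsingleton (Quotient s)
  · let j : Quotient s := Quotient.mk s (Classical.arbitrary T)
    rw [leftUnitSummand_eq B s j, leftUnitSummand_eq B' s j, compSummandHom,
      tensorHom_comp_tensorHom_assoc,
      reassoc_of% (single_natural (fun j => g.app (block s j)) j), ← g.naturality, Category.assoc,
      ← leftUnitor_naturality, tensorHom_comp_whiskerLeft_assoc]
    simp
  · have h0 : ∀ B : SymSeq V, leftUnitSummand B s = 0 := fun B => dif_neg hs
    rw [h0, h0, comp_zero, zero_comp]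

lemma compRightUnit_natural {A A' : SymSeq V} (f : A ⟶ A') :
    compMap f (𝟙 unitSeq) ≫ compRightUnit A' = compRightUnit A ≫ f := by
  ext T : 2
  refine comp_hom_ext fun s => ?_
  rw [NatTrans.comp_app, NatTrans.comp_app, ← Category.assoc, compι_compMap, Category.assoc,
    ← Category.assoc (compι _ _ _), compι_rightUnit, compι_rightUnit]
  by_cases hs : ∀ x y, s x y → x = y
  · have h1 : ∀ A : SymSeq V, rightUnitSummand A s = _ := fun A => dif_pos hs
    rw [h1, h1, compSummandHom,
      tensorHom_comp_tensorHom_assoc, tensHom_collapse, ← f.naturality, Category.assoc,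
      ← rightUnitor_naturality, tensorHom_comp_whiskerRight_assoc]
    simp
  · have h0 : ∀ A : SymSeq V, rightUnitSummand A s = 0 := fun A => dif_neg hs
    rw [h0, h0, comp_zero, zero_comp]

end Composition

/-! ### The box product of cosimplicial objects -/

section SimplexMaps

open SimplexCategory (mk)

/-- The inclusion of `[p]` in `[n]` as an initial segment. -/
def initialMap (p n : ℕ) (h : p ≤ n) : mk p ⟶ mk n :=
  SimplexCategory.Hom.mk
    ⟨fun i => ⟨i.1, by have := i.2; change i.1 < n + 1; change i.1 < p + 1 at this; lia⟩,
      fun _ _ hij => hij⟩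

/-- The inclusion `i ↦ p + i` of `[q]` in `[n]` as a final segment. -/
def finalMap (p q n : ℕ) (h : p + q = n) : mk q ⟶ mk n :=
  SimplexCategory.Hom.mk
    ⟨fun i => ⟨p + i.1, by have := i.2; change p + i.1 < n + 1; change i.1 < q + 1 at this; lia⟩,
      fun i j hij => by
        change p + i.1 ≤ p + j.1
        exact Nat.add_le_add_left hij p⟩

/-- A map to `[n]` with values at most `c`, as a map to `[c]`. -/
def corestrict {r n : ℕ} (α : mk r ⟶ mk n) (c : ℕ) (h : ∀ i, (α.toOrderHom i : ℕ) ≤ c) :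
    mk r ⟶ mk c :=
  SimplexCategory.Hom.mk ⟨fun i => ⟨α.toOrderHom i, Nat.lt_succ_of_le (h i)⟩,
    fun _ _ hij => α.toOrderHom.monotone hij⟩

/-- A map to `[n]`, `n = c + d`, with values at least `c`, as a map to `[d]`. -/
def shiftDown {s n : ℕ} (β : mk s ⟶ mk n) (c d : ℕ) (hcd : c + d = n)
    (h : ∀ i, c ≤ (β.toOrderHom i : ℕ)) : mk s ⟶ mk d :=
  SimplexCategory.Hom.mk ⟨fun i => ⟨β.toOrderHom i - c, by
      have := (β.toOrderHom i).2
      have := h i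
      change _ < n + 1 at *
      change _ < d + 1
      lia⟩,
    fun i j hij => by
      have : (β.toOrderHom i : ℕ) ≤ β.toOrderHom j := β.toOrderHom.monotone hij
      change (β.toOrderHom i : ℕ) - c ≤ β.toOrderHom j - c
      lia⟩

lemma initialMap_comp_le {n n' : ℕ} (f : mk n ⟶ mk n') (p : ℕ) (hp : p ≤ n)
    (i : Fin ((mk p).len + 1)) : ((initialMap p n hp ≫ f).toOrderHom i : ℕ) ≤
      f.toOrderHom ⟨p, Nat.lt_succ_of_le hp⟩ :=
  f.toOrderHom.monotone (Nat.le_of_lt_succ i.2)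

lemma le_finalMap_comp {n n' : ℕ} (f : mk n ⟶ mk n') (p q : ℕ) (h : p + q = n)
    (i : Fin ((mk q).len + 1)) : (f.toOrderHom ⟨p, by change p < n + 1; lia⟩ : ℕ) ≤
      ((finalMap p q n h ≫ f).toOrderHom i : ℕ) :=
  f.toOrderHom.monotone (Nat.le_add_right p i.1)

lemma simplex_hom_ext {p n : ℕ} {f g : mk p ⟶ mk n}
    (h : ∀ i, (f.toOrderHom i : ℕ) = g.toOrderHom i) : f = g :=
  SimplexCategory.Hom.ext _ _ (OrderHom.ext _ _ (funext fun i => Fin.ext (h i)))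

lemma δ_zero_val (n : ℕ) (i : Fin ((mk n).len + 1)) :
    ((SimplexCategory.δ (n := n) 0).toOrderHom i : ℕ) = i.1 + 1 := rfl

lemma δ_last_val (n : ℕ) (i : Fin ((mk n).len + 1)) :
    ((SimplexCategory.δ (Fin.last (n + 1))).toOrderHom i : ℕ) = i.1 := by
  change ((Fin.succAbove (Fin.last (n + 1)) i : Fin (n + 2)) : ℕ) = i.1
  rw [Fin.succAbove_last]
  rfl

end SimplexMaps

section Box

open SimplexCategory (mk)

variable {C : Type*} [Category C] (F : C ⥤ C ⥤ C)

/-- `X^p ⊗ Y^q`, for a bifunctor `F = ⊗`. -/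
abbrev boxTerm (X Y : SimplexCategory ⥤ C) (p q : ℕ) : C :=
  (F.obj (X.obj (mk p))).obj (Y.obj (mk q))

variable (X Y : SimplexCategory ⥤ C)

/-- `X^p ⊗ Y^q ⟶ X^{p'} ⊗ Y^{q'}`. -/
def boxTermMap {p q p' q' : ℕ} (a : mk p ⟶ mk p') (b : mk q ⟶ mk q') :
    boxTerm F X Y p q ⟶ boxTerm F X Y p' q' :=
  (F.map (X.map a)).app _ ≫ (F.obj _).map (Y.map b)

lemma boxTermMap_id (p q : ℕ) : boxTermMap F X Y (𝟙 (mk p)) (𝟙 (mk q)) = 𝟙 _ := by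
  simp [boxTermMap]

lemma boxTermMap_comp {p q p' q' p'' q'' : ℕ} (a : mk p ⟶ mk p') (b : mk q ⟶ mk q')
    (a' : mk p' ⟶ mk p'') (b' : mk q' ⟶ mk q'') :
    boxTermMap F X Y a b ≫ boxTermMap F X Y a' b' = boxTermMap F X Y (a ≫ a') (b ≫ b') := by
  simp [boxTermMap]

/-- Pairs `(p, q)` with `p + q = n`. -/
abbrev Splitting (n : ℕ) : Type := {pq : ℕ × ℕ // pq.1 + pq.2 = n}

/-- Pairs `(r, s)` with `r + s = n - 1`. -/
abbrev PreSplitting (n : ℕ) : Type := {rs : ℕ × ℕ // rs.1 + rs.2 + 1 = n}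

instance (n : ℕ) : Finite (Splitting n) :=
  Finite.of_injective (fun x : Splitting n => (⟨x.1.1, by have := x.2; lia⟩ : Fin (n + 1)))
    fun x y h => by
      have h1 : x.1.1 = y.1.1 := congrArg Fin.val h
      have hx := x.2
      have hy := y.2
      exact Subtype.ext (Prod.ext h1 (by lia))

instance (n : ℕ) : Finite (PreSplitting n) :=
  Finite.of_injective (fun x : PreSplitting n => (⟨x.1.1, by have := x.2; lia⟩ : Fin (n + 1)))
    fun x y h => by
      have h1 : x.1.1 = y.1.1 := congrArg Fin.val h
      have hx := x.2
      have hy := y.2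
      exact Subtype.ext (Prod.ext h1 (by lia))

variable [HasFiniteCoproducts C]

/-- The morphism `∐_{r+s=n-1} X^r ⊗ Y^s ⟶ ∐_{p+q=n} X^p ⊗ Y^q` induced by `id ⊗ d⁰`. -/
def boxLeft (n : ℕ) : (∐ fun rs : PreSplitting n => boxTerm F X Y rs.1.1 rs.1.2) ⟶
    ∐ fun pq : Splitting n => boxTerm F X Y pq.1.1 pq.1.2 :=
  Sigma.desc fun rs => boxTermMap F X Y (𝟙 _) (SimplexCategory.δ 0) ≫
    Sigma.ι (fun pq : Splitting n => boxTerm F X Y pq.1.1 pq.1.2)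
      ⟨(rs.1.1, rs.1.2 + 1), rs.2⟩

/-- The morphism `∐_{r+s=n-1} X^r ⊗ Y^s ⟶ ∐_{p+q=n} X^p ⊗ Y^q` induced by `d^{r+1} ⊗ id`. -/
def boxRight (n : ℕ) : (∐ fun rs : PreSplitting n => boxTerm F X Y rs.1.1 rs.1.2) ⟶
    ∐ fun pq : Splitting n => boxTerm F X Y pq.1.1 pq.1.2 :=
  Sigma.desc fun rs => boxTermMap F X Y (SimplexCategory.δ (Fin.last _)) (𝟙 _) ≫
    Sigma.ι (fun pq : Splitting n => boxTerm F X Y pq.1.1 pq.1.2)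
      ⟨(rs.1.1 + 1, rs.1.2), by have := rs.2; lia⟩

variable [HasCoequalizers C]

/-- The object `(X □ Y)^n`. -/
@[reducible] def boxLevel (n : ℕ) : C := coequalizer (boxLeft F X Y n) (boxRight F X Y n)

/-- The canonical morphism `X^p ⊗ Y^q ⟶ (X □ Y)^n`, for `p + q = n`. -/
def boxι {n : ℕ} (p q : ℕ) (h : p + q = n) : boxTerm F X Y p q ⟶ boxLevel F X Y n :=
  Sigma.ι (fun pq : Splitting n => boxTerm F X Y pq.1.1 pq.1.2) ⟨(p, q), h⟩ ≫
    coequalizer.π (boxLeft F X Y n) (boxRight F X Y n)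

lemma box_condition {n : ℕ} (r s : ℕ) (h : r + (s + 1) = n) (h' : r + 1 + s = n) :
    boxTermMap F X Y (𝟙 (mk r)) (SimplexCategory.δ 0) ≫ boxι F X Y r (s + 1) h =
      boxTermMap F X Y (SimplexCategory.δ (Fin.last _)) (𝟙 (mk s)) ≫
        boxι F X Y (r + 1) s h' := by
  have := Sigma.ι (fun rs : PreSplitting n => boxTerm F X Y rs.1.1 rs.1.2) ⟨(r, s), h⟩ ≫=
    coequalizer.condition (boxLeft F X Y n) (boxRight F X Y n)
  rw [boxLeft, boxRight, Sigma.ι_desc_assoc, Sigma.ι_desc_assoc, Category.assoc,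
    Category.assoc] at this
  exact this

variable {X Y} in
/-- A morphism out of `(X □ Y)^n`. -/
def boxDesc {n : ℕ} {Z : C} (f : ∀ p q : ℕ, p + q = n → (boxTerm F X Y p q ⟶ Z))
    (hf : ∀ (r s : ℕ) (h : r + (s + 1) = n) (h' : r + 1 + s = n),
      boxTermMap F X Y (𝟙 (mk r)) (SimplexCategory.δ 0) ≫ f r (s + 1) h =
        boxTermMap F X Y (SimplexCategory.δ (Fin.last _)) (𝟙 (mk s)) ≫ f (r + 1) s h') :
    boxLevel F X Y n ⟶ Z :=
  coequalizer.desc (Sigma.desc fun pq => f pq.1.1 pq.1.2 pq.2) <| by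
    refine Sigma.hom_ext _ _ fun rs => ?_
    rw [boxLeft, boxRight, Sigma.ι_desc_assoc, Sigma.ι_desc_assoc, Category.assoc,
      Category.assoc, Sigma.ι_desc, Sigma.ι_desc]
    exact hf _ _ _ _

lemma boxι_desc {n : ℕ} {Z : C} (f : ∀ p q : ℕ, p + q = n → (boxTerm F X Y p q ⟶ Z))
    (hf : ∀ (r s : ℕ) (h : r + (s + 1) = n) (h' : r + 1 + s = n),
      boxTermMap F X Y (𝟙 (mk r)) (SimplexCategory.δ 0) ≫ f r (s + 1) h =
        boxTermMap F X Y (SimplexCategory.δ (Fin.last _)) (𝟙 (mk s)) ≫ f (r + 1) s h')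
    (p q : ℕ) (h : p + q = n) : boxι F X Y p q h ≫ boxDesc F f hf = f p q h := by
  rw [boxι, boxDesc, Category.assoc, coequalizer.π_desc, Sigma.ι_desc]

variable {F X Y} in
lemma box_hom_ext {n : ℕ} {Z : C} {f g : boxLevel F X Y n ⟶ Z}
    (h : ∀ (p q : ℕ) (h : p + q = n), boxι F X Y p q h ≫ f = boxι F X Y p q h ≫ g) : f = g := by
  refine coequalizer.hom_ext (Sigma.hom_ext _ _ fun pq => ?_)
  have := h pq.1.1 pq.1.2 pq.2
  rw [boxι, Category.assoc, Category.assoc] at this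
  exact this

/-- For `α : [r] ⟶ [n]` with values `≤ c` and `β : [s] ⟶ [n]` with values `≥ c`, the induced
morphism `X^r ⊗ Y^s ⟶ X^c ⊗ Y^{n-c} ⟶ (X □ Y)^n`. -/
def boxSlide {r s n : ℕ} (α : mk r ⟶ mk n) (β : mk s ⟶ mk n) (c d : ℕ) (hcd : c + d = n)
    (hα : ∀ i, (α.toOrderHom i : ℕ) ≤ c) (hβ : ∀ i, c ≤ (β.toOrderHom i : ℕ)) :
    boxTerm F X Y r s ⟶ boxLevel F X Y n :=
  boxTermMap F X Y (corestrict α c hα) (shiftDown β c d hcd hβ) ≫ boxι F X Y c d hcd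

lemma boxSlide_succ {r s n : ℕ} (α : mk r ⟶ mk n) (β : mk s ⟶ mk n) (c d : ℕ)
    (hcd : c + (d + 1) = n) (hcd' : c + 1 + d = n) (hα : ∀ i, (α.toOrderHom i : ℕ) ≤ c)
    (hβ : ∀ i, c + 1 ≤ (β.toOrderHom i : ℕ)) :
    boxSlide F X Y α β c (d + 1) hcd hα (fun i => (Nat.le_succ c).trans (hβ i)) =
      boxSlide F X Y α β (c + 1) d hcd' (fun i => (hα i).trans (Nat.le_succ c)) hβ := by
  have h1 : shiftDown β c (d + 1) hcd (fun i => (Nat.le_succ c).trans (hβ i)) =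
      shiftDown β (c + 1) d hcd' hβ ≫ SimplexCategory.δ 0 := simplex_hom_ext fun i => by
    have := hβ i
    change (β.toOrderHom i : ℕ) - c = (β.toOrderHom i : ℕ) - (c + 1) + 1
    lia
  have h2 : corestrict α (c + 1) (fun i => (hα i).trans (Nat.le_succ c)) =
      corestrict α c hα ≫ SimplexCategory.δ (Fin.last _) := simplex_hom_ext fun i =>
    (δ_last_val c ((corestrict α c hα).toOrderHom i)).symm
  have h3 := boxTermMap_comp F X Y (corestrict α c hα) (shiftDown β (c + 1) d hcd' hβ) (𝟙 _)
    (SimplexCategory.δ 0)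
  have h4 := boxTermMap_comp F X Y (corestrict α c hα) (shiftDown β (c + 1) d hcd' hβ)
    (SimplexCategory.δ (Fin.last _)) (𝟙 _)
  rw [Category.comp_id] at h3 h4
  rw [boxSlide, boxSlide, h1, h2, ← h3, ← h4, Category.assoc, Category.assoc,
    box_condition F X Y c d hcd hcd']

lemma boxSlide_eq {r s n : ℕ} (α : mk r ⟶ mk n) (β : mk s ⟶ mk n) (c d c' d' : ℕ)
    (hcd : c + d = n) (hcd' : c' + d' = n) (hc : c ≤ c')
    (hα : ∀ i, (α.toOrderHom i : ℕ) ≤ c)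
    (hβ : ∀ i, c' ≤ (β.toOrderHom i : ℕ)) :
    boxSlide F X Y α β c d hcd hα (fun i => hc.trans (hβ i)) =
      boxSlide F X Y α β c' d' hcd' (fun i => (hα i).trans hc) hβ := by
  obtain ⟨k, rfl⟩ := Nat.exists_eq_add_of_le hc
  induction k generalizing d' with
  | zero =>
    obtain rfl : d = d' := by lia
    rfl
  | succ k ih =>
    rw [ih (d' + 1) (by lia) (by lia) fun i => (Nat.le_succ _).trans (hβ i)]
    exact boxSlide_succ F X Y α β (c + k) d' (by lia) (by lia) _ hβ

/-- The cosimplicial structure of `X □ Y`: a map `f : [n] ⟶ [n']` sends `X^p ⊗ Y^q` to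
`X^{f(p)} ⊗ Y^{n' - f(p)}` through the restrictions of `f` to `{0, …, p}` and `{p, …, n}`. In
particular `dⁱ` is `dⁱ ⊗ id` for `i ≤ p` and `id ⊗ d^{i-p}` for `i > p`, and `sʲ` is `sʲ ⊗ id`
for `j < p` and `id ⊗ s^{j-p}` for `j ≥ p`. -/
def boxLevelMap {n n' : ℕ} (f : mk n ⟶ mk n') : boxLevel F X Y n ⟶ boxLevel F X Y n' :=
  boxDesc F (fun p q h => boxSlide F X Y
      (initialMap p n (by lia) ≫ f) (finalMap p q n h ≫ f)
      (f.toOrderHom ⟨p, Nat.lt_succ_of_le (by change p ≤ n; lia)⟩)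
      (n' - f.toOrderHom ⟨p, Nat.lt_succ_of_le (by change p ≤ n; lia)⟩)
      (Nat.add_sub_of_le (Nat.le_of_lt_succ (f.toOrderHom _).2))
      (initialMap_comp_le f p (by lia)) (le_finalMap_comp f p q h))
    (fun r s h h' => by
      have hr : r < n + 1 := by lia
      have hr' : r + 1 < n + 1 := by lia
      have hle : (f.toOrderHom ⟨r, hr⟩ : ℕ) ≤ f.toOrderHom ⟨r + 1, hr'⟩ :=
        f.toOrderHom.monotone (Nat.le_succ r)
      have key := boxSlide_eq F X Y (initialMap r n (by lia) ≫ f)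
        (finalMap (r + 1) s n h' ≫ f) (f.toOrderHom ⟨r, hr⟩) (n' - f.toOrderHom ⟨r, hr⟩)
        (f.toOrderHom ⟨r + 1, hr'⟩) (n' - f.toOrderHom ⟨r + 1, hr'⟩)
        (Nat.add_sub_of_le (Nat.le_of_lt_succ (f.toOrderHom _).2))
        (Nat.add_sub_of_le (Nat.le_of_lt_succ (f.toOrderHom _).2)) hle
        (initialMap_comp_le f r (by lia)) (le_finalMap_comp f (r + 1) s h')
      simp only [boxSlide] at key ⊢
      rw [← Category.assoc, ← Category.assoc, boxTermMap_comp, boxTermMap_comp,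
        Category.id_comp, Category.id_comp]
      refine Eq.trans ?_ (key.trans ?_)
      · congr 2
        refine simplex_hom_ext fun i => ?_
        change (f.toOrderHom _ : ℕ) - _ = (f.toOrderHom _ : ℕ) - _
        congr 3
        refine Fin.ext ?_
        change r + (i.1 + 1) = r + 1 + i.1
        lia
      · congr 2
        refine simplex_hom_ext fun i => ?_
        change (f.toOrderHom _ : ℕ) = (f.toOrderHom _ : ℕ)
        congr 2
        exact Fin.ext (δ_last_val r i).symm)

lemma boxι_levelMap {n n' : ℕ} (f : mk n ⟶ mk n') (p q : ℕ) (h : p + q = n) (p' q' : ℕ)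
    (h' : p' + q' = n')
    (hp : (f.toOrderHom ⟨p, Nat.lt_succ_of_le (by change p ≤ n; lia)⟩ : ℕ) = p') :
    boxι F X Y p q h ≫ boxLevelMap F X Y f =
      boxSlide F X Y (initialMap p n (by lia) ≫ f) (finalMap p q n h ≫ f) p' q' h'
        (fun i => (initialMap_comp_le f p (by lia) i).trans hp.le)
        (fun i => hp.ge.trans (le_finalMap_comp f p q h i)) := by
  subst hp
  obtain rfl : q' = n' - f.toOrderHom ⟨p, Nat.lt_succ_of_le (by change p ≤ n; lia)⟩ := by lia
  exact boxι_desc F _ _ _ _ _ _ _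

lemma boxLevelMap_id (n : ℕ) : boxLevelMap F X Y (𝟙 (mk n)) = 𝟙 _ := by
  refine box_hom_ext fun p q h => ?_
  refine (boxι_levelMap F X Y (𝟙 (mk n)) p q h p q h rfl).trans ?_
  refine Eq.trans ?_ ((Category.id_comp _).trans (Category.comp_id (boxι F X Y p q h)).symm)
  rw [← boxTermMap_id F X Y p q, boxSlide]
  congr 2
  refine simplex_hom_ext fun i => ?_
  change p + i.1 - p = i.1
  lia

lemma boxLevelMap_comp {n n' n'' : ℕ} (f : mk n ⟶ mk n') (g : mk n' ⟶ mk n'') :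
    boxLevelMap F X Y (f ≫ g) = boxLevelMap F X Y f ≫ boxLevelMap F X Y g := by
  refine box_hom_ext fun p q h => ?_
  have hp : p < n + 1 := by lia
  obtain ⟨p', hp'⟩ : ∃ p', p' = f.toOrderHom ⟨p, hp⟩ := ⟨_, rfl⟩
  obtain ⟨p'', hp''⟩ : ∃ p'', p'' = g.toOrderHom p' := ⟨_, rfl⟩
  have e' : (p' : ℕ) + (n' - p') = n' := Nat.add_sub_of_le (Nat.le_of_lt_succ p'.2)
  have e'' : (p'' : ℕ) + (n'' - p'') = n'' := Nat.add_sub_of_le (Nat.le_of_lt_succ p''.2)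
  have h1 := boxι_levelMap F X Y (f ≫ g) p q h p'' (n'' - p'') e''
    (by rw [hp'', hp']; rfl)
  have h2 := boxι_levelMap F X Y f p q h p' (n' - p') e' (by rw [hp'])
  have h3 := boxι_levelMap F X Y g p' (n' - p') e' p'' (n'' - p'') e'' (by rw [hp''])
  have h4 : ∀ (a : mk p ⟶ mk p') (b : mk q ⟶ mk (n' - p')),
      (boxTermMap F X Y a b ≫ boxι F X Y p' (n' - p') e') ≫ boxLevelMap F X Y g =
        boxTermMap F X Y (a ≫ _) (b ≫ _) ≫ boxι F X Y p'' (n'' - p'') e'' := fun a b => by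
    rw [Category.assoc, h3, boxSlide, ← Category.assoc, boxTermMap_comp]
  refine h1.trans (Eq.trans ?_ ((h4 _ _).symm.trans
    ((congrArg (· ≫ boxLevelMap F X Y g) h2).symm.trans (Category.assoc _ _ _))))
  rw [boxSlide]
  congr 2
  refine simplex_hom_ext fun i => ?_
  have hi : p + i.1 < n + 1 := by
    have := i.2
    change i.1 < q + 1 at this
    lia
  have : (p' : ℕ) ≤ f.toOrderHom ⟨p + i.1, hi⟩ := by
    rw [hp']
    exact f.toOrderHom.monotone (Nat.le_add_right p i.1)
  change (g.toOrderHom (f.toOrderHom ⟨p + i.1, hi⟩) : ℕ) - _ = (g.toOrderHom _ : ℕ) - _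
  congr 3
  refine Fin.ext ?_
  change _ = (p' : ℕ) + (f.toOrderHom ⟨p + i.1, hi⟩ - p')
  rw [Nat.add_sub_of_le this]

/-- The box product `X □ Y` of cosimplicial objects:
`(X □ Y)^n = colim (∐_{r+s=n-1} X^r ⊗ Y^s ⇉ ∐_{p+q=n} X^p ⊗ Y^q)`. -/
def box : SimplexCategory ⥤ C where
  obj Δ := boxLevel F X Y Δ.len
  map f := boxLevelMap F X Y f
  map_id Δ := boxLevelMap_id F X Y Δ.len
  map_comp f g := boxLevelMap_comp F X Y f g

section Map

variable {X Y} {X' Y' : SimplexCategory ⥤ C} (φ : X ⟶ X') (ψ : Y ⟶ Y')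

/-- `φ ⊗ ψ : X^p ⊗ Y^q ⟶ X'^p ⊗ Y'^q`. -/
def boxTermHom (p q : ℕ) : boxTerm F X Y p q ⟶ boxTerm F X' Y' p q :=
  (F.map (φ.app (mk p))).app _ ≫ (F.obj _).map (ψ.app (mk q))

lemma boxTermHom_natural {p q p' q' : ℕ} (a : mk p ⟶ mk p') (b : mk q ⟶ mk q') :
    boxTermMap F X Y a b ≫ boxTermHom F φ ψ p' q' =
      boxTermHom F φ ψ p q ≫ boxTermMap F X' Y' a b := by
  simp only [boxTermMap, boxTermHom, Category.assoc, NatTrans.naturality_assoc]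
  rw [← NatTrans.comp_app_assoc, ← NatTrans.comp_app_assoc, ← F.map_comp, ← F.map_comp,
    ← Functor.map_comp, ← Functor.map_comp, φ.naturality, ψ.naturality]

lemma boxTermHom_condition {n : ℕ} (r s : ℕ) (h : r + (s + 1) = n) (h' : r + 1 + s = n) :
    boxTermMap F X Y (𝟙 (mk r)) (SimplexCategory.δ 0) ≫
        boxTermHom F φ ψ r (s + 1) ≫ boxι F X' Y' r (s + 1) h =
      boxTermMap F X Y (SimplexCategory.δ (Fin.last _)) (𝟙 (mk s)) ≫
        boxTermHom F φ ψ (r + 1) s ≫ boxι F X' Y' (r + 1) s h' := by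
  rw [← Category.assoc, ← Category.assoc, boxTermHom_natural, boxTermHom_natural,
    Category.assoc, Category.assoc, box_condition]

/-- Functoriality of `(X □ Y)^n`. -/
def boxLevelHom (n : ℕ) : boxLevel F X Y n ⟶ boxLevel F X' Y' n :=
  boxDesc F (fun p q h => boxTermHom F φ ψ p q ≫ boxι F X' Y' p q h)
    (boxTermHom_condition F φ ψ)

lemma boxι_levelHom {n : ℕ} (p q : ℕ) (h : p + q = n) :
    boxι F X Y p q h ≫ boxLevelHom F φ ψ n = boxTermHom F φ ψ p q ≫ boxι F X' Y' p q h :=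
  boxι_desc F _ _ _ _ _ _ _

lemma boxLevelHom_natural {n n' : ℕ} (f : mk n ⟶ mk n') :
    boxLevelMap F X Y f ≫ boxLevelHom F φ ψ n' = boxLevelHom F φ ψ n ≫ boxLevelMap F X' Y' f := by
  refine box_hom_ext fun p q h => ?_
  have hp : p < n + 1 := by lia
  have e' : (f.toOrderHom ⟨p, hp⟩ : ℕ) + (n' - f.toOrderHom ⟨p, hp⟩) = n' :=
    Nat.add_sub_of_le (Nat.le_of_lt_succ (f.toOrderHom ⟨p, hp⟩).2)
  rw [← Category.assoc, ← Category.assoc, boxι_levelHom, Category.assoc (boxTermHom _ _ _ _ _),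
    boxι_levelMap F X Y f p q h _ _ e' rfl, boxι_levelMap F X' Y' f p q h _ _ e' rfl,
    boxSlide, boxSlide, Category.assoc, boxι_levelHom, ← Category.assoc, boxTermHom_natural,
    Category.assoc]

/-- Functoriality of the box product. -/
def boxMap : box F X Y ⟶ box F X' Y' where
  app Δ := boxLevelHom F φ ψ Δ.len
  naturality _ _ f := boxLevelHom_natural F φ ψ f

end Map

end Box

/-! ### Monoids for the box product over the composition product -/

section BoxComp

open SimplexCategory (mk)

section BoxMaps

variable {C : Type*} [Category C] (F : C ⥤ C ⥤ C) (X Y : SimplexCategory ⥤ C)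
  [HasFiniteCoproducts C] [HasCoequalizers C]

lemma boxι_map_zero {n : ℕ} (p q : ℕ) (h : p + q = n) (h' : p + 1 + q = n + 1) :
    boxι F X Y p q h ≫ boxLevelMap F X Y (SimplexCategory.δ 0) =
      boxTermMap F X Y (SimplexCategory.δ 0) (𝟙 _) ≫ boxι F X Y (p + 1) q h' := by
  rw [boxι_levelMap F X Y _ p q h (p + 1) q h' rfl, boxSlide]
  congr 2
  refine simplex_hom_ext fun i => ?_
  change p + i.1 + 1 - (p + 1) = i.1
  lia

lemma boxι_map_last {n : ℕ} (p q : ℕ) (h : p + q = n) (h' : p + (q + 1) = n + 1) :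
    boxι F X Y p q h ≫ boxLevelMap F X Y (SimplexCategory.δ (Fin.last _)) =
      boxTermMap F X Y (𝟙 _) (SimplexCategory.δ (Fin.last _)) ≫ boxι F X Y p (q + 1) h' := by
  rw [boxι_levelMap F X Y _ p q h p (q + 1) h' (δ_last_val n _), boxSlide]
  congr 2
  · exact simplex_hom_ext fun i => δ_last_val n _
  · refine simplex_hom_ext fun i => ?_
    refine (congrArg (· - p) (δ_last_val n _)).trans (Eq.trans ?_ (δ_last_val q i).symm)
    change p + i.1 - p = i.1
    lia

end BoxMaps

variable {V : Type u} [Category.{v} V] [MonoidalCategory V] [SymmetricCategory V]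
  [HasFiniteCoproducts V] [HasCoequalizers V]

instance : HasFiniteCoproducts (SymSeq V) := ⟨fun _ => inferInstance⟩

lemma boxTermMap_comp_eq (X Y : SimplexCategory ⥤ SymSeq V) {p q p' q' : ℕ} (a : mk p ⟶ mk p')
    (b : mk q ⟶ mk q') :
    boxTermMap compFunctor X Y a b = compMap (X.map a) (Y.map b) := by
  refine (compMap_comp _ _ _ _).trans ?_
  rw [Category.comp_id, Category.id_comp]

/-- The box product over the composition product. -/
abbrev boxCirc (X Y : SimplexCategory ⥤ SymSeq V) : SimplexCategory ⥤ SymSeq V :=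
  box compFunctor X Y

/-- The canonical morphism `X^p ∘ Y^q ⟶ (X □ Y)^n`, for `p + q = n`. -/
def circι (X Y : SimplexCategory ⥤ SymSeq V) {n : ℕ} (p q : ℕ) (h : p + q = n) :
    comp (X.obj (mk p)) (Y.obj (mk q)) ⟶ (boxCirc X Y).obj (mk n) :=
  boxι compFunctor X Y p q h

lemma circι_condition (X Y : SimplexCategory ⥤ SymSeq V) {n : ℕ} (p q : ℕ) (h : p + (q + 1) = n)
    (h' : p + 1 + q = n) :
    compMap (𝟙 _) (Y.map (SimplexCategory.δ 0)) ≫ circι X Y p (q + 1) h =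
      compMap (X.map (SimplexCategory.δ (Fin.last _))) (𝟙 _) ≫ circι X Y (p + 1) q h' := by
  have hc := box_condition compFunctor X Y p q h h'
  rw [boxTermMap_comp_eq, boxTermMap_comp_eq, X.map_id, Y.map_id] at hc
  exact hc

lemma circι_map_zero (X Y : SimplexCategory ⥤ SymSeq V) {n : ℕ} (p q : ℕ) (h : p + q = n)
    (h' : p + 1 + q = n + 1) :
    circι X Y p q h ≫ (boxCirc X Y).map (SimplexCategory.δ 0) =
      compMap (X.map (SimplexCategory.δ 0)) (𝟙 _) ≫ circι X Y (p + 1) q h' := by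
  have hc := boxι_map_zero compFunctor X Y p q h h'
  rw [boxTermMap_comp_eq, Y.map_id] at hc
  exact hc

lemma circι_map_last (X Y : SimplexCategory ⥤ SymSeq V) {n : ℕ} (p q : ℕ) (h : p + q = n)
    (h' : p + (q + 1) = n + 1) :
    circι X Y p q h ≫ (boxCirc X Y).map (SimplexCategory.δ (Fin.last _)) =
      compMap (𝟙 _) (Y.map (SimplexCategory.δ (Fin.last _))) ≫ circι X Y p (q + 1) h' := by
  have hc := boxι_map_last compFunctor X Y p q h h'
  rw [boxTermMap_comp_eq, X.map_id] at hc
  exact hc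

lemma compMap_eq {A A' B B' : SymSeq V} (f : A ⟶ A') (g : B ⟶ B') :
    compMap f g = compMap f (𝟙 _) ≫ compMap (𝟙 _) g := by
  rw [compMap_comp, Category.comp_id, Category.id_comp]

lemma compMap_eq' {A A' B B' : SymSeq V} (f : A ⟶ A') (g : B ⟶ B') :
    compMap f g = compMap (𝟙 _) g ≫ compMap f (𝟙 _) := by
  rw [compMap_comp, Category.comp_id, Category.id_comp]

lemma compMap_comp_left {A A' A'' B : SymSeq V} (f : A ⟶ A') (f' : A' ⟶ A'') :
    compMap (f ≫ f') (𝟙 B) = compMap f (𝟙 _) ≫ compMap f' (𝟙 _) := by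
  rw [compMap_comp, Category.comp_id]

lemma compMap_comp_right {A B B' B'' : SymSeq V} (g : B ⟶ B') (g' : B' ⟶ B'') :
    compMap (𝟙 A) (g ≫ g') = compMap (𝟙 _) g ≫ compMap (𝟙 _) g' := by
  rw [compMap_comp, Category.comp_id]

lemma compAssocLeft_ι {A A' B B' Z Z' M N : SymSeq V} (f : A ⟶ A') (g : B ⟶ B') (k : Z ⟶ Z')
    (i : comp A' B' ⟶ M) (j : comp M Z' ⟶ N) (T : FinNE) :
    comp3Map f g k T ≫ compAssocLeft A' B' Z' T ≫ (compMap i (𝟙 Z') ≫ j).app T =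
      compAssocLeft A B Z T ≫ (compMap (compMap f g ≫ i) k ≫ j).app T := by
  rw [← Category.assoc, compAssocLeft_natural, Category.assoc, ← NatTrans.comp_app,
    ← Category.assoc, compMap_comp, Category.comp_id]

lemma compAssocRight_ι {A A' B B' Z Z' M N : SymSeq V} (f : A ⟶ A') (g : B ⟶ B') (k : Z ⟶ Z')
    (i : comp B' Z' ⟶ M) (j : comp A' M ⟶ N) (T : FinNE) :
    comp3Map f g k T ≫ compAssocRight A' B' Z' T ≫ (compMap (𝟙 A') i ≫ j).app T =
      compAssocRight A B Z T ≫ (compMap f (compMap g k ≫ i) ≫ j).app T := by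
  rw [← Category.assoc, compAssocRight_natural, Category.assoc, ← NatTrans.comp_app,
    ← Category.assoc, compMap_comp, Category.comp_id]

/-- Triples `(p, q, r)` with `p + q + r = n`. -/
abbrev Splitting3 (n : ℕ) : Type := {x : ℕ × ℕ × ℕ // x.1 + x.2.1 + x.2.2 = n}

/-- Triples `(p, q, r)` with `p + q + r = n - 1`. -/
abbrev PreSplitting3 (n : ℕ) : Type := {x : ℕ × ℕ × ℕ // x.1 + x.2.1 + x.2.2 + 1 = n}

instance (n : ℕ) : Finite (Splitting3 n) :=
  Finite.of_injective (fun x : Splitting3 n => ((⟨x.1.1, by have := x.2; lia⟩,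
    ⟨x.1.2.1, by have := x.2; lia⟩, ⟨x.1.2.2, by have := x.2; lia⟩) :
      Fin (n + 1) × Fin (n + 1) × Fin (n + 1)))
    fun x y h => by
      simp only [Prod.mk.injEq, Fin.mk.injEq] at h
      exact Subtype.ext (Prod.ext h.1 (Prod.ext h.2.1 h.2.2))

instance (n : ℕ) : Finite (PreSplitting3 n) :=
  Finite.of_injective (fun x : PreSplitting3 n => ((⟨x.1.1, by have := x.2; lia⟩,
    ⟨x.1.2.1, by have := x.2; lia⟩, ⟨x.1.2.2, by have := x.2; lia⟩) :
      Fin (n + 1) × Fin (n + 1) × Fin (n + 1)))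
    fun x y h => by
      simp only [Prod.mk.injEq, Fin.mk.injEq] at h
      exact Subtype.ext (Prod.ext h.1 (Prod.ext h.2.1 h.2.2))

variable (X Y Z : SimplexCategory ⥤ SymSeq V)

/-- `(X^p ∘ Y^q ∘ Z^r)[T]`. -/
abbrev term3 (T : FinNE) (p q r : ℕ) : V :=
  comp3 (X.obj (mk p)) (Y.obj (mk q)) (Z.obj (mk r)) T

/-- The relations which define `X □ Y □ Z`, one for each of the two adjacent pairs of factors. -/
abbrev Rel3 (n : ℕ) : Type := PreSplitting3 n ⊕ PreSplitting3 n

/-- The source `X^p ∘ Y^q ∘ Z^r` of a relation. -/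
abbrev relTerm3 (T : FinNE) (n : ℕ) (x : Rel3 n) : V :=
  term3 X Y Z T (x.elim id id).1.1 (x.elim id id).1.2.1 (x.elim id id).1.2.2

/-- The inclusion of the summand `(p, q, r)`. -/
def term3ι (T : FinNE) {n : ℕ} (p q r : ℕ) (h : p + q + r = n) : term3 X Y Z T p q r ⟶
    ∐ fun x : Splitting3 n => term3 X Y Z T x.1.1 x.1.2.1 x.1.2.2 :=
  Sigma.ι (fun x : Splitting3 n => term3 X Y Z T x.1.1 x.1.2.1 x.1.2.2) ⟨(p, q, r), h⟩

variable {X Y Z} in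
lemma term3ι_desc {T : FinNE} {n : ℕ} {W : V}
    (f : ∀ p q r : ℕ, p + q + r = n → (term3 X Y Z T p q r ⟶ W)) (p q r : ℕ)
    (h : p + q + r = n) {A : V} (a : A ⟶ term3 X Y Z T p q r) :
    (a ≫ term3ι X Y Z T p q r h) ≫
      Sigma.desc (fun x : Splitting3 n => f x.1.1 x.1.2.1 x.1.2.2 x.2) = a ≫ f p q r h := by
  rw [Category.assoc, term3ι, Sigma.ι_desc]

/-- The morphism with components `id ∘ d⁰ ∘ id` and `id ∘ id ∘ d⁰`. -/
def box3Left (T : FinNE) (n : ℕ) : (∐ relTerm3 X Y Z T n) ⟶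
    ∐ fun x : Splitting3 n => term3 X Y Z T x.1.1 x.1.2.1 x.1.2.2 :=
  Sigma.desc fun
    | .inl x => comp3Map (𝟙 _) (Y.map (SimplexCategory.δ 0)) (𝟙 _) T ≫
        term3ι X Y Z T x.1.1 (x.1.2.1 + 1) x.1.2.2 (by have := x.2; lia)
    | .inr x => comp3Map (𝟙 _) (𝟙 _) (Z.map (SimplexCategory.δ 0)) T ≫
        term3ι X Y Z T x.1.1 x.1.2.1 (x.1.2.2 + 1) (by have := x.2; lia)

/-- The morphism with components `d^{p+1} ∘ id ∘ id` and `id ∘ d^{q+1} ∘ id`. -/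
def box3Right (T : FinNE) (n : ℕ) : (∐ relTerm3 X Y Z T n) ⟶
    ∐ fun x : Splitting3 n => term3 X Y Z T x.1.1 x.1.2.1 x.1.2.2 :=
  Sigma.desc fun
    | .inl x => comp3Map (X.map (SimplexCategory.δ (Fin.last _))) (𝟙 _) (𝟙 _) T ≫
        term3ι X Y Z T (x.1.1 + 1) x.1.2.1 x.1.2.2 (by have := x.2; lia)
    | .inr x => comp3Map (𝟙 _) (Y.map (SimplexCategory.δ (Fin.last _))) (𝟙 _) T ≫
        term3ι X Y Z T x.1.1 (x.1.2.1 + 1) x.1.2.2 (by have := x.2; lia)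

/-- The triple box product `(X □ Y □ Z)^n[T]`: the quotient of `∐_{p+q+r=n} (X^p ∘ Y^q ∘ Z^r)[T]`
which, for `p + q + r = n - 1`, identifies `d^{p+1} ∘ id ∘ id` with `id ∘ d⁰ ∘ id` and
`id ∘ d^{q+1} ∘ id` with `id ∘ id ∘ d⁰`. -/
@[reducible] def box3 (T : FinNE) (n : ℕ) : V := coequalizer (box3Left X Y Z T n) (box3Right X Y Z T n)

/-- The canonical morphism `(X^p ∘ Y^q ∘ Z^r)[T] ⟶ (X □ Y □ Z)^n[T]`. -/
def box3ι (T : FinNE) {n : ℕ} (p q r : ℕ) (h : p + q + r = n) :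
    term3 X Y Z T p q r ⟶ box3 X Y Z T n :=
  term3ι X Y Z T p q r h ≫ coequalizer.π _ _

variable {X Y Z} in
/-- A morphism out of the triple box product. -/
def box3Desc {T : FinNE} {n : ℕ} {W : V}
    (f : ∀ p q r : ℕ, p + q + r = n → (term3 X Y Z T p q r ⟶ W))
    (h1 : ∀ (p q r : ℕ) (h : p + (q + 1) + r = n) (h' : p + 1 + q + r = n),
      comp3Map (𝟙 _) (Y.map (SimplexCategory.δ 0)) (𝟙 _) T ≫ f p (q + 1) r h =
        comp3Map (X.map (SimplexCategory.δ (Fin.last _))) (𝟙 _) (𝟙 _) T ≫ f (p + 1) q r h')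
    (h2 : ∀ (p q r : ℕ) (h : p + q + (r + 1) = n) (h' : p + (q + 1) + r = n),
      comp3Map (𝟙 _) (𝟙 _) (Z.map (SimplexCategory.δ 0)) T ≫ f p q (r + 1) h =
        comp3Map (𝟙 _) (Y.map (SimplexCategory.δ (Fin.last _))) (𝟙 _) T ≫ f p (q + 1) r h') :
    box3 X Y Z T n ⟶ W :=
  coequalizer.desc (Sigma.desc fun x => f x.1.1 x.1.2.1 x.1.2.2 x.2) <| by
    refine Sigma.hom_ext _ _ fun x => ?_
    rw [box3Left, box3Right, Sigma.ι_desc_assoc, Sigma.ι_desc_assoc]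
    rcases x with x | x
    · exact (term3ι_desc f _ _ _ _ _).trans ((h1 _ _ _ _ _).trans (term3ι_desc f _ _ _ _ _).symm)
    · exact (term3ι_desc f _ _ _ _ _).trans ((h2 _ _ _ _ _).trans (term3ι_desc f _ _ _ _ _).symm)

lemma box3ι_desc {T : FinNE} {n : ℕ} {W : V}
    (f : ∀ p q r : ℕ, p + q + r = n → (term3 X Y Z T p q r ⟶ W)) (h1) (h2) (p q r : ℕ)
    (h : p + q + r = n) : box3ι X Y Z T p q r h ≫ box3Desc f h1 h2 = f p q r h := by
  refine (Category.assoc _ _ _).trans ?_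
  rw [box3Desc, coequalizer.π_desc, term3ι, Sigma.ι_desc]

/-- `X^p ∘ Y^q ∘ Z^r ⟶ (X^p ∘ Y^q) ∘ Z^r ⟶ (X □ Y)^{p+q} ∘ Z^r ⟶ ((X □ Y) □ Z)^n`. -/
def assocLeftTerm (T : FinNE) {n : ℕ} (p q r m : ℕ) (hm : p + q = m) (h : m + r = n) :
    term3 X Y Z T p q r ⟶ ((boxCirc (boxCirc X Y) Z).obj (mk n)).obj T :=
  compAssocLeft _ _ _ T ≫ (compMap (circι X Y p q hm) (𝟙 (Z.obj (mk r))) ≫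
    circι (boxCirc X Y) Z m r h).app T

/-- `X^p ∘ Y^q ∘ Z^r ⟶ X^p ∘ (Y^q ∘ Z^r) ⟶ X^p ∘ (Y □ Z)^{q+r} ⟶ (X □ (Y □ Z))^n`. -/
def assocRightTerm (T : FinNE) {n : ℕ} (p q r m : ℕ) (hm : q + r = m) (h : p + m = n) :
    term3 X Y Z T p q r ⟶ ((boxCirc X (boxCirc Y Z)).obj (mk n)).obj T :=
  compAssocRight _ _ _ T ≫ (compMap (𝟙 (X.obj (mk p))) (circι Y Z q r hm) ≫
    circι X (boxCirc Y Z) p m h).app T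

/-- The canonical comparison `X □ Y □ Z ⟶ (X □ Y) □ Z` (an isomorphism if `⊗` preserves finite
colimits in each variable). -/
def boxAssocLeft (T : FinNE) (n : ℕ) :
    box3 X Y Z T n ⟶ ((boxCirc (boxCirc X Y) Z).obj (mk n)).obj T :=
  box3Desc (fun p q r h => assocLeftTerm X Y Z T p q r (p + q) rfl h)
    (fun p q r h h' => by
      have e : ∀ m (hm : p + 1 + q = m) (hm' : m + r = n),
          assocLeftTerm X Y Z T (p + 1) q r (p + 1 + q) rfl h' =
            assocLeftTerm X Y Z T (p + 1) q r m hm hm' := by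
        rintro _ rfl _
        rfl
      rw [e (p + (q + 1)) (by lia) (by lia), assocLeftTerm, assocLeftTerm, compAssocLeft_ι,
        compAssocLeft_ι, circι_condition])
    (fun p q r h h' => by
      change _ = _ ≫ assocLeftTerm X Y Z T p (q + 1) r (p + q + 1) rfl h'
      rw [assocLeftTerm, assocLeftTerm, compAssocLeft_ι, compAssocLeft_ι,
        ← circι_map_last X Y p q rfl rfl, compMap_id, Category.id_comp]
      rw [compMap_eq (circι X Y p q rfl) (Z.map _), compMap_comp_left, Category.assoc,
        Category.assoc, circι_condition])

/-- The canonical comparison `θ : X □ Y □ Z ⟶ X □ (Y □ Z)`. -/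
def boxAssocRight (T : FinNE) (n : ℕ) :
    box3 X Y Z T n ⟶ ((boxCirc X (boxCirc Y Z)).obj (mk n)).obj T :=
  box3Desc (fun p q r h => assocRightTerm X Y Z T p q r (q + r) rfl (by lia))
    (fun p q r h h' => by
      have e : ∀ m (hm : q + 1 + r = m) (hm' : p + m = n),
          assocRightTerm X Y Z T p (q + 1) r (q + 1 + r) rfl (by lia) =
            assocRightTerm X Y Z T p (q + 1) r m hm hm' := by
        rintro _ rfl _
        rfl
      rw [e (q + r + 1) (by lia) (by lia), assocRightTerm, assocRightTerm, compAssocRight_ι,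
        compAssocRight_ι, ← circι_map_zero Y Z q r rfl (by lia), compMap_id, Category.id_comp]
      rw [compMap_eq' (X.map _) (circι Y Z q r rfl), compMap_comp_right, Category.assoc,
        Category.assoc, circι_condition])
    (fun p q r h h' => by
      have e : ∀ m (hm : q + 1 + r = m) (hm' : p + m = n),
          assocRightTerm X Y Z T p (q + 1) r (q + 1 + r) rfl (by lia) =
            assocRightTerm X Y Z T p (q + 1) r m hm hm' := by
        rintro _ rfl _
        rfl
      rw [e (q + (r + 1)) (by lia) (by lia), assocRightTerm, assocRightTerm, compAssocRight_ι,
        compAssocRight_ι, circι_condition])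

end BoxComp

section Monoid

open SimplexCategory (mk)

variable {V : Type u} [Category.{v} V] [MonoidalCategory V] [SymmetricCategory V]
  [HasFiniteCoproducts V] [HasCoequalizers V]

/-- A morphism out of `(X □ Y)^n`. -/
def circDesc {X Y : SimplexCategory ⥤ SymSeq V} {n : ℕ} {W : SymSeq V}
    (f : ∀ p q : ℕ, p + q = n → (comp (X.obj (mk p)) (Y.obj (mk q)) ⟶ W))
    (hf : ∀ (p q : ℕ) (h : p + (q + 1) = n) (h' : p + 1 + q = n),
      compMap (𝟙 _) (Y.map (SimplexCategory.δ 0)) ≫ f p (q + 1) h =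
        compMap (X.map (SimplexCategory.δ (Fin.last _))) (𝟙 _) ≫ f (p + 1) q h') :
    (boxCirc X Y).obj (mk n) ⟶ W :=
  boxDesc compFunctor f fun r s h h' => by
    rw [boxTermMap_comp_eq, boxTermMap_comp_eq, X.map_id, Y.map_id]
    exact hf r s h h'

lemma circι_desc {X Y : SimplexCategory ⥤ SymSeq V} {n : ℕ} {W : SymSeq V}
    (f : ∀ p q : ℕ, p + q = n → (comp (X.obj (mk p)) (Y.obj (mk q)) ⟶ W)) (hf) (p q : ℕ)
    (h : p + q = n) : circι X Y p q h ≫ circDesc f hf = f p q h :=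
  boxι_desc compFunctor X Y f _ p q h

lemma circ_hom_ext {X Y : SimplexCategory ⥤ SymSeq V} {n : ℕ} {W : SymSeq V}
    {f g : (boxCirc X Y).obj (mk n) ⟶ W}
    (h : ∀ (p q : ℕ) (h : p + q = n), circι X Y p q h ≫ f = circι X Y p q h ≫ g) : f = g :=
  box_hom_ext h

lemma circι_map (X Y : SimplexCategory ⥤ SymSeq V) {n n' : ℕ} (f : mk n ⟶ mk n') (p q : ℕ)
    (h : p + q = n) : ∃ (p' q' : ℕ) (h' : p' + q' = n') (a : mk p ⟶ mk p') (b : mk q ⟶ mk q'),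
      a ≫ initialMap p' n' (by lia) = initialMap p n (by lia) ≫ f ∧
      b ≫ finalMap p' q' n' h' = finalMap p q n h ≫ f ∧
      circι X Y p q h ≫ (boxCirc X Y).map f =
        compMap (X.map a) (Y.map b) ≫ circι X Y p' q' h' := by
  have e' : (f.toOrderHom ⟨p, by lia⟩ : ℕ) + (n' - f.toOrderHom ⟨p, by lia⟩) = n' :=
    Nat.add_sub_of_le (Nat.le_of_lt_succ (f.toOrderHom ⟨p, by lia⟩).2)
  have key := boxι_levelMap compFunctor X Y f p q h _ _ e' rfl
  rw [boxSlide, boxTermMap_comp_eq] at key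
  refine ⟨_, _, e', _, _, ?_, ?_, key⟩
  · exact simplex_hom_ext fun i => rfl
  · refine simplex_hom_ext fun i => ?_
    exact Nat.add_sub_of_le (le_finalMap_comp f p q h i)

variable [HasZeroMorphisms V]

lemma compLeftUnit_natural_assoc {B B' W : SymSeq V} (g : B ⟶ B') (h : B' ⟶ W) :
    compMap (𝟙 unitSeq) g ≫ compLeftUnit B' ≫ h = compLeftUnit B ≫ g ≫ h := by
  rw [← Category.assoc, compLeftUnit_natural, Category.assoc]

lemma compRightUnit_natural_assoc {A A' W : SymSeq V} (f : A ⟶ A') (h : A' ⟶ W) :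
    compMap f (𝟙 unitSeq) ≫ compRightUnit A' ≫ h = compRightUnit A ≫ f ≫ h := by
  rw [← Category.assoc, compRightUnit_natural, Category.assoc]

/-- The canonical isomorphism `I □ X ≅ X`, as a morphism (`I` the constant cosimplicial object):
it is `I ∘ X^q ≅ X^q ⟶ X^n` on `I ∘ X^q`, induced by the inclusion of `[q]` in `[n]` as a final
segment. -/
def boxLeftUnit (X : SimplexCategory ⥤ SymSeq V) :
    boxCirc ((Functor.const SimplexCategory).obj unitSeq) X ⟶ X where
  app Δ := circDesc (n := Δ.len) (W := X.obj Δ)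
    (fun p q h => compLeftUnit (X.obj (mk q)) ≫ X.map (finalMap p q Δ.len h))
    fun p q h h' => by
      refine (compLeftUnit_natural_assoc (X.map (SimplexCategory.δ 0)) _).trans ?_
      refine Eq.trans ?_ (congrArg (· ≫ _) (compMap_id _ _).symm)
      refine Eq.trans ?_ (Category.id_comp _).symm
      rw [← X.map_comp]
      congr 2
      refine simplex_hom_ext fun i => ?_
      change p + (i.1 + 1) = p + 1 + i.1
      lia
  naturality Δ Δ' f := by
    refine circ_hom_ext (n := Δ.len) fun p q h => ?_
    obtain ⟨p', q', h', a, b, -, hb, key⟩ :=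
      circι_map ((Functor.const SimplexCategory).obj unitSeq) X f p q h
    refine (Category.assoc _ _ _).symm.trans ?_
    refine (congrArg (· ≫ _) key).trans ?_
    refine (Category.assoc _ _ _).trans ?_
    refine (congrArg (_ ≫ ·) (circι_desc _ _ _ _ _)).trans ?_
    refine Eq.trans ?_ (Category.assoc _ _ _)
    refine Eq.trans ?_ (congrArg (· ≫ _) (circι_desc _ _ _ _ _).symm)
    refine (compLeftUnit_natural_assoc (X.map b) _).trans ?_
    rw [← X.map_comp, hb, X.map_comp, Category.assoc]

/-- The canonical isomorphism `X □ I ≅ X`, as a morphism (`I` the constant cosimplicial object):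
it is `X^p ∘ I ≅ X^p ⟶ X^n` on `X^p ∘ I`, induced by the inclusion of `[p]` in `[n]` as an
initial segment. -/
def boxRightUnit (X : SimplexCategory ⥤ SymSeq V) :
    boxCirc X ((Functor.const SimplexCategory).obj unitSeq) ⟶ X where
  app Δ := circDesc (n := Δ.len) (W := X.obj Δ)
    (fun p q h => compRightUnit (X.obj (mk p)) ≫ X.map (initialMap p Δ.len (by lia)))
    fun p q h h' => by
      refine Eq.trans ?_
        (compRightUnit_natural_assoc (X.map (SimplexCategory.δ (Fin.last _))) _).symm
      refine (congrArg (· ≫ _) (compMap_id _ _)).trans ?_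
      refine (Category.id_comp _).trans ?_
      rw [← X.map_comp]
      congr 2
      exact simplex_hom_ext fun i => (δ_last_val _ i).symm
  naturality Δ Δ' f := by
    refine circ_hom_ext (n := Δ.len) fun p q h => ?_
    obtain ⟨p', q', h', a, b, ha, -, key⟩ :=
      circι_map X ((Functor.const SimplexCategory).obj unitSeq) f p q h
    refine (Category.assoc _ _ _).symm.trans ?_
    refine (congrArg (· ≫ _) key).trans ?_
    refine (Category.assoc _ _ _).trans ?_
    refine (congrArg (_ ≫ ·) (circι_desc _ _ _ _ _)).trans ?_
    refine Eq.trans ?_ (Category.assoc _ _ _)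
    refine Eq.trans ?_ (congrArg (· ≫ _) (circι_desc _ _ _ _ _).symm)
    refine (compRightUnit_natural_assoc (X.map a) _).trans ?_
    rw [← X.map_comp, ha, X.map_comp, Category.assoc]

/-- Functoriality of the box product over the composition product. -/
abbrev circMap {X X' Y Y' : SimplexCategory ⥤ SymSeq V} (φ : X ⟶ X') (ψ : Y ⟶ Y') :
    boxCirc X Y ⟶ boxCirc X' Y' :=
  boxMap compFunctor φ ψ

/-- A monoid for the (not strictly monoidal) product `boxCirc`: an object `X` with
`m : X □ X ⟶ X` and `u : I ⟶ X` such that the composites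
`X □ X □ X ⟶ X □ (X □ X) ⟶ X □ X ⟶ X` and `X □ X □ X ⟶ (X □ X) □ X ⟶ X □ X ⟶ X` agree, and
`I □ X ⟶ X □ X ⟶ X` and `X □ I ⟶ X □ X ⟶ X` are the canonical isomorphisms. -/
structure BoxCircMonoid (X : SimplexCategory ⥤ SymSeq V) where
  mul : boxCirc X X ⟶ X
  one : (Functor.const SimplexCategory).obj unitSeq ⟶ X
  assoc : ∀ (T : FinNE) (n : ℕ),
    boxAssocRight X X X T n ≫ ((circMap (𝟙 X) mul ≫ mul).app (mk n)).app T =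
      boxAssocLeft X X X T n ≫ ((circMap mul (𝟙 X) ≫ mul).app (mk n)).app T
  one_mul : circMap one (𝟙 X) ≫ mul = boxLeftUnit X
  mul_one : circMap (𝟙 X) one ≫ mul = boxRightUnit X

end Monoid

/-! ### The cobar construction on the commutative cooperad -/

section Chains

open SimplexCategory (mk)

/-- Chains `λ₀ ≤ ⋯ ≤ λ_k` of partitions of `T` such that `λ₀` is the partition with one block and
`λ_k` is the partition into singletons. Here `λ ≤ λ'` means that `λ'` refines `λ`, which is the
reverse of the order of equivalence relations. These chains are the simplices different from the
basepoint of the pointed simplicial set `P(T)`. -/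
@[ext]
structure NChain (T : FinNE) (k : ℕ) where
  part : Fin (k + 1) → Setoid T
  anti : Antitone part
  first : part 0 = ⊤
  last : part (Fin.last k) = ⊥

instance (T : FinNE) (k : ℕ) : Finite (NChain T k) :=
  Finite.of_injective NChain.part fun _ _ h => NChain.ext h

/-- The action of bijections on chains. -/
def NChain.comap {T T' : FinNE} (σ : T ⟶ T') {k : ℕ} (γ : NChain T' k) : NChain T k where
  part i := (γ.part i).comap σ.equiv
  anti _ _ h _ _ hxy := γ.anti h hxy
  first := by rw [γ.first]; rfl
  last := by
    rw [γ.last]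
    ext x y
    exact σ.equiv.apply_eq_iff_eq

open Classical in
/-- The simplicial structure of the pointed simplicial set `P(T)`: the `i`-th term of the new chain
is the `f i`-th term of the given one, and the value is the basepoint `none` if the new chain does
not start with the partition with one block or does not end with the partition into singletons. -/
def NChain.pull {T : FinNE} {m n : ℕ} (f : SimplexCategory.mk m ⟶ SimplexCategory.mk n) (γ : NChain T n) : Option (NChain T m) :=
  if h : γ.part (f.toOrderHom 0) = ⊤ ∧ γ.part (f.toOrderHom (Fin.last m)) = ⊥ then
    some
      { part := fun i => γ.part (f.toOrderHom i)
        anti := fun _ _ hij => γ.anti (f.toOrderHom.monotone hij)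
        first := h.1
        last := h.2 }
  else none

lemma NChain.pull_eq_some {T : FinNE} {m n : ℕ} (f : SimplexCategory.mk m ⟶ SimplexCategory.mk n) (γ : NChain T n)
    (γ' : NChain T m) : γ.pull f = some γ' ↔ ∀ i, γ'.part i = γ.part (f.toOrderHom i) := by
  unfold NChain.pull
  split_ifs with h
  · rw [Option.some_inj, NChain.ext_iff, funext_iff]
    exact forall_congr' fun i => eq_comm
  · refine iff_of_false (by simp) fun h' => h ⟨?_, ?_⟩
    · rw [← γ'.first]; exact (h' 0).symm
    · rw [← γ'.last]; exact (h' _).symm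

lemma NChain.pull_eq_none {T : FinNE} {m n : ℕ} (f : SimplexCategory.mk m ⟶ SimplexCategory.mk n) (γ : NChain T n) :
    γ.pull f = none ↔
      ¬ (γ.part (f.toOrderHom 0) = ⊤ ∧ γ.part (f.toOrderHom (Fin.last m)) = ⊥) := by
  unfold NChain.pull
  split_ifs with h <;> simp [h]

lemma NChain.pull_id {T : FinNE} {n : ℕ} (γ : NChain T n) : γ.pull (𝟙 (SimplexCategory.mk n)) = some γ :=
  (NChain.pull_eq_some _ _ _).2 fun _ => rfl

lemma NChain.pull_comp {T : FinNE} {l m n : ℕ} (f : SimplexCategory.mk l ⟶ SimplexCategory.mk m) (g : SimplexCategory.mk m ⟶ SimplexCategory.mk n)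
    (γ : NChain T n) : γ.pull (f ≫ g) = (γ.pull g).bind fun γ' => γ'.pull f := by
  by_cases h : γ.part (g.toOrderHom (f.toOrderHom 0)) = ⊤ ∧
      γ.part (g.toOrderHom (f.toOrderHom (Fin.last l))) = ⊥
  · have hg : γ.part (g.toOrderHom 0) = ⊤ ∧ γ.part (g.toOrderHom (Fin.last m)) = ⊥ :=
      ⟨top_le_iff.1 (h.1.ge.trans (γ.anti (g.toOrderHom.monotone (Fin.zero_le _)))),
        le_bot_iff.1 ((γ.anti (g.toOrderHom.monotone (Fin.le_last _))).trans h.2.le)⟩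
    obtain ⟨γ₁, h₁⟩ := Option.ne_none_iff_exists'.1
      (fun h' => (NChain.pull_eq_none g γ).1 h' hg)
    rw [h₁, Option.bind_some]
    rw [NChain.pull_eq_some] at h₁
    obtain ⟨γ₂, h₂⟩ := Option.ne_none_iff_exists'.1
      (fun h' => (NChain.pull_eq_none f γ₁).1 h' ⟨(h₁ _).trans h.1, (h₁ _).trans h.2⟩)
    rw [h₂, NChain.pull_eq_some]
    rw [NChain.pull_eq_some] at h₂
    exact fun i => (h₂ i).trans (h₁ _)
  · rw [(NChain.pull_eq_none (f ≫ g) γ).2 h]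
    symm
    rcases h₁ : γ.pull g with _ | γ₁
    · rfl
    · rw [NChain.pull_eq_some] at h₁
      rw [Option.bind_some, NChain.pull_eq_none, h₁, h₁]
      exact h

lemma NChain.pull_comap {T T' : FinNE} (σ : T ⟶ T') {m n : ℕ} (f : SimplexCategory.mk m ⟶ SimplexCategory.mk n)
    (γ : NChain T' n) : (γ.comap σ).pull f = (γ.pull f).map (NChain.comap σ) := by
  rcases h : γ.pull f with _ | γ₁
  · rw [NChain.pull_eq_none] at h
    rw [Option.map_none, NChain.pull_eq_none]
    refine fun h' => h ⟨?_, ?_⟩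
    · refine top_le_iff.1 fun x y _ => ?_
      have : (γ.part (f.toOrderHom 0)).comap σ.equiv (σ.equiv.symm x) (σ.equiv.symm y) := by
        have h1 := h'.1
        change (γ.part (f.toOrderHom 0)).comap σ.equiv = ⊤ at h1
        rw [h1]
        trivial
      change γ.part _ (σ.equiv (σ.equiv.symm x)) (σ.equiv (σ.equiv.symm y)) at this
      rwa [σ.equiv.apply_symm_apply, σ.equiv.apply_symm_apply] at this
    · refine le_bot_iff.1 fun x y hxy => ?_
      have h2 := h'.2
      change (γ.part (f.toOrderHom (Fin.last m))).comap σ.equiv = ⊥ at h2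
      have : (γ.part (f.toOrderHom (Fin.last m))).comap σ.equiv (σ.equiv.symm x)
          (σ.equiv.symm y) := by
        change γ.part _ (σ.equiv (σ.equiv.symm x)) (σ.equiv (σ.equiv.symm y))
        rwa [σ.equiv.apply_symm_apply, σ.equiv.apply_symm_apply]
      rw [h2] at this
      exact σ.equiv.symm.injective this
  · rw [NChain.pull_eq_some] at h
    rw [Option.map_some, NChain.pull_eq_some]
    intro i
    change (γ₁.part i).comap _ = (γ.part _).comap _
    rw [h i]

/-- The partition of `T` obtained from partitions of all blocks of a partition of `T`. -/
def sumPartition {T : FinNE} (s : Setoid T) (μ : ∀ j : Quotient s, Setoid (block s j)) :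
    Setoid T where
  r x y := ∃ (j : Quotient s) (hx : Quotient.mk s x = j) (hy : Quotient.mk s y = j),
    μ j ⟨x, hx⟩ ⟨y, hy⟩
  iseqv :=
    { refl := fun x => ⟨_, rfl, rfl, Setoid.refl' _ _⟩
      symm := fun ⟨j, hx, hy, h⟩ => ⟨j, hy, hx, Setoid.symm' _ h⟩
      trans := by
        rintro x y z ⟨j, hx, hy, h⟩ ⟨j', hy', hz, h'⟩
        obtain rfl : j = j' := hy.symm.trans hy'
        exact ⟨j, hx, hz, Setoid.trans' _ h h'⟩ }

lemma sumPartition_le {T : FinNE} (s : Setoid T) (μ : ∀ j : Quotient s, Setoid (block s j)) :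
    sumPartition s μ ≤ s := fun _ _ ⟨_, hx, hy, _⟩ => Quotient.exact (hx.trans hy.symm)

/-- The projection of `T` to the set of blocks of a partition. -/
def toBlocks {T : FinNE} (s : Setoid T) : T → blocks s := Quotient.mk s

lemma toBlocks_eq {T : FinNE} {s : Setoid T} {x y : T} : toBlocks s x = toBlocks s y ↔ s x y :=
  Quotient.eq

/-- The terms of the chain `NChain.graft`. -/
def graftPart {T : FinNE} (s : Setoid T) {p q : ℕ} (γ : NChain (blocks s) p)
    (β : ∀ j : Quotient s, NChain (block s j) q) (i : Fin (p + q + 1)) : Setoid T :=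
  if h : i.1 ≤ p then (γ.part ⟨i.1, Nat.lt_succ_of_le h⟩).comap (toBlocks s)
  else sumPartition s fun j => (β j).part ⟨i.1 - p, by have := i.2; lia⟩

lemma graftPart_of_le {T : FinNE} (s : Setoid T) {p q : ℕ} (γ : NChain (blocks s) p)
    (β : ∀ j : Quotient s, NChain (block s j) q) (i : Fin (p + q + 1)) (k : Fin (p + 1))
    (h : i.1 = k.1) : graftPart s γ β i = (γ.part k).comap (toBlocks s) := by
  have hi : i.1 ≤ p := h.le.trans (Nat.le_of_lt_succ k.2)
  obtain rfl : k = ⟨i.1, Nat.lt_succ_of_le hi⟩ := Fin.ext h.symm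
  exact dif_pos hi

lemma graftPart_of_lt {T : FinNE} (s : Setoid T) {p q : ℕ} (γ : NChain (blocks s) p)
    (β : ∀ j : Quotient s, NChain (block s j) q) (i : Fin (p + q + 1)) (k : Fin (q + 1))
    (h : i.1 = p + k.1) (hk : k.1 ≠ 0) :
    graftPart s γ β i = sumPartition s fun j => (β j).part k := by
  have hi : ¬ i.1 ≤ p := by lia
  have hk' : (⟨i.1 - p, by have := i.2; lia⟩ : Fin (q + 1)) = k :=
    Fin.ext (by change i.1 - p = k.1; lia)
  rw [graftPart, dif_neg hi, hk']

lemma sumPartition_iff {T : FinNE} (s : Setoid T) (μ : ∀ j : Quotient s, Setoid (block s j))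
    (j : Quotient s) (a b : block s j) : sumPartition s μ a.1 b.1 ↔ μ j a b := by
  refine ⟨?_, fun h => ⟨j, a.2, b.2, h⟩⟩
  rintro ⟨j', ha, hb, h⟩
  obtain rfl : j = j' := a.2.symm.trans ha
  exact h

lemma sumPartition_bot {T : FinNE} (s : Setoid T) :
    sumPartition s (fun _ => (⊥ : Setoid (block s _))) = ⊥ :=
  le_bot_iff.1 fun _ _ ⟨_, _, _, h⟩ => congrArg Subtype.val h

lemma graftPart_antitone {T : FinNE} (s : Setoid T) {p q : ℕ} (γ : NChain (blocks s) p)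
    (β : ∀ j : Quotient s, NChain (block s j) q) : Antitone (graftPart s γ β) := by
  intro i i' hii
  have hii' : i.1 ≤ i'.1 := hii
  have h2 := i'.2
  by_cases h' : i'.1 ≤ p
  · rw [graftPart_of_le s γ β i' ⟨i'.1, by lia⟩ rfl, graftPart_of_le s γ β i ⟨i.1, by lia⟩ rfl]
    exact fun x y hxy => γ.anti (Fin.mk_le_mk.2 hii') hxy
  · rw [graftPart_of_lt s γ β i' ⟨i'.1 - p, by lia⟩ (by change i'.1 = p + (i'.1 - p); lia)
      (by change i'.1 - p ≠ 0; lia)]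
    by_cases h : i.1 ≤ p
    · rw [graftPart_of_le s γ β i ⟨i.1, by lia⟩ rfl]
      refine (sumPartition_le s _).trans fun x y hxy => ?_
      change (γ.part _) (toBlocks s x) (toBlocks s y)
      rw [toBlocks_eq.2 hxy]
    · rw [graftPart_of_lt s γ β i ⟨i.1 - p, by lia⟩ (by change i.1 = p + (i.1 - p); lia)
        (by change i.1 - p ≠ 0; lia)]
      rintro x y ⟨j, hx, hy, hxy⟩
      exact ⟨j, hx, hy, (β j).anti (Fin.mk_le_mk.2 (Nat.sub_le_sub_right hii' p)) hxy⟩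

lemma graftPart_last {T : FinNE} (s : Setoid T) {p q : ℕ} (γ : NChain (blocks s) p)
    (β : ∀ j : Quotient s, NChain (block s j) q) :
    graftPart s γ β (Fin.last (p + q)) = ⊥ := by
  by_cases hq : q = 0
  · subst hq
    refine (graftPart_of_le s γ β (Fin.last (p + 0)) (Fin.last p) rfl).trans ?_
    rw [γ.last]
    refine le_bot_iff.1 fun x y hxy => ?_
    have hs : s x y := toBlocks_eq.1 hxy
    let j : Quotient s := Quotient.mk s x
    have hj : (⊤ : Setoid (block s j)) = ⊥ := (β j).first.symm.trans (β j).last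
    let a : block s j := ⟨x, rfl⟩
    let b : block s j := ⟨y, (Quotient.sound hs).symm⟩
    have : (⊤ : Setoid (block s j)) a b := trivial
    rw [hj] at this
    exact congrArg Subtype.val this
  · rw [graftPart_of_lt s γ β _ (Fin.last q) rfl hq]
    simp only [NChain.last, sumPartition_bot]

/-- The chain `γ ∘ (β_j)_j` of partitions of `T`, for a partition `s` of `T`, a chain `γ` of
partitions of the set of blocks of `s`, and chains `β_j` of partitions of the blocks `j` of `s`:
its terms up to the `p`-th one are the partitions of `T` obtained from those of `γ` by replacing
each block of `s` by its elements, and its terms from the `p`-th one on are the disjoint unions of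
the partitions in the `β_j` (the `p`-th term is `s`, from either point of view). -/
def NChain.graft {T : FinNE} (s : Setoid T) {p q : ℕ} (γ : NChain (blocks s) p)
    (β : ∀ j : Quotient s, NChain (block s j) q) : NChain T (p + q) where
  part := graftPart s γ β
  anti := graftPart_antitone s γ β
  first := by
    rw [graftPart_of_le s γ β 0 0 rfl, γ.first]
    rfl
  last := graftPart_last s γ β

open Classical in
/-- The decomposition map `Ψ`: the decomposition `γ' = γ ∘ (β_j)_j` of a chain `γ'` with respect to
a partition `s` if there is one, and the basepoint `none` otherwise. -/
def NChain.ungraft {T : FinNE} {p q : ℕ} (γ' : NChain T (p + q)) (s : Setoid T) :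
    Option (NChain (blocks s) p × ∀ j : Quotient s, NChain (block s j) q) :=
  if h : ∃ x : NChain (blocks s) p × ∀ j : Quotient s, NChain (block s j) q,
      NChain.graft s x.1 x.2 = γ' then
    some h.choose
  else none

/-- A chain decomposes with respect to a given partition in at most one way. -/
lemma NChain.graft_injective {T : FinNE} (s : Setoid T) {p q : ℕ}
    (x y : NChain (blocks s) p × ∀ j : Quotient s, NChain (block s j) q)
    (h : NChain.graft s x.1 x.2 = NChain.graft s y.1 y.2) : x = y := by
  have hp : ∀ i, graftPart s x.1 x.2 i = graftPart s y.1 y.2 i :=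
    fun i => congrFun (congrArg NChain.part h) i
  refine Prod.ext (NChain.ext (funext fun i => ?_)) (funext fun j => NChain.ext (funext fun i => ?_))
  · have := hp ⟨i.1, by have := i.2; lia⟩
    rw [graftPart_of_le _ _ _ _ i rfl, graftPart_of_le _ _ _ _ i rfl] at this
    ext a b
    obtain ⟨c, rfl⟩ := Quotient.exists_rep a
    obtain ⟨d, rfl⟩ := Quotient.exists_rep b
    exact iff_of_eq (congrArg (fun r : Setoid T => r c d) this)
  · by_cases hi : i.1 = 0
    · obtain rfl : i = 0 := Fin.ext hi
      rw [(x.2 j).first, (y.2 j).first]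
    · have := hp ⟨p + i.1, by have := i.2; lia⟩
      rw [graftPart_of_lt _ _ _ _ i rfl hi, graftPart_of_lt _ _ _ _ i rfl hi] at this
      ext a b
      exact (sumPartition_iff s (fun j => (x.2 j).part i) j a b).symm.trans
        ((iff_of_eq (congrArg (fun r : Setoid T => r a.1 b.1) this)).trans
          (sumPartition_iff s (fun j => (y.2 j).part i) j a b))

end Chains

section Cobar

open SimplexCategory (mk)

variable (V : Type u) [Category.{v} V] [MonoidalCategory V] [HasFiniteProducts V]

/-- `C(S)^k`, as a symmetric sequence: the product of copies of the unit object `𝟙` over the set of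
chains. -/
def cobarLevel (k : ℕ) : SymSeq V where
  obj T := ∏ᶜ fun _ : NChain T k => 𝟙_ V
  map {T T'} σ := Pi.lift fun γ => Pi.π (fun _ : NChain T k => 𝟙_ V) (γ.comap σ)
  map_id T := by
    refine Pi.hom_ext _ _ fun γ => ?_
    rw [Pi.lift_π, Category.id_comp]
    rfl
  map_comp σ τ := by
    refine Pi.hom_ext _ _ fun γ => ?_
    rw [Pi.lift_π, Category.assoc, Pi.lift_π, Pi.lift_π]
    rfl

/-- The projection of `C(S)^k[T]` to the factor of a chain. -/
def cobarπ {T : FinNE} {k : ℕ} (γ : NChain T k) : (cobarLevel V k).obj T ⟶ 𝟙_ V :=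
  Pi.π (fun _ : NChain T k => 𝟙_ V) γ

variable {V} in
/-- A morphism to `C(S)^k[T]`, given by its components. -/
def cobarLift {T : FinNE} {k : ℕ} {A : V} (f : NChain T k → (A ⟶ 𝟙_ V)) :
    A ⟶ (cobarLevel V k).obj T :=
  Pi.lift f

@[simp]
lemma cobarLift_π {T : FinNE} {k : ℕ} {A : V} (f : NChain T k → (A ⟶ 𝟙_ V)) (γ : NChain T k) :
    cobarLift f ≫ cobarπ V γ = f γ :=
  Pi.lift_π _ _

variable {V} in
lemma cobar_hom_ext {T : FinNE} {k : ℕ} {A : V} {f g : A ⟶ (cobarLevel V k).obj T}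
    (h : ∀ γ : NChain T k, f ≫ cobarπ V γ = g ≫ cobarπ V γ) : f = g :=
  Pi.hom_ext _ _ h

lemma cobarLevel_map_π {T T' : FinNE} (σ : T ⟶ T') {k : ℕ} (γ : NChain T' k) :
    (cobarLevel V k).map σ ≫ cobarπ V γ = cobarπ V (γ.comap σ) :=
  Pi.lift_π _ _

variable [HasZeroMorphisms V]

/-- The projection to the factor of a simplex of `P(T)`, which is zero for the basepoint. -/
def cobarπ' {T : FinNE} {k : ℕ} : Option (NChain T k) → ((cobarLevel V k).obj T ⟶ 𝟙_ V)
  | none => 0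
  | some γ => cobarπ V γ

/-- The cosimplicial structure of `C(S)`: the component at a simplex `γ` of `P(T)` of the morphism
induced by `f` is the projection to the factor of the simplex `f^* γ`. -/
def cobarLevelMap {m n : ℕ} (f : mk m ⟶ mk n) : cobarLevel V m ⟶ cobarLevel V n where
  app T := cobarLift fun γ => cobarπ' V (γ.pull f)
  naturality T T' σ := by
    refine cobar_hom_ext fun γ => ?_
    rw [Category.assoc, Category.assoc, cobarLift_π, cobarLevel_map_π, cobarLift_π,
      NChain.pull_comap]
    rcases γ.pull f with _ | γ₁
    · exact comp_zero
    · exact cobarLevel_map_π V σ γ₁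

lemma cobarLevelMap_π {m n : ℕ} (f : mk m ⟶ mk n) {T : FinNE} (γ : NChain T n) :
    (cobarLevelMap V f).app T ≫ cobarπ V γ = cobarπ' V (γ.pull f) :=
  cobarLift_π V _ γ

lemma cobarLevelMap_π' {m n : ℕ} (f : mk m ⟶ mk n) {T : FinNE} (γ : Option (NChain T n)) :
    (cobarLevelMap V f).app T ≫ cobarπ' V γ = cobarπ' V (γ.bind fun γ₁ => γ₁.pull f) := by
  rcases γ with _ | γ
  · exact comp_zero
  · exact cobarLevelMap_π V f γ

lemma cobarLevelMap_id (n : ℕ) : cobarLevelMap V (𝟙 (mk n)) = 𝟙 _ := by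
  ext T : 2
  refine cobar_hom_ext fun γ => ?_
  rw [cobarLevelMap_π, NChain.pull_id, NatTrans.id_app, Category.id_comp]
  rfl

lemma cobarLevelMap_comp {l m n : ℕ} (f : mk l ⟶ mk m) (g : mk m ⟶ mk n) :
    cobarLevelMap V (f ≫ g) = cobarLevelMap V f ≫ cobarLevelMap V g := by
  ext T : 2
  refine cobar_hom_ext fun γ => ?_
  rw [cobarLevelMap_π, NatTrans.comp_app, Category.assoc, cobarLevelMap_π, cobarLevelMap_π',
    NChain.pull_comp]

/-- The cosimplicial symmetric sequence `C(S)`: at `T` and in cosimplicial degree `k` it is the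
product of copies of `𝟙` over the set of `k`-simplices of `P(T)` different from the basepoint, and
its cosimplicial structure is induced by the simplicial structure of the pointed simplicial set
`P(T)`. -/
def cobar : SimplexCategory ⥤ SymSeq V where
  obj Δ := cobarLevel V Δ.len
  map f := cobarLevelMap V f
  map_id Δ := cobarLevelMap_id V Δ.len
  map_comp f g := cobarLevelMap_comp V f g

variable [SymmetricCategory V] [HasFiniteCoproducts V]

/-- The component at a chain `γ'` of the morphism `m_{p,q}` on the summand of `C(S)^p ∘ C(S)^q` at
a partition `s`: if `γ' = γ ∘ (β_j)_j`, it is the tensor product of the projections to the factors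
of `γ` and of the `β_j`, followed by `𝟙 ⊗ ⋯ ⊗ 𝟙 ≅ 𝟙`, and otherwise it is zero. -/
def cobarMulComponent {T : FinNE} {p q : ℕ} (s : Setoid T) (γ' : NChain T (p + q)) :
    compSummand (cobarLevel V p) (cobarLevel V q) s ⟶ 𝟙_ V :=
  match γ'.ungraft s with
  | none => 0
  | some x => (cobarπ V x.1 ⊗ₘ collapse fun j => cobarπ V (x.2 j)) ≫ (λ_ (𝟙_ V)).hom

/-- The morphism `m_{p,q} : C(S)^p ∘ C(S)^q ⟶ C(S)^{p+q}`, at `T`. -/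
def cobarMul (p q : ℕ) (T : FinNE) :
    (comp ((cobar V).obj (mk p)) ((cobar V).obj (mk q))).obj T ⟶
      ((cobar V).obj (mk (p + q))).obj T :=
  compDesc (A := cobarLevel V p) (B := cobarLevel V q) fun s =>
    cobarLift fun γ' => cobarMulComponent V s γ'

/-- The morphism `I ⟶ C(S)^k` all of whose components are the canonical morphisms `I[T] ⟶ 𝟙`. -/
def cobarUnitLevel (k : ℕ) : unitSeq ⟶ cobarLevel V k where
  app T := cobarLift fun _ => unitε T
  naturality T T' σ := by
    refine cobar_hom_ext fun γ => ?_
    rw [Category.assoc, Category.assoc, cobarLift_π, cobarLevel_map_π, cobarLift_π, unitSeq_map_ε]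

lemma cobarUnitLevel_π (k : ℕ) {T : FinNE} (γ : NChain T k) :
    (cobarUnitLevel V k).app T ≫ cobarπ V γ = unitε T :=
  cobarLift_π V _ γ

lemma cobarUnitLevel_map {m n : ℕ} (f : mk m ⟶ mk n) :
    cobarUnitLevel V m ≫ cobarLevelMap V f = cobarUnitLevel V n := by
  ext T : 2
  refine cobar_hom_ext fun γ => ?_
  rw [NatTrans.comp_app, Category.assoc, cobarLevelMap_π, cobarUnitLevel_π]
  rcases h : γ.pull f with _ | γ₁
  · refine comp_zero.trans (Sigma.hom_ext _ _ fun hT => ?_)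
    have := hT.down
    have hs : ∀ r r' : Setoid T, r = r' := fun r r' => by
      ext x y
      rw [Subsingleton.elim x y]
      exact iff_of_true (Setoid.refl' _ _) (Setoid.refl' _ _)
    exact absurd ⟨hs _ _, hs _ _⟩ ((NChain.pull_eq_none _ γ).1 h)
  · exact cobarUnitLevel_π V m γ₁

/-- The coaugmentation `I ⟶ C(S)` given by the identity on `I`: if `T` has one element, then there
is only one chain for every `k`, so that `C(S)^k[T] = 𝟙 = I[T]`; if `T` has more than one element,
then `I[T]` is zero. -/
def cobarUnit : (Functor.const SimplexCategory).obj unitSeq ⟶ cobar V where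
  app Δ := cobarUnitLevel V Δ.len
  naturality _ _ f := (Category.id_comp _).trans (cobarUnitLevel_map V f).symm

end Cobar

end BoxCirc

end

/-! A morphism to C(S)^n[T] is the family of its components at the chains γ, so every identity to be
proved is an identity between morphisms to 𝟙. The morphisms that occur are products of projections
to factors: `mulUnit` multiplies two morphisms to 𝟙, `collapse` a finite family of them. Since 𝟙 is
a commutative monoid under 𝟙 ⊗ 𝟙 ≅ 𝟙, these products do not see the coherence maps: associators,
reorderings, the shuffle `zip` and the grouping into fibres `fibrewise` all carry products to
products (`associator_inv_mulUnit`, `tensMap_collapse`, `zip_collapse`, `fibrewise_collapse`). What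
is left is to compare sequences of partitions.

The basepoint is handled by working with total operations. `seqπ V u` is defined for every sequence
`u` of partitions, and is zero unless `u` is a chain from min to max. `quoPartition s w` and
`restrictPartition w j` turn any partition `w` of T into a partition of T/s and of the block j. The
component of m_{p,q} at γ on the summand of s is then `compSeqπ V s u v`, with u = (γ_0, …, γ_p) and
v = (γ_p, …, γ_n) (`cobarMulComponent_eq`). If all factors of this product are chains, then s = γ_p:
the restrictions to the blocks start with min, so s refines γ_p, and the sequence on T/s ends with
max, so γ_p refines s. Then γ is grafted from the pieces (`graft_eq_of_parts`). If some factor is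
not a chain, the product is zero, because ⊗ preserves zero morphisms in a closed category. Therefore
the formula holds for every antitone sequence instead of γ (`compι_cobarMulHom`), and no later
argument has to ask whether a decomposition exists.

Each structure map now acts on projections by reindexing or transporting sequences: `levelMap_seqπ`
for simplicial operators, `map_seqπ` for bijections, `compSummandHom_compSeqπ` and
`compSummandMap_compSeqπ` on summands. In the coequalizer relation both sides read the terms 0, …, p
of γ on T/s and the terms p+1, …, n on the blocks of s. For the units, only the one-block partition
contributes to I ∘ B and only the partition into singletons to A ∘ I.

For associativity, on the summand of a pair (s, t) both composites are `comp3Seqπ` of the three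
segments of γ cut at p and p + q: the first is read on T/s, the second on the blocks of t inside
each block of s, the third on the blocks of t. The combinatorial input is that quotients can be
formed in stages and commute with restriction to a block (`quoPartition_comap_quotientBlocks`,
`quoPartition_comap_restrictBlocks`). -/

noncomputable section

namespace BoxCirc

/-! ### Products of morphisms to the unit object, and their compatibility with the coherence maps.
-/

section Collapse

variable {V : Type u} [Category.{v} V] [MonoidalCategory V]

/-- The product of two morphisms to the unit object. -/
def mulUnit {A B : V} (f : A ⟶ 𝟙_ V) (g : B ⟶ 𝟙_ V) : A ⊗ B ⟶ 𝟙_ V :=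
  (f ⊗ₘ g) ≫ (λ_ (𝟙_ V)).hom

lemma tensorHom_mulUnit {A A' B B' : V} (a : A' ⟶ A) (b : B' ⟶ B) (f : A ⟶ 𝟙_ V)
    (g : B ⟶ 𝟙_ V) : (a ⊗ₘ b) ≫ mulUnit f g = mulUnit (a ≫ f) (b ≫ g) := by
  rw [mulUnit, tensorHom_comp_tensorHom_assoc, mulUnit]

lemma whiskerLeft_mulUnit {A B B' : V} (b : B' ⟶ B) (f : A ⟶ 𝟙_ V) (g : B ⟶ 𝟙_ V) :
    A ◁ b ≫ mulUnit f g = mulUnit f (b ≫ g) := by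
  rw [← id_tensorHom, tensorHom_mulUnit, Category.id_comp]

lemma whiskerRight_mulUnit {A A' B : V} (a : A' ⟶ A) (f : A ⟶ 𝟙_ V) (g : B ⟶ 𝟙_ V) :
    a ▷ B ≫ mulUnit f g = mulUnit (a ≫ f) g := by
  rw [← tensorHom_id, tensorHom_mulUnit, Category.id_comp]

/-- Associativity of 𝟙 ⊗ 𝟙 ≅ 𝟙: naturality reduces it to the case of identities, which is the
triangle identity together with the equality of the two unitors of 𝟙. -/
lemma associator_inv_mulUnit {A B Z : V} (f : A ⟶ 𝟙_ V) (g : B ⟶ 𝟙_ V) (h : Z ⟶ 𝟙_ V) :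
    (α_ A B Z).inv ≫ mulUnit (mulUnit f g) h = mulUnit f (mulUnit g h) := by
  have e : mulUnit (mulUnit f g) h =
      ((f ⊗ₘ g) ⊗ₘ h) ≫ ((λ_ (𝟙_ V)).hom ▷ 𝟙_ V) ≫ (λ_ (𝟙_ V)).hom := by
    rw [mulUnit, mulUnit, tensorHom_comp_whiskerRight_assoc]
  have e' : mulUnit f (mulUnit g h) =
      (f ⊗ₘ (g ⊗ₘ h)) ≫ (𝟙_ V ◁ (λ_ (𝟙_ V)).hom) ≫ (λ_ (𝟙_ V)).hom := by
    rw [mulUnit, mulUnit, tensorHom_comp_whiskerLeft_assoc]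
  rw [e, e', ← associator_inv_naturality_assoc]
  congr 1
  simp [unitors_equal]

lemma leftUnitor_inv_mulUnit {A : V} (f : A ⟶ 𝟙_ V) :
    (λ_ A).inv ≫ mulUnit (𝟙 (𝟙_ V)) f = f := by
  simp [mulUnit]

/-- Splitting a list only rebrackets the product, so induction on the first list uses associativity
at each step and the unit law at the end. -/
lemma splitList_collapseList {J : Type} {X : J → V} (f : ∀ j, X j ⟶ 𝟙_ V) (l l' : List J) :
    splitList X l l' ≫ mulUnit (collapseList f l) (collapseList f l') =
      collapseList f (l ++ l') := by
  induction l with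
  | nil => exact leftUnitor_inv_mulUnit _
  | cons j l ih =>
    change (X j ◁ splitList X l l' ≫ (α_ _ _ _).inv) ≫
      mulUnit (mulUnit (f j) (collapseList f l)) (collapseList f l') =
        mulUnit (f j) (collapseList f (l ++ l'))
    rw [Category.assoc, associator_inv_mulUnit, whiskerLeft_mulUnit, ih]

lemma bracketList_collapseList {I J : Type} (φ : I → List J) {X : J → V}
    (f : ∀ j, X j ⟶ 𝟙_ V) (l : List I) :
    bracketList φ X l ≫ collapseList (fun i => collapseList f (φ i)) l =
      collapseList f (l.flatMap φ) := by
  induction l with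
  | nil => exact Category.id_comp _
  | cons i l ih =>
    change (splitList X (φ i) (l.flatMap φ) ≫ tensList X (φ i) ◁ bracketList φ X l) ≫
      mulUnit (collapseList f (φ i)) (collapseList (fun i => collapseList f (φ i)) l) =
        collapseList f (φ i ++ l.flatMap φ)
    rw [Category.assoc, whiskerLeft_mulUnit, ih, splitList_collapseList]

lemma relabelList_collapseList {I J : Type} (e : I → J) {X : J → V} (f : ∀ j, X j ⟶ 𝟙_ V)
    (l : List I) :
    relabelList e X l ≫ collapseList (fun i => f (e i)) l = collapseList f (l.map e) := by
  induction l with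
  | nil => exact Category.id_comp _
  | cons i l ih =>
    change X (e i) ◁ relabelList e X l ≫
      mulUnit (f (e i)) (collapseList (fun i => f (e i)) l) =
        mulUnit (f (e i)) (collapseList f (l.map e))
    rw [whiskerLeft_mulUnit, ih]

/-- The functor A ⊗ – is a left adjoint, and left adjoints preserve zero morphisms. This is the only
point at which closedness enters. -/
lemma whiskerLeft_zero_of_closed [MonoidalClosed V] [HasZeroMorphisms V] (A : V)
    {B B' : V} : A ◁ (0 : B ⟶ B') = 0 := by
  have := Functor.preservesZeroMorphisms_of_isLeftAdjoint (tensorLeft A)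
  exact (tensorLeft A).map_zero B B'

lemma mulUnit_zero_right [MonoidalClosed V] [HasZeroMorphisms V] {A B : V} (f : A ⟶ 𝟙_ V) :
    mulUnit f (0 : B ⟶ 𝟙_ V) = 0 := by
  rw [mulUnit, tensorHom_def', whiskerLeft_zero_of_closed, zero_comp, zero_comp]

variable [SymmetricCategory V]

lemma reorderHom_collapseList {J : Type} {X : J → V} (f : ∀ j, X j ⟶ 𝟙_ V) {l l' : List J}
    (h : l.Perm l') : reorderHom X h ≫ collapseList f l' = collapseList f l :=
  Reorder.hom_collapseList f _

/-- Each of the three constituents of `fibrewise` preserves products of morphisms to 𝟙: reordering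
by commutativity, bracketing by associativity, relabelling trivially. Hence a product may be
computed fibre by fibre. -/
lemma fibrewise_collapse {K I : Type} [Finite K] [Finite I] (g : K → I) {X : K → V}
    (f : ∀ k, X k ⟶ 𝟙_ V) :
    fibrewise g X ≫ collapse (fun i : I => collapse fun k : {k // g k = i} => f k.1) =
      collapse f := by
  have h : tensListHom (fun i => relabelList Subtype.val X (enum {k // g k = i})) (enum I) ≫
      collapse (fun i : I => collapse fun k : {k // g k = i} => f k.1) =
        collapseList (fun i => collapseList f (fibreList g i)) (enum I) := by
    refine (tensHom_collapse _ _).trans ?_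
    rw [collapse]
    congr 1
    funext i
    exact relabelList_collapseList Subtype.val f _
  rw [fibrewise, Category.assoc, Category.assoc, h, bracketList_collapseList,
    reorderHom_collapseList, collapse]

/-- A product with a single factor is that factor. `single` uses the right unitor and `collapse` the
left one; they agree on 𝟙. -/
lemma single_collapse {J : Type} [Finite J] [Subsingleton J] {X : J → V} (f : ∀ j, X j ⟶ 𝟙_ V)
    (j : J) : single X j ≫ f j = collapse f := by
  have h : (ρ_ (X j)).hom ≫ f j = collapseList f [j] := by
    simp [collapseList, unitors_equal]
  rw [single, Category.assoc, h, reorderHom_collapseList, collapse]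

/-- The middle-four interchange (ff')(gg') = (fg)(f'g'), which is the commutativity of the monoid 𝟙.
-/
lemma tensorμ_mulUnit {A B A' B' : V} (f : A ⟶ 𝟙_ V) (g : B ⟶ 𝟙_ V) (f' : A' ⟶ 𝟙_ V)
    (g' : B' ⟶ 𝟙_ V) :
    tensorμ A B A' B' ≫ mulUnit (mulUnit f f') (mulUnit g g') =
      mulUnit (mulUnit f g) (mulUnit f' g') := by
  have e {A B A' B' : V} (f : A ⟶ 𝟙_ V) (g : B ⟶ 𝟙_ V) (f' : A' ⟶ 𝟙_ V) (g' : B' ⟶ 𝟙_ V) :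
      mulUnit (mulUnit f f') (mulUnit g g') = ((f ⊗ₘ f') ⊗ₘ (g ⊗ₘ g')) ≫
        ((λ_ (𝟙_ V)).hom ▷ _) ≫ (λ_ (𝟙_ V ⊗ 𝟙_ V)).hom ≫ (λ_ (𝟙_ V)).hom := by
    rw [← leftUnitor_naturality, ← tensorHom_def_assoc, mulUnit, mulUnit, mulUnit,
      tensorHom_comp_tensorHom_assoc]
  -- By naturality of `tensorμ` only the case of identities is left, and that is the compatibility
  -- of the left unitor with the shuffle at 𝟙.
  have h := leftUnitor_monoidal (C := V) (𝟙_ V) (𝟙_ V)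
  rw [e, ← tensorμ_natural_assoc, ← reassoc_of% h, mulUnit, mulUnit, mulUnit,
    tensorHom_comp_tensorHom_assoc]

lemma zip_collapse {J : Type} [Finite J] {X Y : J → V} (f : ∀ j, X j ⟶ 𝟙_ V)
    (g : ∀ j, Y j ⟶ 𝟙_ V) :
    zip X Y ≫ collapse (fun j => mulUnit (f j) (g j)) = mulUnit (collapse f) (collapse g) := by
  have (l : List J) : zipList X Y l ≫ collapseList (fun j => mulUnit (f j) (g j)) l =
      mulUnit (collapseList f l) (collapseList g l) := by
    induction l with
    | nil => simp [zipList, collapseList, mulUnit]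
    | cons j l ih =>
      change (tensorμ (X j) (tensList X l) (Y j) (tensList Y l) ≫
        (X j ⊗ Y j) ◁ zipList X Y l) ≫ mulUnit (mulUnit (f j) (g j)) (collapseList _ l) =
          mulUnit (mulUnit (f j) (collapseList f l)) (mulUnit (g j) (collapseList g l))
      rw [Category.assoc, whiskerLeft_mulUnit, ih, tensorμ_mulUnit]
  exact this _

section Zero

variable [MonoidalClosed V] [HasZeroMorphisms V]

/-- The braiding moves the zero factor to the right, where closedness applies. -/
lemma mulUnit_zero_left {A B : V} (g : B ⟶ 𝟙_ V) : mulUnit (0 : A ⟶ 𝟙_ V) g = 0 := by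
  have h : mulUnit (0 : A ⟶ 𝟙_ V) g = (β_ A B).hom ≫ mulUnit g 0 := by
    rw [mulUnit, mulUnit, ← BraidedCategory.braiding_naturality_assoc]
    simp [← unitors_equal]
  rw [h, mulUnit_zero_right, comp_zero]

lemma collapse_eq_zero {J : Type} [Finite J] {X : J → V} {f : ∀ j, X j ⟶ 𝟙_ V} {j : J}
    (hj : f j = 0) : collapse f = 0 := by
  have (l : List J) (hl : j ∈ l) : collapseList f l = 0 := by
    induction l with
    | nil => simp at hl
    | cons k l ih =>
      change mulUnit (f k) (collapseList f l) = 0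
      rcases List.mem_cons.1 hl with rfl | h
      · rw [hj, mulUnit_zero_left]
      · rw [ih h, mulUnit_zero_right]
  exact this _ (mem_enum j)

end Zero

end Collapse

/-! ### Partitions induced on the set of blocks and on the single blocks of a partition. -/

section Quotients

/-- The partition of the set of blocks of `s` induced by a partition `w` which `s` refines. -/
def quoPartition {T : FinNE} (s w : Setoid T) : Setoid (blocks s) where
  -- This is meaningful for every `w`, even if `s` does not refine it: the alternative `a = b`
  -- supplies reflexivity when a block of `s` is not contained in a block of `w`.
  r a b := a = b ∨ ∀ x y, toBlocks s x = a → toBlocks s y = b → w x y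
  iseqv :=
    { refl := fun _ => Or.inl rfl
      symm := by
        rintro a b (h | h)
        · exact Or.inl h.symm
        · exact Or.inr fun x y hx hy => w.symm' (h y x hy hx)
      trans := by
        rintro a b c (rfl | h) (rfl | h')
        · exact Or.inl rfl
        · exact Or.inr h'
        · exact Or.inr h
        -- Transitivity passes through an element of the middle block, so it needs that blocks are
        -- nonempty.
        · obtain ⟨y, rfl⟩ := Quotient.exists_rep b
          exact Or.inr fun x z hx hz => w.trans' (h x y hx rfl) (h' y z rfl hz) }

lemma quoPartition_mono {T : FinNE} (s : Setoid T) : Monotone (quoPartition s) :=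
  fun _ _ hw _ _ => Or.imp_right fun h x y hx hy => hw (h x y hx hy)

/-- When `s` refines `w`, the relation `w` does not depend on representatives of blocks of `s`, and
the total definition is the usual quotient partition. -/
lemma quoPartition_toBlocks {T : FinNE} {s w : Setoid T} (h : s ≤ w) (x y : T) :
    quoPartition s w (toBlocks s x) (toBlocks s y) ↔ w x y := by
  refine ⟨?_, fun hxy => Or.inr fun x' y' hx hy => ?_⟩
  · rintro (hxy | hxy)
    · exact h (toBlocks_eq.1 hxy)
    · exact hxy x y rfl rfl
  · exact w.trans' (h (toBlocks_eq.1 hx)) (w.trans' hxy (w.symm' (h (toBlocks_eq.1 hy))))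

lemma quoPartition_comap {T : FinNE} (s : Setoid T) (r : Setoid (blocks s)) :
    quoPartition s (r.comap (toBlocks s)) = r := by
  have h : s ≤ r.comap (toBlocks s) := fun x y hxy => by
    change r (toBlocks s x) (toBlocks s y)
    rw [toBlocks_eq.2 hxy]
  ext a b
  obtain ⟨x, rfl⟩ := Quotient.exists_rep a
  obtain ⟨y, rfl⟩ := Quotient.exists_rep b
  exact quoPartition_toBlocks h x y

lemma comap_quoPartition {T : FinNE} {s w : Setoid T} (h : s ≤ w) :
    (quoPartition s w).comap (toBlocks s) = w := by
  ext x y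
  exact quoPartition_toBlocks h x y

/-- Equivariance of the quotient construction, for the action of bijections on the multiplication;
`w` need not be coarser than `s'`. -/
lemma quoPartition_pushforward {T T' : FinNE} (σ : T ≃ T') {s : Setoid T} {s' : Setoid T'}
    (h : ∀ x y, s x y ↔ s' (σ x) (σ y)) (w : Setoid T') :
    (quoPartition s' w).comap (blocksMap σ h) = quoPartition s (w.comap σ) := by
  have hb (x : T) (a : Quotient s) : toBlocks s' (σ x) = blocksMap σ h a ↔ toBlocks s x = a := by
    rw [show toBlocks s' (σ x) = blocksMap σ h (toBlocks s x) from rfl]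
    exact (blocksMap σ h).apply_eq_iff_eq
  ext a b
  refine or_congr (blocksMap σ h).apply_eq_iff_eq ⟨fun H x y hx hy => ?_, fun H x y hx hy => ?_⟩
  · exact H _ _ ((hb x a).2 hx) ((hb y b).2 hy)
  · obtain ⟨x, rfl⟩ := σ.surjective x
    obtain ⟨y, rfl⟩ := σ.surjective y
    exact H x y ((hb x a).1 hx) ((hb y b).1 hy)

/-- Two elements of one block of `s` are related by the restriction of `w` to that block. -/
lemma le_of_restrictPartition {T : FinNE} {s w : Setoid T}
    (h : ∀ j : Quotient s, restrictPartition w j = ⊤) : s ≤ w := fun x y hxy => by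
  have : restrictPartition w (Quotient.mk s x)
      (⟨x, rfl⟩ : {z : T // Quotient.mk s z = Quotient.mk s x})
      (⟨y, (Quotient.sound hxy).symm⟩ : {z : T // Quotient.mk s z = Quotient.mk s x}) := by
    rw [h]
    trivial
  exact this

/-- With `restrict_sumPartition`: refinements of `s` are the same as families of partitions of its
blocks. This is the fine half of a decomposition γ ∘ (β_j), while `quoPartition_comap` and
`comap_quoPartition` are the coarse half. -/
lemma sumPartition_restrict {T : FinNE} {s w : Setoid T} (h : w ≤ s) :
    (sumPartition s fun j => restrictPartition w j) = w := by
  ext x y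
  refine ⟨fun ⟨_, _, _, hxy⟩ => hxy, fun hxy => ⟨_, rfl, (Quotient.sound (h hxy)).symm, hxy⟩⟩

lemma restrict_sumPartition {T : FinNE} (s : Setoid T) (μ : ∀ j : Quotient s, Setoid (block s j))
    (j : Quotient s) : restrictPartition (sumPartition s μ) j = μ j := by
  ext a b
  exact sumPartition_iff s μ j a b

end Quotients

/-! ### Projections of C(S) indexed by arbitrary sequences of partitions. -/

section SequenceProjections

open SimplexCategory (mk)

variable (V : Type u) [Category.{v} V] [MonoidalCategory V] [HasFiniteProducts V]
  [HasZeroMorphisms V]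

open Classical in
/-- The projection of `C(S)^k[T]` to the factor of a sequence of partitions, which is zero if the
sequence is not a chain from the partition with one block to the partition into singletons. -/
def seqπ {T : FinNE} {k : ℕ} (u : Fin (k + 1) → Setoid T) : (cobarLevel V k).obj T ⟶ 𝟙_ V :=
  -- The choice is harmless, since a chain is determined by its terms.
  if h : ∃ γ : NChain T k, γ.part = u then cobarπ V h.choose else 0

lemma seqπ_part {T : FinNE} {k : ℕ} (γ : NChain T k) : seqπ V γ.part = cobarπ V γ := by
  have h : ∃ γ' : NChain T k, γ'.part = γ.part := ⟨γ, rfl⟩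
  rw [seqπ, dif_pos h]
  congr 1
  exact NChain.ext h.choose_spec

lemma seqπ_eq_zero {T : FinNE} {k : ℕ} {u : Fin (k + 1) → Setoid T}
    (h : ¬ ∃ γ : NChain T k, γ.part = u) : seqπ V u = 0 := dif_neg h

lemma exists_chain {T : FinNE} {k : ℕ} {u : Fin (k + 1) → Setoid T} (hu : Antitone u)
    (h0 : u 0 = ⊤) (h1 : u (Fin.last k) = ⊥) : ∃ γ : NChain T k, γ.part = u :=
  ⟨⟨u, hu, h0, h1⟩, rfl⟩

/-- For a chain this is the definition of the cosimplicial structure, basepoint included. For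
another antitone sequence both sides vanish: if the reindexed sequence runs from min to max, then so
does `u`. Monotonicity is essential here, since reindexing could forget terms that are out of order.
-/
lemma levelMap_seqπ {m n : ℕ} (f : mk m ⟶ mk n) {T : FinNE} {u : Fin (n + 1) → Setoid T}
    (hu : Antitone u) :
    (cobarLevelMap V f).app T ≫ seqπ V u = seqπ V fun i : Fin (m + 1) => u (f.toOrderHom i) := by
  by_cases h : ∃ γ : NChain T n, γ.part = u
  · obtain ⟨γ, rfl⟩ := h
    rw [seqπ_part, cobarLevelMap_π]
    rcases hγ : γ.pull f with _ | γ'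
    · refine (seqπ_eq_zero V ?_).symm
      rintro ⟨γ', h'⟩
      rw [(NChain.pull_eq_some f γ γ').2 (congrFun h')] at hγ
      cases hγ
    · rw [← funext ((NChain.pull_eq_some f γ γ').1 hγ), seqπ_part]
      rfl
  · rw [seqπ_eq_zero V h, comp_zero, seqπ_eq_zero]
    rintro ⟨γ', h'⟩
    -- The outer terms of `u` are squeezed: `u 0` lies above the first chosen term, which is `⊤`,
    -- and the last term of `u` lies below the last chosen one, which is `⊥`.
    refine h (exists_chain hu (top_le_iff.1 ?_) (le_bot_iff.1 ?_))
    · rw [← γ'.first, h']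
      exact hu (Fin.zero_le _)
    · rw [← γ'.last, h']
      exact hu (Fin.le_last _)

/-- A bijection transports chains in both directions, so being a chain is preserved and reflected,
and no monotonicity of `u` is needed. -/
lemma map_seqπ {T T' : FinNE} (σ : T ⟶ T') {k : ℕ} (u : Fin (k + 1) → Setoid T') :
    (cobarLevel V k).map σ ≫ seqπ V u = seqπ V fun i => (u i).comap σ.equiv := by
  by_cases h : ∃ γ : NChain T' k, γ.part = u
  · obtain ⟨γ, rfl⟩ := h
    rw [seqπ_part, cobarLevel_map_π, ← seqπ_part]
    rfl
  · rw [seqπ_eq_zero V h, comp_zero, seqπ_eq_zero]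
    rintro ⟨γ, hγ⟩
    refine h ⟨γ.comap (FinNE.ofEquiv σ.equiv.symm), funext fun i => ?_⟩
    change (γ.part i).comap σ.equiv.symm = u i
    rw [hγ]
    ext x y
    change u i (σ.equiv (σ.equiv.symm x)) (σ.equiv (σ.equiv.symm y)) ↔ _
    rw [σ.equiv.apply_symm_apply, σ.equiv.apply_symm_apply]

lemma map_ofEquiv_seqπ {T T' : FinNE} (σ : T ≃ T') {k : ℕ} (u : Fin (k + 1) → Setoid T') :
    (cobarLevel V k).map (FinNE.ofEquiv σ) ≫ seqπ V u = seqπ V fun i => (u i).comap σ :=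
  map_seqπ V _ u

variable [SymmetricCategory V] [HasFiniteCoproducts V]

/-- A one-element set has a single partition, which is both min and max, so every sequence is a
chain. -/
lemma unitLevel_seqπ_of_subsingleton {T : FinNE} [Subsingleton T] {k : ℕ}
    (u : Fin (k + 1) → Setoid T) : (cobarUnitLevel V k).app T ≫ seqπ V u = unitε T := by
  have hs : ∀ r r' : Setoid T, r = r' := fun r r' => by
    ext x y
    rw [Subsingleton.elim x y]
    exact iff_of_true (Setoid.refl' _ _) (Setoid.refl' _ _)
  obtain ⟨γ, rfl⟩ := exists_chain (u := u) (fun _ _ _ => (hs _ _).le) (hs _ _) (hs _ _)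
  rw [seqπ_part, cobarUnitLevel_π]

/-- Here I[T] is an empty coproduct, and any two morphisms out of it agree. -/
lemma unitLevel_seqπ_of_not_subsingleton {T : FinNE} (h : ¬ Subsingleton T) {k : ℕ}
    (u : Fin (k + 1) → Setoid T) : (cobarUnitLevel V k).app T ≫ seqπ V u = 0 :=
  Sigma.hom_ext _ _ fun hT => absurd hT.down h

end SequenceProjections

/-! ### The maps m_{p,q} in terms of initial and final segments of sequences. -/

section Multiplication

open SimplexCategory (mk)

variable (V : Type u) [Category.{v} V] [MonoidalCategory V] [HasFiniteProducts V]
  [HasZeroMorphisms V] [SymmetricCategory V]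

/-- The product of the projections to the factor of the sequence induced by `u` on the set of blocks
of `s` and to the factors of the sequences induced by `v` on the blocks of `s`. -/
def compSeqπ {T : FinNE} {p q : ℕ} (s : Setoid T) (u : Fin (p + 1) → Setoid T)
    (v : Fin (q + 1) → Setoid T) : compSummand (cobarLevel V p) (cobarLevel V q) s ⟶ 𝟙_ V :=
  mulUnit (seqπ V fun i => quoPartition s (u i))
    (collapse fun j => seqπ V fun i => restrictPartition (v i) j)

/-- Quotients and restrictions of an antitone sequence are antitone, so `levelMap_seqπ` applies to
each factor. -/
lemma compSummandHom_compSeqπ {T : FinNE} {p q p' q' : ℕ} (s : Setoid T) (a : mk p ⟶ mk p')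
    (b : mk q ⟶ mk q') {u : Fin (p' + 1) → Setoid T} {v : Fin (q' + 1) → Setoid T}
    (hu : Antitone u) (hv : Antitone v) :
    compSummandHom (cobarLevelMap V a) (cobarLevelMap V b) s ≫ compSeqπ V s u v =
      compSeqπ V s (fun i : Fin (p + 1) => u (a.toOrderHom i))
        fun i : Fin (q + 1) => v (b.toOrderHom i) := by
  have hq : Antitone fun i => quoPartition s (u i) := fun _ _ h => quoPartition_mono s (hu h)
  have hr (j : Quotient s) : Antitone fun i => restrictPartition (v i) j :=
    fun _ _ h _ _ hxy => hv h hxy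
  rw [compSummandHom, compSeqπ, tensorHom_mulUnit, levelMap_seqπ V a hq, tensHom_collapse]
  simp only [levelMap_seqπ V b (hr _)]
  rfl

lemma compSummandMap_compSeqπ {T T' : FinNE} {p q : ℕ} (σ : T ≃ T') {s : Setoid T}
    {s' : Setoid T'} (h : ∀ x y, s x y ↔ s' (σ x) (σ y)) (u : Fin (p + 1) → Setoid T')
    (v : Fin (q + 1) → Setoid T') :
    compSummandMap (cobarLevel V p) (cobarLevel V q) σ h ≫ compSeqπ V s' u v =
      compSeqπ V s (fun i => (u i).comap σ) fun i => (v i).comap σ := by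
  rw [compSummandMap, compSeqπ, tensorHom_mulUnit,
    map_ofEquiv_seqπ V (T := blocks s) (T' := blocks s') (blocksMap σ h),
    tensMap_collapse (blocksMap σ h) _ _ _ fun j => map_ofEquiv_seqπ V _ _]
  exact congrArg (fun f => mulUnit (seqπ V f) _)
    (funext fun i => quoPartition_pushforward σ h (u i))

/-- The terms `w₀, …, w_p` of a sequence. -/
def initialSeq {T : FinNE} {n : ℕ} (w : Fin (n + 1) → Setoid T) (p q : ℕ) (h : p + q = n) :
    Fin (p + 1) → Setoid T :=
  fun i => w ((initialMap p n (by lia)).toOrderHom i)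

/-- The terms `w_p, …, w_n` of a sequence. -/
def finalSeq {T : FinNE} {n : ℕ} (w : Fin (n + 1) → Setoid T) (p q : ℕ) (h : p + q = n) :
    Fin (q + 1) → Setoid T :=
  fun i => w ((finalMap p q n h).toOrderHom i)

lemma antitone_initialSeq {T : FinNE} {n : ℕ} {w : Fin (n + 1) → Setoid T} (hw : Antitone w)
    (p q : ℕ) (h : p + q = n) : Antitone (initialSeq w p q h) :=
  fun _ _ hij => hw ((initialMap p n (by lia)).toOrderHom.monotone hij)

lemma antitone_finalSeq {T : FinNE} {n : ℕ} {w : Fin (n + 1) → Setoid T} (hw : Antitone w)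
    (p q : ℕ) (h : p + q = n) : Antitone (finalSeq w p q h) :=
  fun _ _ hij => hw ((finalMap p q n h).toOrderHom.monotone hij)

/-- The two segments overlap in the term `w_p`, the one that has to equal `s`. -/
lemma initialSeq_last {T : FinNE} {n : ℕ} (w : Fin (n + 1) → Setoid T) (p q : ℕ)
    (h : p + q = n) : initialSeq w p q h (Fin.last p) = finalSeq w p q h 0 := rfl

/-- A factor that is not a chain is zero and annihilates the whole product. -/
lemma compSeqπ_ne_zero [MonoidalClosed V] {T : FinNE} {p q : ℕ} {s : Setoid T}
    {u : Fin (p + 1) → Setoid T} {v : Fin (q + 1) → Setoid T} (h : compSeqπ V s u v ≠ 0) :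
    (∃ γ : NChain (blocks s) p, γ.part = fun i => quoPartition s (u i)) ∧
      ∀ j, ∃ β : NChain (block s j) q, β.part = fun i => restrictPartition (v i) j := by
  constructor
  · by_contra h'
    exact h (by rw [compSeqπ, seqπ_eq_zero V h', mulUnit_zero_left])
  · intro j
    by_contra h'
    refine h ?_
    rw [compSeqπ, collapse_eq_zero (j := j) (seqπ_eq_zero V h'), mulUnit_zero_right]

/-- The heart of the combinatorics. The end conditions on the pieces, read at the common index p,
force `w_p = s`. The terms before p are then coarser than `s` and recovered from the quotient, while
those after p are finer and recovered from the restrictions. -/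
lemma graft_eq_of_parts {T : FinNE} {p q : ℕ} {s : Setoid T} {w : Fin (p + q + 1) → Setoid T}
    (hw : Antitone w) {γ : NChain (blocks s) p} {β : ∀ j : Quotient s, NChain (block s j) q}
    (hγ : γ.part = fun i => quoPartition s (initialSeq w p q rfl i))
    (hβ : ∀ j, (β j).part = fun i => restrictPartition (finalSeq w p q rfl i) j) :
    (NChain.graft s γ β).part = w := by
  -- Each `β j` starts with the one-block partition of its block.
  have hle : s ≤ w ⟨p, by lia⟩ := le_of_restrictPartition fun j => by
    rw [← (β j).first, hβ]
    rfl
  -- The chain `γ` ends with singletons: elements related by `w_p` lie in the same block of `s`.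
  have hge : w ⟨p, by lia⟩ ≤ s := by
    have h := γ.last
    rw [hγ] at h
    change quoPartition s (initialSeq w p q rfl (Fin.last p)) = ⊥ at h
    intro x y hxy
    have := (quoPartition_toBlocks hle x y).2 hxy
    change quoPartition s (initialSeq w p q rfl (Fin.last p)) _ _ at this
    rw [h] at this
    exact toBlocks_eq.1 this
  funext i
  by_cases hi : i.1 ≤ p
  · refine (graftPart_of_le s γ β i ⟨i.1, by lia⟩ rfl).trans ?_
    rw [hγ]
    exact comap_quoPartition (hle.trans (hw hi))
  · refine (graftPart_of_lt s γ β i ⟨i.1 - p, by lia⟩ (by change i.1 = p + (i.1 - p); lia)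
      (by change i.1 - p ≠ 0; lia)).trans ?_
    have hi' : finalSeq w p q rfl ⟨i.1 - p, by lia⟩ = w i :=
      congrArg w (Fin.ext (by change p + (i.1 - p) = i.1; lia))
    simp only [hβ, hi']
    exact sumPartition_restrict ((hw (Fin.mk_le_of_le_val (by lia))).trans hge)

lemma graft_initialSeq {T : FinNE} {p q : ℕ} {s : Setoid T} (γ : NChain (blocks s) p)
    (β : ∀ j : Quotient s, NChain (block s j) q) (i : Fin (p + 1)) :
    quoPartition s (initialSeq (NChain.graft s γ β).part p q rfl i) = γ.part i := by
  rw [← quoPartition_comap s (γ.part i), ←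
    graftPart_of_le s γ β ((initialMap p (p + q) (by lia)).toOrderHom i) i rfl]
  rfl

/-- The converse of `graft_eq_of_parts` for the fine half: cutting a grafted chain returns the
pieces. -/
lemma graft_finalSeq {T : FinNE} {p q : ℕ} {s : Setoid T} (γ : NChain (blocks s) p)
    (β : ∀ j : Quotient s, NChain (block s j) q) (j : Quotient s) (i : Fin (q + 1)) :
    restrictPartition (finalSeq (NChain.graft s γ β).part p q rfl i) j = (β j).part i := by
  -- At the common index p the term of a graft is defined through `γ`. It is pulled back from the
  -- set of blocks, so on a single block it is `⊤`, the first term of `β j`.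
  by_cases hi : i = 0
  · subst hi
    rw [(β j).first, ← initialSeq_last]
    have h : initialSeq (NChain.graft s γ β).part p q rfl (Fin.last p) =
        (γ.part (Fin.last p)).comap (toBlocks s) := graftPart_of_le s γ β _ (Fin.last p) rfl
    rw [h]
    refine top_le_iff.1 fun a b _ => ?_
    change γ.part (Fin.last p) (toBlocks s a.1) (toBlocks s b.1)
    rw [show toBlocks s a.1 = toBlocks s b.1 from a.2.trans b.2.symm]
  · have h : finalSeq (NChain.graft s γ β).part p q rfl i =
        sumPartition s fun j => (β j).part i :=
      graftPart_of_lt s γ β _ i rfl fun h => hi (Fin.ext h)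
    rw [h, restrict_sumPartition]

/-- This replaces the decomposition map Ψ, with its basepoint, by a formula without cases. If γ'
decomposes, cutting gives back the two parts; if not, a nonzero right-hand side would produce a
decomposition by `graft_eq_of_parts`. -/
lemma cobarMulComponent_eq [MonoidalClosed V] {T : FinNE} {p q : ℕ} (s : Setoid T)
    (γ' : NChain T (p + q)) :
    cobarMulComponent V s γ' =
      compSeqπ V s (initialSeq γ'.part p q rfl) (finalSeq γ'.part p q rfl) := by
  by_cases h : ∃ x : NChain (blocks s) p × ∀ j : Quotient s, NChain (block s j) q,
      NChain.graft s x.1 x.2 = γ'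
  · have hx : γ'.ungraft s = some h.choose := dif_pos h
    have hc := h.choose_spec
    generalize h.choose = x at hx hc
    rw [cobarMulComponent, hx]
    subst hc
    simp only [compSeqπ, graft_initialSeq, graft_finalSeq, seqπ_part]
    rfl
  · have hx : γ'.ungraft s = none := dif_neg h
    rw [cobarMulComponent, hx]
    by_contra h'
    obtain ⟨⟨γ, hγ⟩, hβ⟩ := compSeqπ_ne_zero V (Ne.symm h')
    choose β hβ using hβ
    exact h ⟨(γ, β), NChain.ext (graft_eq_of_parts γ'.anti hγ hβ)⟩

variable [HasFiniteCoproducts V]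

/-- The morphism `C(S)^p ∘ C(S)^q ⟶ C(S)^n` for `p + q = n`. -/
def cobarMulHom (p q n : ℕ) (h : p + q = n) :
    comp (cobarLevel V p) (cobarLevel V q) ⟶ cobarLevel V n where
  app T := compDesc fun s => cobarLift fun γ =>
    compSeqπ V s (initialSeq γ.part p q h) (finalSeq γ.part p q h)
  naturality T T' σ := by
    refine comp_hom_ext fun s => cobar_hom_ext fun γ => ?_
    simp only [Category.assoc]
    rw [cobarLevel_map_π, reassoc_of% (compι_map (cobarLevel V p) (cobarLevel V q) σ
      (pushPartition_iff σ.equiv s)), ← Category.assoc (compι _ _ _), ← Category.assoc (compι _ _ _),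
      compι_desc, compι_desc, cobarLift_π, cobarLift_π, compSummandMap_compSeqπ]
    rfl

lemma compι_cobarMulHom_π {p q n : ℕ} (h : p + q = n) {T : FinNE} (s : Setoid T)
    (γ : NChain T n) :
    compι _ _ s ≫ (cobarMulHom V p q n h).app T ≫ cobarπ V γ =
      compSeqπ V s (initialSeq γ.part p q h) (finalSeq γ.part p q h) := by
  rw [← Category.assoc, cobarMulHom, compι_desc, cobarLift_π]

/-- The extension from chains to antitone sequences is what makes iteration possible: sequences
obtained from a chain by reindexing, quotient or restriction need not be chains. If `w` is not a
chain, neither are all of its pieces, and both sides are zero. -/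
lemma compι_cobarMulHom [MonoidalClosed V] {p q n : ℕ} (h : p + q = n) {T : FinNE} (s : Setoid T)
    {w : Fin (n + 1) → Setoid T} (hw : Antitone w) :
    compι _ _ s ≫ (cobarMulHom V p q n h).app T ≫ seqπ V w =
      compSeqπ V s (initialSeq w p q h) (finalSeq w p q h) := by
  by_cases hγ : ∃ γ : NChain T n, γ.part = w
  · obtain ⟨γ, rfl⟩ := hγ
    rw [seqπ_part, compι_cobarMulHom_π]
  · rw [seqπ_eq_zero V hγ, comp_zero, comp_zero]
    by_contra h'
    obtain ⟨⟨γ, hγ'⟩, hβ⟩ := compSeqπ_ne_zero V (Ne.symm h')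
    choose β hβ using hβ
    subst h
    exact hγ ⟨_, graft_eq_of_parts hw hγ' hβ⟩

/-- The link with the m_{p,q} of the statement, which are defined through Ψ. -/
lemma cobarMulHom_app [MonoidalClosed V] (p q : ℕ) (T : FinNE) :
    (cobarMulHom V p q (p + q) rfl).app T = cobarMul V p q T := by
  refine comp_hom_ext fun s => cobar_hom_ext fun γ => ?_
  rw [Category.assoc, compι_cobarMulHom_π, ← cobarMulComponent_eq]
  refine Eq.symm ((congrArg (· ≫ _) (compι_desc _ s)).trans ?_)
  exact cobarLift_π V _ γ

end Multiplication

/-! ### The multiplication on the box product and the unit laws. -/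

section MonoidStructure

open SimplexCategory (mk)

lemma circι_circMap {V : Type u} [Category.{v} V] [MonoidalCategory V] [SymmetricCategory V]
    [HasFiniteCoproducts V] [HasCoequalizers V] {X X' Y Y' : SimplexCategory ⥤ SymSeq V}
    (φ : X ⟶ X') (ψ : Y ⟶ Y') {n : ℕ} (p q : ℕ) (h : p + q = n) :
    circι X Y p q h ≫ (circMap φ ψ).app (mk n) =
      compMap (φ.app (mk p)) (ψ.app (mk q)) ≫ circι X' Y' p q h := by
  refine (boxι_levelHom compFunctor φ ψ p q h).trans (congrArg (· ≫ _) ?_)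
  refine (compMap_comp _ _ _ _).trans ?_
  rw [Category.comp_id, Category.id_comp]

variable (V : Type u) [Category.{v} V] [MonoidalCategory V] [HasFiniteProducts V]
  [HasZeroMorphisms V] [SymmetricCategory V] [HasFiniteCoproducts V]

lemma compMap_cobarMulHom_π {p q p' q' n : ℕ} (h : p' + q' = n) (a : mk p ⟶ mk p')
    (b : mk q ⟶ mk q') {T : FinNE} (s : Setoid T) (γ : NChain T n) :
    compι _ _ s ≫ (compMap (cobarLevelMap V a) (cobarLevelMap V b) ≫
        cobarMulHom V p' q' n h).app T ≫ cobarπ V γ =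
      compSeqπ V s (fun i : Fin (p + 1) => initialSeq γ.part p' q' h (a.toOrderHom i))
        fun i : Fin (q + 1) => finalSeq γ.part p' q' h (b.toOrderHom i) := by
  rw [NatTrans.comp_app, Category.assoc, ← Category.assoc, compι_compMap, Category.assoc,
    compι_cobarMulHom_π, compSummandHom_compSeqπ V s a b (antitone_initialSeq γ.anti _ _ _)
      (antitone_finalSeq γ.anti _ _ _)]

/-- At γ both sides use the terms 0, …, p on the blocks of s and the terms p+1, …, n inside them.
The face d⁰ drops the shared term of the final segment, and the last face drops that of the initial
one. -/
lemma compMap_cobarMulHom_condition {n : ℕ} (p q : ℕ) (h : p + (q + 1) = n)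
    (h' : p + 1 + q = n) :
    compMap (𝟙 _) (cobarLevelMap V (SimplexCategory.δ 0)) ≫ cobarMulHom V p (q + 1) n h =
      compMap (cobarLevelMap V (SimplexCategory.δ (Fin.last _))) (𝟙 _) ≫
        cobarMulHom V (p + 1) q n h' := by
  -- The identities are viewed as cosimplicial operators, so that one formula covers both sides.
  rw [← cobarLevelMap_id, ← cobarLevelMap_id]
  ext T : 2
  refine comp_hom_ext fun s => cobar_hom_ext fun γ => ?_
  rw [Category.assoc, Category.assoc, compMap_cobarMulHom_π, compMap_cobarMulHom_π]
  congr 1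
  · funext i
    refine congrArg γ.part (Fin.ext ?_)
    exact (δ_last_val p i).symm
  · funext i
    refine congrArg γ.part (Fin.ext ?_)
    change p + (i.1 + 1) = p + 1 + i.1
    lia

/-- The only block is all of T, so restricting to it changes nothing, and the product over blocks
has one factor. -/
lemma leftUnitSummand_seqπ {T : FinNE} {q : ℕ} (s : Setoid T) [Subsingleton (Quotient s)]
    (v : Fin (q + 1) → Setoid T) :
    leftUnitSummand (cobarLevel V q) s ≫ seqπ V v =
      mulUnit (unitε (blocks s)) (collapse fun j => seqπ V fun i => restrictPartition (v i) j) := by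
  rw [leftUnitSummand_eq _ s (Quotient.mk s (Classical.arbitrary T)), Category.assoc,
    ← leftUnitor_naturality, tensorHom_comp_whiskerLeft_assoc, Category.assoc,
    map_ofEquiv_seqπ V (wholeBlock s _), ← single_collapse _ (Quotient.mk s (Classical.arbitrary T))]
  rfl

/-- A partition into singletons refines every `w`, so the quotient partition is `w` itself under T/s
≅ T. -/
lemma quoPartition_eq_comap_discreteBlocks {T : FinNE} {s : Setoid T} (h : ∀ x y, s x y → x = y)
    (w : Setoid T) : quoPartition s w = w.comap (discreteBlocks s h) := by
  have hs : s ≤ w := fun x y hxy => by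
    rw [h x y hxy]
  ext a b
  obtain ⟨x, rfl⟩ := Quotient.exists_rep a
  obtain ⟨y, rfl⟩ := Quotient.exists_rep b
  refine (quoPartition_toBlocks hs x y).trans ?_
  change _ ↔ w (discreteBlocks s h (Quotient.mk s x)) (discreteBlocks s h (Quotient.mk s y))
  rw [discreteBlocks_mk, discreteBlocks_mk]

lemma rightUnitSummand_seqπ {T : FinNE} {p : ℕ} {s : Setoid T} (h : ∀ x y, s x y → x = y)
    (u : Fin (p + 1) → Setoid T) :
    rightUnitSummand (cobarLevel V p) s ≫ seqπ V u =
      mulUnit (seqπ V fun i => quoPartition s (u i)) (collapse fun j => unitε (block s j)) := by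
  rw [rightUnitSummand, dif_pos h, Category.assoc, ← rightUnitor_naturality,
    tensorHom_comp_whiskerRight_assoc,
    map_ofEquiv_seqπ V (T := blocks s) (T' := T) (discreteBlocks s h), ← unitors_equal]
  simp only [quoPartition_eq_comap_discreteBlocks h]
  rfl

/-- The sequence `u` disappears: if `s` has one block, its projection is the canonical map whatever
`u` is, and otherwise I[T/s] is initial and both sides are zero. -/
lemma unitLevel_compSeqπ_left [MonoidalClosed V] {T : FinNE} {p q : ℕ} (s : Setoid T)
    (u : Fin (p + 1) → Setoid T) (v : Fin (q + 1) → Setoid T) :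
    compSummandHom (cobarUnitLevel V p) (𝟙 (cobarLevel V q)) s ≫ compSeqπ V s u v =
      leftUnitSummand (cobarLevel V q) s ≫ seqπ V v := by
  rw [compSummandHom, compSeqπ, tensorHom_mulUnit]
  simp only [NatTrans.id_app]
  rw [tensHom_id, Category.id_comp]
  by_cases hs : Subsingleton (Quotient s)
  · have : Subsingleton (blocks s) := hs
    rw [leftUnitSummand_seqπ, unitLevel_seqπ_of_subsingleton]
  · have hs' : ¬ Subsingleton (blocks s) := hs
    rw [leftUnitSummand, dif_neg hs, zero_comp, unitLevel_seqπ_of_not_subsingleton V hs',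
      mulUnit_zero_left]

/-- Dually, `v` disappears: if all blocks are singletons, each factor is canonical whatever `v` is,
and otherwise one block with two elements makes the product vanish. -/
lemma unitLevel_compSeqπ_right [MonoidalClosed V] {T : FinNE} {p q : ℕ} (s : Setoid T)
    (u : Fin (p + 1) → Setoid T) (v : Fin (q + 1) → Setoid T) :
    compSummandHom (𝟙 (cobarLevel V p)) (cobarUnitLevel V q) s ≫ compSeqπ V s u v =
      rightUnitSummand (cobarLevel V p) s ≫ seqπ V u := by
  rw [compSummandHom, compSeqπ, tensorHom_mulUnit, tensHom_collapse, NatTrans.id_app,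
    Category.id_comp]
  by_cases hs : ∀ x y, s x y → x = y
  · have (j : Quotient s) : Subsingleton (block s j) :=
      ⟨fun x y => Subtype.ext (hs _ _ (Quotient.exact (x.2.trans y.2.symm)))⟩
    rw [rightUnitSummand_seqπ V hs]
    simp only [unitLevel_seqπ_of_subsingleton]
  · rw [rightUnitSummand, dif_neg hs, zero_comp]
    push Not at hs
    obtain ⟨x, y, hxy, hne⟩ := hs
    have hj : ¬ Subsingleton (block s (Quotient.mk s x)) := fun h => hne <|
      congrArg Subtype.val (h.elim (⟨x, rfl⟩ : {z : T // Quotient.mk s z = Quotient.mk s x})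
        ⟨y, (Quotient.sound hxy).symm⟩)
    rw [collapse_eq_zero (j := Quotient.mk s x) (unitLevel_seqπ_of_not_subsingleton V hj _),
      mulUnit_zero_right]

variable [HasCoequalizers V]

/-- The multiplication `C(S) □ C(S) ⟶ C(S)`. -/
def cobarMulBox [MonoidalClosed V] : boxCirc (cobar V) (cobar V) ⟶ cobar V where
  app Δ := circDesc (X := cobar V) (Y := cobar V) (n := Δ.len) (W := cobarLevel V Δ.len)
    (fun p q h => cobarMulHom V p q Δ.len h)
    fun p q h h' => by
      have := compMap_cobarMulHom_condition V p q h h'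
      exact this
  naturality Δ Δ' f := by
    refine circ_hom_ext (n := Δ.len) fun p q h => ?_
    -- The operator `f` sends the cut p to p' = f(p), and `a`, `b` are its restrictions to the two
    -- sides of the cut.
    obtain ⟨p', q', h', a, b, ha, hb, key⟩ := circι_map (cobar V) (cobar V) f p q h
    refine (Category.assoc _ _ _).symm.trans ?_
    refine (congrArg (· ≫ _) key).trans ?_
    refine (Category.assoc _ _ _).trans ?_
    refine (congrArg (_ ≫ ·) (circι_desc _ _ _ _ _)).trans ?_
    refine Eq.trans ?_ (Category.assoc _ _ _)
    refine Eq.trans ?_ (congrArg (· ≫ _) (circι_desc _ _ _ _ _).symm)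
    change compMap (cobarLevelMap V a) (cobarLevelMap V b) ≫ cobarMulHom V p' q' Δ'.len h' =
      cobarMulHom V p q Δ.len h ≫ cobarLevelMap V (m := Δ.len) (n := Δ'.len) f
    ext T : 2
    refine comp_hom_ext fun s => cobar_hom_ext fun γ => ?_
    rw [Category.assoc, compMap_cobarMulHom_π, NatTrans.comp_app, Category.assoc, Category.assoc,
      -- The sequence γ ∘ f may fail to be a chain, which is why the formula for antitone sequences
      -- is used on this side. What remains is that cutting γ ∘ f at p is cutting γ at p' and
      -- reindexing by `a` and `b`.
      ← seqπ_part, levelMap_seqπ V _ γ.anti,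
      compι_cobarMulHom V h s fun _ _ hij => γ.anti (f.toOrderHom.monotone hij)]
    congr 1
    · funext i
      exact congrArg (fun g => γ.part (g.toOrderHom i)) ha
    · funext i
      exact congrArg (fun g => γ.part (g.toOrderHom i)) hb

lemma circι_cobarMulBox [MonoidalClosed V] {n : ℕ} (p q : ℕ) (h : p + q = n) :
    circι (cobar V) (cobar V) p q h ≫ (cobarMulBox V).app (mk n) = cobarMulHom V p q n h :=
  circι_desc _ _ _ _ _

/-- On I ∘ C(S)^q both sides project to the final segment of γ, which is the reindexing by which
`boxLeftUnit` is defined. -/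
lemma cobar_one_mul [MonoidalClosed V] :
    circMap (cobarUnit V) (𝟙 (cobar V)) ≫ cobarMulBox V = boxLeftUnit (cobar V) := by
  ext Δ : 2
  refine circ_hom_ext (n := Δ.len) fun p q h => ?_
  refine (Category.assoc _ _ _).symm.trans ?_
  refine (congrArg (· ≫ _) (circι_circMap (cobarUnit V) (𝟙 (cobar V)) p q h)).trans ?_
  refine (Category.assoc _ _ _).trans ?_
  refine (congrArg (_ ≫ ·) (circι_cobarMulBox V p q h)).trans ?_
  refine Eq.trans ?_ (circι_desc _ _ _ _ _).symm
  change compMap (cobarUnitLevel V p) (𝟙 (cobarLevel V q)) ≫ cobarMulHom V p q Δ.len h =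
    compLeftUnit (cobarLevel V q) ≫ cobarLevelMap V (finalMap p q Δ.len h)
  ext T : 2
  refine comp_hom_ext fun s => cobar_hom_ext fun γ => ?_
  simp only [NatTrans.comp_app, Category.assoc]
  rw [← Category.assoc, compι_compMap, Category.assoc, compι_cobarMulHom_π,
    unitLevel_compSeqπ_left, ← seqπ_part, levelMap_seqπ V _ γ.anti,
    ← Category.assoc (compι _ _ _), compι_leftUnit]
  rfl

lemma cobar_mul_one [MonoidalClosed V] :
    circMap (𝟙 (cobar V)) (cobarUnit V) ≫ cobarMulBox V = boxRightUnit (cobar V) := by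
  ext Δ : 2
  refine circ_hom_ext (n := Δ.len) fun p q h => ?_
  refine (Category.assoc _ _ _).symm.trans ?_
  refine (congrArg (· ≫ _) (circι_circMap (𝟙 (cobar V)) (cobarUnit V) p q h)).trans ?_
  refine (Category.assoc _ _ _).trans ?_
  refine (congrArg (_ ≫ ·) (circι_cobarMulBox V p q h)).trans ?_
  refine Eq.trans ?_ (circι_desc _ _ _ _ _).symm
  change compMap (𝟙 (cobarLevel V p)) (cobarUnitLevel V q) ≫ cobarMulHom V p q Δ.len h =
    compRightUnit (cobarLevel V p) ≫ cobarLevelMap V (initialMap p Δ.len (by lia))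
  ext T : 2
  refine comp_hom_ext fun s => cobar_hom_ext fun γ => ?_
  simp only [NatTrans.comp_app, Category.assoc]
  rw [← Category.assoc, compι_compMap, Category.assoc, compι_cobarMulHom_π,
    unitLevel_compSeqπ_right, ← seqπ_part, levelMap_seqπ V _ γ.anti,
    ← Category.assoc (compι _ _ _), compι_rightUnit]
  rfl

end MonoidStructure

/-! ### Associativity: both composites read three consecutive segments of a chain. -/

section Associativity

open SimplexCategory (mk)

/-- The partition of the set of blocks of `t` in a block of `s` induced by a partition `w`. -/
def blocksInPartition {T : FinNE} {s t : Setoid T} (h : t ≤ s) (w : Setoid T) (i : Quotient s) :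
    Setoid (blocksIn h i) :=
  (quoPartition t w).comap (Subtype.val : {j : Quotient t // coarsen h j = i} → Quotient t)

/-- The quotient by `s` may be formed in two stages, through the blocks of `t`. This holds for
arbitrary `w`, so associativity needs no case distinction about `w`. -/
lemma quoPartition_comap_quotientBlocks {T : FinNE} {s t : Setoid T} (h : t ≤ s) (w : Setoid T) :
    (quoPartition (quotientPartition h) (quoPartition t w)).comap (quotientBlocks h) =
      quoPartition s w := by
  have hb (j : Quotient t) (a : Quotient s) :
      toBlocks (quotientPartition h) j = quotientBlocks h a ↔ coarsen h j = a := by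
    rw [show toBlocks (quotientPartition h) j = quotientBlocks h (coarsen h j) from
      (quotientBlocks_coarsen h j).symm]
    exact (quotientBlocks h).apply_eq_iff_eq
  ext a b
  change quotientBlocks h a = quotientBlocks h b ∨ _ ↔ _ ∨ _
  rw [(quotientBlocks h).apply_eq_iff_eq]
  -- For distinct blocks of `s`, a block of `t` in one cannot equal a block of `t` in the other, so
  -- the reflexive clause of the inner quotient plays no role.
  by_cases hab : a = b
  · exact iff_of_true (Or.inl hab) (Or.inl hab)
  refine or_congr Iff.rfl ⟨fun H x y hx hy => ?_, fun H j k hj hk => ?_⟩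
  · have hx' : coarsen h (toBlocks t x) = a := hx
    have hy' : coarsen h (toBlocks t y) = b := hy
    rcases H _ _ ((hb _ a).2 hx') ((hb _ b).2 hy') with hxy | hxy
    · exact absurd (hx'.symm.trans ((congrArg (coarsen h) hxy).trans hy')) hab
    · exact hxy x y rfl rfl
  · have hj' := (hb j a).1 hj
    have hk' := (hb k b).1 hk
    refine Or.inr fun x y hx hy => H x y ?_ ?_
    · rw [← hj', ← hx]
      rfl
    · rw [← hk', ← hy]
      rfl

/-- Quotient by `t` and restriction to a block of `s` commute, again for arbitrary `w`: this matches
the middle segment in the two bracketings. -/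
lemma quoPartition_comap_restrictBlocks {T : FinNE} {s t : Setoid T} (h : t ≤ s) (w : Setoid T)
    (i : Quotient s) :
    (quoPartition (restrictPartition t i) (restrictPartition w i)).comap (restrictBlocks h i) =
      blocksInPartition h w i := by
  have hb (x : block s i) (a : blocksIn h i) :
      toBlocks (restrictPartition t i) x = restrictBlocks h i a ↔ toBlocks t x.1 = a.1 := by
    rw [show toBlocks (restrictPartition t i) x =
      restrictBlocks h i (restrictBlocksFun h i (Quotient.mk _ x)) from
        (restrictBlocks_mk h i x).symm]
    exact (restrictBlocks h i).apply_eq_iff_eq.trans Subtype.ext_iff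
  ext a b
  change restrictBlocks h i a = restrictBlocks h i b ∨ _ ↔ a.1 = b.1 ∨ _
  rw [(restrictBlocks h i).apply_eq_iff_eq]
  refine or_congr Subtype.ext_iff ⟨fun H x y hx hy => ?_, fun H x y hx hy => ?_⟩
  -- All representatives of a block of `t` inside `i` lie in `i`, so quantifying over T or over `i`
  -- is the same.
  · have hx' : Quotient.mk s x = i := (congrArg (coarsen h) hx).trans a.2
    have hy' : Quotient.mk s y = i := (congrArg (coarsen h) hy).trans b.2
    exact H ⟨x, hx'⟩ ⟨y, hy'⟩ ((hb _ a).2 hx) ((hb _ b).2 hy)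
  · exact H x.1 y.1 ((hb x a).1 hx) ((hb y b).1 hy)

lemma box3_hom_ext {V : Type u} [Category.{v} V] [MonoidalCategory V] [SymmetricCategory V]
    [HasFiniteCoproducts V] [HasCoequalizers V] {X Y Z : SimplexCategory ⥤ SymSeq V}
    {T : FinNE} {n : ℕ} {W : V}
    {f g : box3 X Y Z T n ⟶ W}
    (h : ∀ (p q r : ℕ) (h : p + q + r = n), box3ι X Y Z T p q r h ≫ f =
      box3ι X Y Z T p q r h ≫ g) : f = g := by
  refine coequalizer.hom_ext (Sigma.hom_ext _ _ fun x => ?_)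
  have := h x.1.1 x.1.2.1 x.1.2.2 x.2
  rw [box3ι, Category.assoc, Category.assoc] at this
  exact this

variable (V : Type u) [Category.{v} V] [MonoidalCategory V] [HasFiniteProducts V]
  [HasZeroMorphisms V] [SymmetricCategory V]

/-- The product of the projections to the factors of the sequences induced by `u` on the set of
blocks of `s`, by `v` on the sets of blocks of `t` in the blocks of `s`, and by `w` on the blocks of
`t`, for a chain `(s, t)`. -/
def comp3Seqπ {T : FinNE} {p q r : ℕ} (c : Chain2 T) (u : Fin (p + 1) → Setoid T)
    (v : Fin (q + 1) → Setoid T) (w : Fin (r + 1) → Setoid T) :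
    comp3Summand (cobarLevel V p) (cobarLevel V q) (cobarLevel V r) c ⟶ 𝟙_ V :=
  mulUnit (seqπ V fun k => quoPartition c.1.1 (u k))
    (mulUnit (collapse fun i => seqπ V fun k => blocksInPartition c.2 (v k) i)
      (collapse fun j => seqπ V fun k => restrictPartition (w k) j))

variable [HasFiniteCoproducts V] [MonoidalClosed V]

/-- The inner multiplication of the left bracketing takes place on the blocks of `t`. The induced
sequence there is only known to be antitone, which is all that `compι_cobarMulHom` requires. -/
lemma regroupLeft_seqπ {p q m : ℕ} (h : p + q = m) {T : FinNE} (c : Chain2 T)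
    {x : Fin (m + 1) → Setoid T} (hx : Antitone x) :
    regroupLeft (cobarLevel V p) (cobarLevel V q) c ≫ (cobarMulHom V p q m h).app (blocks c.1.2) ≫
        seqπ V (fun k => quoPartition c.1.2 (x k)) =
      mulUnit (seqπ V fun k => quoPartition c.1.1 (initialSeq x p q h k))
        (collapse fun i => seqπ V fun k => blocksInPartition c.2 (finalSeq x p q h k) i) := by
  rw [regroupLeft, Category.assoc, compι_cobarMulHom V h _ fun _ _ hij =>
    quoPartition_mono _ (hx hij), compSeqπ, tensorHom_mulUnit,
    map_ofEquiv_seqπ V (T := blocks c.1.1) (T' := blocks (quotientPartition c.2))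
      (quotientBlocks c.2),
    tensMap_collapse (quotientBlocks c.2) _ _ _ fun j => map_ofEquiv_seqπ V _ _]
  exact congrArg (fun f => mulUnit (seqπ V f) _)
    (funext fun k => quoPartition_comap_quotientBlocks c.2 (initialSeq x p q h k))

/-- The inner multiplication of the right bracketing, one for each block `i` of `s`; the sequence is
restricted to `i` before it is cut. -/
lemma regroupRight_seqπ {q r m : ℕ} (h : q + r = m) {T : FinNE} (c : Chain2 T)
    (i : Quotient c.1.1) {x : Fin (m + 1) → Setoid T} (hx : Antitone x) :
    regroupRight (cobarLevel V q) (cobarLevel V r) c i ≫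
        (cobarMulHom V q r m h).app (block c.1.1 i) ≫
        seqπ V (fun k => restrictPartition (x k) i) =
      mulUnit (seqπ V fun k => blocksInPartition c.2 (initialSeq x q r h k) i)
        (collapse fun j : {j : Quotient c.1.2 // coarsen c.2 j = i} =>
          seqπ V fun k => restrictPartition (finalSeq x q r h k) j.1) := by
  rw [regroupRight, Category.assoc, compι_cobarMulHom V h (T := block c.1.1 i) _
    (w := fun k => restrictPartition (x k) i) fun _ _ hij _ _ hxy => hx hij hxy,
    compSeqπ, tensorHom_mulUnit,
    map_ofEquiv_seqπ V (T := blocksIn c.2 i) (T' := blocks (restrictPartition c.1.2 i))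
      (restrictBlocks c.2 i)]
  exact congrArg₂ mulUnit
    (congrArg (seqπ V)
      (funext fun k => quoPartition_comap_restrictBlocks c.2 (initialSeq x q r h k) i))
    (tensMap_collapse (J := {j : Quotient c.1.2 // coarsen c.2 j = i}) (restrictBlocks c.2 i) _ _ _
      fun j => map_ofEquiv_seqπ V (restrictBlock c.2 i j _ rfl) _)

lemma compAssocLeft_cobarMulHom {p q r m n : ℕ} (hm : p + q = m) (h : m + r = n) {T : FinNE}
    (c : Chain2 T) (γ : NChain T n) :
    comp3ι _ _ _ c ≫ compAssocLeft _ _ _ T ≫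
        (compMap (cobarMulHom V p q m hm) (𝟙 (cobarLevel V r)) ≫ cobarMulHom V m r n h).app T ≫
          cobarπ V γ =
      comp3Seqπ V c (initialSeq (initialSeq γ.part m r h) p q hm)
        (finalSeq (initialSeq γ.part m r h) p q hm) (finalSeq γ.part m r h) := by
  rw [compAssocLeft, ← Category.assoc, comp3ι_desc, NatTrans.comp_app]
  simp only [Category.assoc]
  rw [← Category.assoc (compι _ _ _), compι_compMap, Category.assoc, compι_cobarMulHom_π, compSeqπ,
    compSummandHom, tensorHom_mulUnit]
  simp only [NatTrans.id_app]
  rw [tensHom_id, Category.id_comp, whiskerRight_mulUnit,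
    regroupLeft_seqπ V hm c (antitone_initialSeq γ.anti m r h), associator_inv_mulUnit]
  rfl

/-- This bracketing groups the blocks of `t` by the blocks of `s` containing them. `zip_collapse`
separates the middle factors from the fine ones, and `fibrewise_collapse` undoes the grouping of the
latter. -/
lemma compAssocRight_cobarMulHom {p q r m n : ℕ} (hm : q + r = m) (h : p + m = n) {T : FinNE}
    (c : Chain2 T) (γ : NChain T n) :
    comp3ι _ _ _ c ≫ compAssocRight _ _ _ T ≫
        (compMap (𝟙 (cobarLevel V p)) (cobarMulHom V q r m hm) ≫ cobarMulHom V p m n h).app T ≫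
          cobarπ V γ =
      comp3Seqπ V c (initialSeq γ.part p m h) (initialSeq (finalSeq γ.part p m h) q r hm)
        (finalSeq (finalSeq γ.part p m h) q r hm) := by
  rw [compAssocRight, ← Category.assoc, comp3ι_desc, NatTrans.comp_app]
  simp only [Category.assoc]
  rw [← Category.assoc (compι _ _ _), compι_compMap, Category.assoc, compι_cobarMulHom_π, compSeqπ,
    compSummandHom, tensorHom_mulUnit, NatTrans.id_app, Category.id_comp, whiskerLeft_mulUnit,
    Category.assoc, Category.assoc, tensHom_collapse, tensHom_collapse]
  simp only [regroupRight_seqπ V hm c _ (antitone_finalSeq γ.anti p m h)]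
  rw [zip_collapse, whiskerLeft_mulUnit,
    fibrewise_collapse (coarsen c.2) fun j : Quotient c.1.2 =>
      seqπ V fun k => restrictPartition (finalSeq (finalSeq γ.part p m h) q r hm k) j]
  rfl

variable [HasCoequalizers V]

lemma circι_circMap_mul {X Y : SimplexCategory ⥤ SymSeq V} (φ : X ⟶ cobar V) (ψ : Y ⟶ cobar V)
    {n : ℕ} (p q : ℕ) (h : p + q = n) :
    circι X Y p q h ≫ (circMap φ ψ ≫ cobarMulBox V).app (mk n) =
      compMap (φ.app (mk p)) (ψ.app (mk q)) ≫ cobarMulHom V p q n h := by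
  rw [NatTrans.comp_app, ← Category.assoc, circι_circMap, Category.assoc, circι_cobarMulBox]
  rfl

/-- Restricted to one term of the triple box product, the two multiplications of C(S) become two
maps m_{p,q}; no chains are involved. -/
lemma assocLeftTerm_mul {p q r m n : ℕ} (hm : p + q = m) (h : m + r = n) (T : FinNE) :
    assocLeftTerm (cobar V) (cobar V) (cobar V) T p q r m hm h ≫
        ((circMap (cobarMulBox V) (𝟙 (cobar V)) ≫ cobarMulBox V).app (mk n)).app T =
      compAssocLeft _ _ _ T ≫
        (compMap (cobarMulHom V p q m hm) (𝟙 (cobarLevel V r)) ≫ cobarMulHom V m r n h).app T := by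
  rw [assocLeftTerm, Category.assoc, ← NatTrans.comp_app, Category.assoc, circι_circMap_mul]
  refine congrArg (fun f => _ ≫ NatTrans.app f T) ((Category.assoc _ _ _).symm.trans
    (congrArg (· ≫ _) ((compMap_comp _ _ _ _).trans ?_)))
  exact congrArg₂ compMap (circι_cobarMulBox V _ _ _) (Category.comp_id _)

lemma assocRightTerm_mul {p q r m n : ℕ} (hm : q + r = m) (h : p + m = n) (T : FinNE) :
    assocRightTerm (cobar V) (cobar V) (cobar V) T p q r m hm h ≫
        ((circMap (𝟙 (cobar V)) (cobarMulBox V) ≫ cobarMulBox V).app (mk n)).app T =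
      compAssocRight _ _ _ T ≫
        (compMap (𝟙 (cobarLevel V p)) (cobarMulHom V q r m hm) ≫ cobarMulHom V p m n h).app T := by
  rw [assocRightTerm, Category.assoc, ← NatTrans.comp_app, Category.assoc, circι_circMap_mul]
  refine congrArg (fun f => _ ≫ NatTrans.app f T) ((Category.assoc _ _ _).symm.trans
    (congrArg (· ≫ _) ((compMap_comp _ _ _ _).trans ?_)))
  exact congrArg₂ compMap (Category.comp_id _) (circι_cobarMulBox V _ _ _)

lemma cobar_mul_assoc (T : FinNE) (n : ℕ) :
    boxAssocRight (cobar V) (cobar V) (cobar V) T n ≫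
        ((circMap (𝟙 (cobar V)) (cobarMulBox V) ≫ cobarMulBox V).app (mk n)).app T =
      boxAssocLeft (cobar V) (cobar V) (cobar V) T n ≫
        ((circMap (cobarMulBox V) (𝟙 (cobar V)) ≫ cobarMulBox V).app (mk n)).app T := by
  refine box3_hom_ext fun p q r h => ?_
  rw [← Category.assoc, ← Category.assoc, boxAssocRight, boxAssocLeft, box3ι_desc, box3ι_desc,
    assocLeftTerm_mul, assocRightTerm_mul]
  refine comp3_hom_ext fun c => cobar_hom_ext (T := T) (k := n) fun γ => ?_
  have hl := compAssocLeft_cobarMulHom V (p := p) (q := q) rfl h c γ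
  have hr := compAssocRight_cobarMulHom V (q := q) (r := r) (p := p) rfl (by lia) c γ
  rw [Category.assoc, Category.assoc, Category.assoc, Category.assoc]
  refine hr.trans (Eq.trans ?_ hl.symm)
  -- The first two segments agree definitionally; for the third the offsets p + (q + k) and (p + q)
  -- + k have to be compared.
  congr 1
  funext k
  refine congrArg γ.part (Fin.ext ?_)
  change p + (q + k.1) = p + q + k.1
  lia

/-- The monoid structure of `C(S)`. -/
def cobarMonoid : BoxCircMonoid (cobar V) where
  mul := cobarMulBox V
  one := cobarUnit V
  assoc := cobar_mul_assoc V
  one_mul := cobar_one_mul V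
  mul_one := cobar_mul_one V

end Associativity

end BoxCirc

end

theorem mainTheorem3 (V : Type u) [Category.{v} V] [MonoidalCategory V] [SymmetricCategory V]
    [MonoidalClosed V] [HasZeroObject V] [HasZeroMorphisms V] [HasFiniteProducts V]
    [HasFiniteCoproducts V] [HasCoequalizers V] :
    ∃ M : BoxCirc.BoxCircMonoid (BoxCirc.cobar V),
      (∀ (p q : ℕ) (T : BoxCirc.FinNE),
        (BoxCirc.circι (BoxCirc.cobar V) (BoxCirc.cobar V) p q rfl).app T ≫
            (M.mul.app (SimplexCategory.mk (p + q))).app T =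
          BoxCirc.cobarMul V p q T) ∧
      M.one = BoxCirc.cobarUnit V := by
  refine ⟨BoxCirc.cobarMonoid V, fun p q T => ?_, rfl⟩
  rw [← BoxCirc.cobarMulHom_app, ← BoxCirc.circι_cobarMulBox]
  rfl
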